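/- Let $\xi=e^{2\pi i/3}$, $\Lambda=\mathbb Z^3\oplus\xi\mathbb Z^3\subset\mathbb C^3$ and $\mathbb A=(\mathbb C^3\times\mathbb R)/(\Lambda\times\mathbb Z)$. Let $\Gamma$ be the finite group of diffeomorphisms of $\mathbb A$ generated by $$\alpha(z,x)=(\xi z,\,x+\tfrac13),\qquad \beta(z,x)=(-\bar z,-x).$$ Identify $\mathbb C^2$ with $\mathbb R^4$ by the coordinates $(a_1,b_1,a_2,b_2)$ of $(a_1+ib_1,\,a_2+ib_2)$, put $T^3=\mathbb R^3/\mathbb Z^3$, and for $k\in\{0,1,2\}$, $e\in\{0,1\}$ let $$\tau_{k,e}:\mathbb C^2\times T^3\to\mathbb A,\qquad \tau_{k,e}(a_1+ib_1,a_2+ib_2,[y])=\bigl[\xi^k\bigl((a_1,b_1,a_2)+i\sqrt3\,y\bigr),\ \tfrac k3+\tfrac e2+b_2\bigr].$$ Let $T_{k,e}=\tau_{k,e}(\{0\}\times T^3)$. These are six disjoint 3-tori, $\tau_{k,e}$ restricts to a tubular coordinate system $\{|w|<\tfrac1{12}\}\times T^3\to\mathbb A$ around $T_{k,e}$, and $\alpha\circ\tau_{k,e}=\tau_{k+1,e}$,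 $\beta\circ\tau_{k,e}(w,p)=\tau_{-k,e}(-w,p)$ (with $k$ mod $3$). Let $Y$ be the real oriented blow-up of $\mathbb A$ along the six tori $T_{k,e}$; via $\tau_{k,e}$ its boundary components are copies of $S^3\times T^3$, where $S^3$ is the space of oriented real lines in $\mathbb C^2=\mathbb R^4$. Let $Y'$ be obtained from $Y$ by gluing to each boundary component a collar $[0,1]\times S^3\times T^3$ along $\{0\}\times S^3\times T^3$. Let $\tilde M$ be the quotient of $Y'$ by the Hopf collapse of each $\{1\}\times S^3\times T^3$: $(1,\ell_1,p)\sim(1,\ell_2,p)$ if $\ell_1,\ell_2$ lie in the same complex line of $\mathbb C^2$. The group $\Gamma$ acts on $Y$ by the extension of its action on $\mathbb A$, and this action extends to $Y'$, with $\alpha$ and $\beta$ acting on the collars by $(r,\sigma,p)\mapsto(r,\sigma,p)$ and $(r,\sigma,p)\mapsto(r,-\sigma,p)$ from the $(k,e)$-th collar to the $(k+1,e)$-th and the $(-k,e)$-th one, respectively. It descends to $\tilde M$. Let $M=\tilde M/\Gamma$, a compact Hausdorff space. Let $T\in SL(3,\mathbb Z)$ and let $\gamma:[0,1]\to SL(3,\mathbb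 R)$ be a continuous path with $\gamma(0)=T$ and $\gamma(1)=\mathrm{id}$. Let $f_Y:Y\to Y$ be the extension of $(z,x)\mapsto(Tz,x)$ to the blow-up. Let $f_{Y'}:Y'\to Y'$ be equal to $f_Y$ on $Y$ and to $$(r,\sigma,p)\mapsto\bigl(r,\,(\gamma(r)\oplus\mathrm{id})(\sigma),\,Tp\bigr)$$ on each collar, where $\gamma(r)\oplus\mathrm{id}$ acts on oriented lines in $\mathbb R^4=\mathbb R^3\oplus\mathbb R$. The map $f_{Y'}$ descends to $\tilde M$, commutes there with $\Gamma$, and so induces a map $f_T:M\to M$. **Theorem.** The map $f_T$ is a homeomorphism of the compact Hausdorff space $M$, and its topological entropy is $$h_{top}(f_T)=2\sum_{\substack{\lambda\in\operatorname{Spec}T\\|\lambda|>1}}\log|\lambda|,$$ the sum being over the complex eigenvalues $\lambda$ of $T$ with $|\lambda|>1$, counted with algebraic multiplicity. -/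

import Mathlib

open Matrix

noncomputable section

namespace JoyceManifold

/-! ### The torus and the two generators of the finite group -/

/-- The primitive cube root of unity `exp (2πi/3)`. -/
def xi : ℂ := Complex.exp (2 * Real.pi * Complex.I / 3)

lemma xi_pow_three : xi ^ 3 = 1 := by
  rw [xi, ← Complex.exp_nat_mul, Complex.exp_eq_one_iff]
  exact ⟨1, by push_cast; ring⟩

lemma xi_sq : xi ^ 2 = -1 - xi := by
  have hne : xi ≠ 1 := by
    intro h
    rw [xi, Complex.exp_eq_one_iff] at h
    obtain ⟨n, hn⟩ := h
    have hpi : (2 * Real.pi * Complex.I : ℂ) ≠ 0 := Complex.two_pi_I_ne_zero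
    have h3 : (1 : ℂ) = 3 * n := by
      apply mul_left_cancel₀ hpi
      linear_combination 3 * hn
    have h4 : (1 : ℤ) = 3 * n := by exact_mod_cast h3
    omega
  have h : (xi - 1) * (xi ^ 2 + xi + 1) = 0 := by linear_combination xi_pow_three
  rcases mul_eq_zero.mp h with h | h
  · exact absurd (sub_eq_zero.mp h) hne
  · linear_combination h

lemma conj_xi : (starRingEnd ℂ) xi = xi ^ 2 := by
  rw [xi, ← Complex.exp_conj, ← Complex.exp_nat_mul, Complex.exp_eq_exp_iff_exists_int]
  refine ⟨-1, ?_⟩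
  simp only [map_div₀, map_mul, Complex.conj_I, Complex.conj_ofReal, map_ofNat]
  push_cast
  ring

/-- The universal cover `ℂ³ × ℝ` of the torus. -/
abbrev V : Type := (Fin 3 → ℂ) × ℝ

/-- The lattice `ℤ³ ⊕ ξℤ³` in `ℂ³`. -/
def eisensteinLattice : AddSubgroup (Fin 3 → ℂ) where
  carrier := {z | ∃ m n : Fin 3 → ℤ, ∀ j, z j = m j + xi * n j}
  zero_mem' := ⟨0, 0, by simp⟩
  add_mem' := by
    rintro a b ⟨m, n, h⟩ ⟨m', n', h'⟩
    refine ⟨m + m', n + n', fun j => ?_⟩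
    simp only [Pi.add_apply, h, h', Int.cast_add]
    ring
  neg_mem' := by
    rintro a ⟨m, n, h⟩
    refine ⟨-m, -n, fun j => ?_⟩
    simp only [Pi.neg_apply, h, Int.cast_neg]
    ring

/-- The lattice `(ℤ³ ⊕ ξℤ³) × ℤ` in `ℂ³ × ℝ`. -/
def lattice : AddSubgroup V := eisensteinLattice.prod (AddSubgroup.zmultiples (1 : ℝ))

/-- The 7-torus `(ℂ³ × ℝ) / ((ℤ³ ⊕ ξℤ³) × ℤ)`. -/
abbrev Torus7 : Type := V ⧸ lattice

/-- The 3-dimensional lattice `ℤ³` in `ℝ³`. -/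
def intLattice : AddSubgroup (Fin 3 → ℝ) where
  carrier := {v | ∃ m : Fin 3 → ℤ, ∀ j, v j = m j}
  zero_mem' := ⟨0, by simp⟩
  add_mem' := by
    rintro a b ⟨m, h⟩ ⟨m', h'⟩
    exact ⟨m + m', fun j => by simp [h, h']⟩
  neg_mem' := by
    rintro a ⟨m, h⟩
    exact ⟨-m, fun j => by simp [h]⟩

/-- The 3-torus `ℝ³ / ℤ³`. -/
abbrev Torus3 : Type := (Fin 3 → ℝ) ⧸ intLattice

/-- `(z, x) ↦ (ξ z, x)` on `ℂ³ × ℝ`. -/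
def xiHom : V →+ V where
  toFun v := (fun j => xi * v.1 j, v.2)
  map_zero' := by ext <;> simp
  map_add' v w := by ext <;> simp [mul_add]

/-- `(z, x) ↦ (-z̄, -x)` on `ℂ³ × ℝ`. -/
def betaHom : V →+ V where
  toFun v := (fun j => -(starRingEnd ℂ) (v.1 j), -v.2)
  map_zero' := by ext <;> simp
  map_add' v w := by ext <;> simp <;> ring

/-- `(z, x) ↦ (T z, x)` on `ℂ³ × ℝ`. -/
def linHom (T : SpecialLinearGroup (Fin 3) ℤ) : V →+ V where
  toFun v := (fun i => ∑ j, (T.1 i j : ℂ) * v.1 j, v.2)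
  map_zero' := by ext <;> simp
  map_add' v w := by
    apply Prod.ext
    · funext i
      simp only [Prod.fst_add, Pi.add_apply, mul_add, Finset.sum_add_distrib]
    · simp

lemma xiHom_lattice : lattice ≤ lattice.comap xiHom := by
  rintro v ⟨⟨m, n, h⟩, hx⟩
  refine ⟨⟨-n, m - n, fun j => ?_⟩, hx⟩
  simp only [xiHom, AddMonoidHom.coe_mk, ZeroHom.coe_mk]
  rw [h j]
  simp only [Pi.neg_apply, Pi.sub_apply, Int.cast_neg, Int.cast_sub]
  linear_combination (n j : ℂ) * xi_sq

lemma betaHom_lattice : lattice ≤ lattice.comap betaHom := by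
  rintro v ⟨⟨m, n, h⟩, hx⟩
  refine ⟨⟨n - m, n, fun j => ?_⟩, AddSubgroup.neg_mem _ hx⟩
  change -(starRingEnd ℂ) (v.1 j) = _
  rw [h j]
  simp only [map_add, map_mul, conj_xi, map_intCast, Pi.sub_apply, Int.cast_sub]
  linear_combination -(n j : ℂ) * xi_sq

lemma linHom_lattice (T : SpecialLinearGroup (Fin 3) ℤ) :
    lattice ≤ lattice.comap (linHom T) := by
  rintro v ⟨⟨m, n, h⟩, hx⟩
  refine ⟨⟨fun i => ∑ j, T.1 i j * m j, fun i => ∑ j, T.1 i j * n j, fun i => ?_⟩, hx⟩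
  change ∑ j, (T.1 i j : ℂ) * v.1 j = _
  push_cast
  rw [Finset.mul_sum, ← Finset.sum_add_distrib]
  refine Finset.sum_congr rfl fun j _ => ?_
  rw [h j]
  ring

/-- The generator `α (z, x) = (ξ z, x + 1/3)` on the 7-torus. -/
def alpha (a : Torus7) : Torus7 :=
  QuotientAddGroup.map lattice lattice xiHom xiHom_lattice a +
    QuotientAddGroup.mk ((0, 1 / 3) : V)

/-- The generator `β (z, x) = (-z̄, -x)` on the 7-torus. -/
def beta (a : Torus7) : Torus7 :=
  QuotientAddGroup.map lattice lattice betaHom betaHom_lattice a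

/-- The action `T (z, x) = (T z, x)` of `SL(3, ℤ)` on the 7-torus. -/
def lin (T : SpecialLinearGroup (Fin 3) ℤ) (a : Torus7) : Torus7 :=
  QuotientAddGroup.map lattice lattice (linHom T) (linHom_lattice T) a

/-- The action of `SL(3, ℤ)` on `ℝ³`. -/
def linHom3 (T : SpecialLinearGroup (Fin 3) ℤ) : (Fin 3 → ℝ) →+ (Fin 3 → ℝ) where
  toFun v := fun i => ∑ j, (T.1 i j : ℝ) * v j
  map_zero' := by ext; simp
  map_add' v w := by
    funext i
    simp only [Pi.add_apply, mul_add, Finset.sum_add_distrib]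

lemma linHom3_lattice (T : SpecialLinearGroup (Fin 3) ℤ) :
    intLattice ≤ intLattice.comap (linHom3 T) := by
  rintro v ⟨m, h⟩
  refine ⟨fun i => ∑ j, T.1 i j * m j, fun i => ?_⟩
  change ∑ j, (T.1 i j : ℝ) * v j = _
  push_cast
  exact Finset.sum_congr rfl fun j _ => by rw [h j]

/-- The action of `SL(3, ℤ)` on the 3-torus. -/
def lin3 (T : SpecialLinearGroup (Fin 3) ℤ) (p : Torus3) : Torus3 :=
  QuotientAddGroup.map intLattice intLattice (linHom3 T) (linHom3_lattice T) p

/-! ### The six fixed 3-tori and their tubular coordinates -/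

/-- `ℂ²` with its Hermitian norm. -/
abbrev C2 : Type := EuclideanSpace ℂ (Fin 2)

/-- The unit sphere `S³` of `ℂ²`, that is, the space of oriented real lines in `ℂ²`. -/
abbrev S3 : Type := Metric.sphere (0 : C2) 1

/-- Labels of the six tori: `(k, e)` with `k ∈ {0, 1, 2}` and `e ∈ {0, 1}`. -/
abbrev Idx : Type := ZMod 3 × Fin 2

/-- The first three of the real coordinates `(a₁, b₁, a₂, b₂)` of
`(a₁ + i b₁, a₂ + i b₂) ∈ ℂ²`. -/
def re3 (w : C2) : Fin 3 → ℝ := ![(w 0).re, (w 0).im, (w 1).re]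

/-- The real-linear map `(v, y) ↦ (ξᵏ (re3 v + i √3 y), Im v₁)`. For `k = 0` its `v`-part is
`a₁ ∂_{s₁} + b₁ ∂_{s₂} + a₂ ∂_{s₃} + b₂ ∂_x`. -/
def tubeHom (k : ZMod 3) : C2 × (Fin 3 → ℝ) →+ V where
  toFun q := (fun j => xi ^ k.val * (re3 q.1 j + Complex.I * (Real.sqrt 3 * q.2 j)), (q.1 1).im)
  map_zero' := by
    apply Prod.ext
    · funext j; fin_cases j <;> simp [re3]
    · simp
  map_add' q r := by
    apply Prod.ext
    · funext j; fin_cases j <;> simp [re3] <;> ring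
    · simp

lemma one_add_two_xi : 1 + 2 * xi = Complex.I * Real.sqrt 3 := by
  have h : xi = Complex.exp (((2 * Real.pi / 3 : ℝ) : ℂ) * Complex.I) := by
    rw [xi]; congr 1; push_cast; ring
  have hc : Real.cos (2 * Real.pi / 3) = -(1 / 2) := by
    rw [show 2 * Real.pi / 3 = Real.pi - Real.pi / 3 by ring, Real.cos_pi_sub,
      Real.cos_pi_div_three]
  have hs : Real.sin (2 * Real.pi / 3) = Real.sqrt 3 / 2 := by
    rw [show 2 * Real.pi / 3 = Real.pi - Real.pi / 3 by ring, Real.sin_pi_sub,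
      Real.sin_pi_div_three]
  rw [h, Complex.exp_mul_I, ← Complex.ofReal_cos, ← Complex.ofReal_sin, hc, hs]
  push_cast
  ring

lemma xi_pow_lattice (k : ℕ) (m n : Fin 3 → ℤ) :
    (fun j => xi ^ k * (m j + xi * n j)) ∈ eisensteinLattice := by
  induction k generalizing m n with
  | zero => exact ⟨m, n, fun j => by simp⟩
  | succ k ih =>
    convert ih (-n) (m - n) using 2 with j
    simp only [Pi.neg_apply, Pi.sub_apply, Int.cast_neg, Int.cast_sub]
    linear_combination xi ^ k * (n j : ℂ) * xi_sq

lemma tubeHom_lattice (k : ZMod 3) :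
    intLattice ≤ lattice.comap ((tubeHom k).comp (AddMonoidHom.inr C2 (Fin 3 → ℝ))) := by
  rintro v ⟨m, h⟩
  refine ⟨?_, 0, by simp [tubeHom]⟩
  have key : (((tubeHom k).comp (AddMonoidHom.inr C2 (Fin 3 → ℝ))) v).1 =
      fun j => xi ^ k.val * (m j + xi * (2 * m : Fin 3 → ℤ) j) := ?_
  · exact key ▸ xi_pow_lattice k.val m (2 * m)
  funext j
  have h0 : re3 0 j = 0 := by fin_cases j <;> simp [re3]
  simp only [tubeHom, AddMonoidHom.comp_apply, AddMonoidHom.coe_mk, ZeroHom.coe_mk,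
    AddMonoidHom.inr_apply, h0, h j, Pi.mul_apply, Pi.ofNat_apply, Int.cast_mul]
  push_cast
  linear_combination -(xi ^ k.val * (m j : ℂ)) * one_add_two_xi

/-- The map `τᵢ : ℂ² × T³ → 𝔸`. For `i = (0, e)` it is
`(w, [y]) ↦ [(re3 w + i √3 y, e/2 + Im w₁)]`; the factor `√3` is the length of the period of
`{z = i t}` modulo the lattice in each coordinate direction. In general
`τ_(k, e) = αᵏ ∘ τ_(0, e)`. It is a homeomorphism from `{‖w‖ < 1/12} × T³` onto a tubular
neighbourhood of a 3-torus, and the six tubular neighbourhoods are disjoint. -/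
def tau (i : Idx) (w : C2) (p : Torus3) : Torus7 :=
  QuotientAddGroup.mk (tubeHom i.1 (w, 0)) +
    QuotientAddGroup.map intLattice lattice _ (tubeHom_lattice i.1) p +
    QuotientAddGroup.mk ((0, (i.1.val : ℝ) / 3 + (i.2.val : ℝ) / 2) : V)

lemma tau_mk (i : Idx) (w : C2) (y : Fin 3 → ℝ) :
    tau i w (QuotientAddGroup.mk y) =
      QuotientAddGroup.mk ((fun j => xi ^ i.1.val * (re3 w j + Complex.I * (Real.sqrt 3 * y j)),
        (w 1).im + ((i.1.val : ℝ) / 3 + (i.2.val : ℝ) / 2)) : V) := by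
  rw [tau, QuotientAddGroup.map_mk, ← QuotientAddGroup.mk_add, ← QuotientAddGroup.mk_add]
  congr 1
  have h0 : ∀ j, re3 0 j = 0 := by intro j; fin_cases j <;> simp [re3]
  apply Prod.ext
  · funext j
    simp [tubeHom, h0]
    ring
  · simp [tubeHom]

/-- The union of the six 3-tori
`T_(k, e) = {x = k/3 + e/2, z ∈ ξᵏ i ℝ³}`, the fixed loci of the reflections in the group
generated by `α` and `β`. -/
def sing : Set Torus7 := {a | ∃ (i : Idx) (p : Torus3), a = tau i 0 p}

/-- The linear map `G ⊕ id` of `ℂ² = ℝ⁴`, in the real coordinates `(a₁, b₁, a₂, b₂)` of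
`(a₁ + i b₁, a₂ + i b₂)`. -/
def extend (G : SpecialLinearGroup (Fin 3) ℝ) (w : C2) : C2 :=
  !₂[((G.1 *ᵥ re3 w) 0 : ℂ) + ((G.1 *ᵥ re3 w) 1 : ℂ) * Complex.I,
    ((G.1 *ᵥ re3 w) 2 : ℂ) + ((w 1).im : ℂ) * Complex.I]

lemma re3_extend (G : SpecialLinearGroup (Fin 3) ℝ) (w : C2) :
    re3 (extend G w) = G.1 *ᵥ re3 w := by
  funext j; fin_cases j <;> simp [re3, extend]

lemma extend_im (G : SpecialLinearGroup (Fin 3) ℝ) (w : C2) :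
    (extend G w 1).im = (w 1).im := by
  simp [extend]

lemma C2_ext {w w' : C2} (h : re3 w = re3 w') (h' : (w 1).im = (w' 1).im) : w = w' := by
  ext j
  have h0 := congrFun h 0
  have h1 := congrFun h 1
  have h2 := congrFun h 2
  simp only [re3, Matrix.cons_val_zero, Matrix.cons_val_one, Matrix.cons_val] at h0 h1 h2
  fin_cases j
  · exact Complex.ext h0 h1
  · exact Complex.ext h2 h'

lemma extend_one (w : C2) : extend 1 w = w :=
  C2_ext (by rw [re3_extend]; simp) (extend_im _ _)

lemma extend_zero (G : SpecialLinearGroup (Fin 3) ℝ) : extend G 0 = 0 := by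
  have h0 : re3 0 = 0 := by funext j; fin_cases j <;> simp [re3]
  exact C2_ext (by rw [re3_extend, h0]; simp) (extend_im _ _)

lemma extend_ne_zero (G : SpecialLinearGroup (Fin 3) ℝ) {w : C2} (hw : w ≠ 0) :
    extend G w ≠ 0 := by
  intro h
  have h1 : G⁻¹.1 *ᵥ re3 (extend G w) = re3 w := by
    rw [re3_extend, Matrix.mulVec_mulVec, ← Matrix.SpecialLinearGroup.coe_mul]
    simp
  have h0 : re3 0 = 0 := by funext j; fin_cases j <;> simp [re3]
  apply hw
  apply C2_ext
  · rw [← h1, h, h0]; simp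
  · rw [← extend_im G w, h]

/-- The coercion `SL(3, ℤ) → SL(3, ℝ)`. -/
def toReal (T : SpecialLinearGroup (Fin 3) ℤ) : SpecialLinearGroup (Fin 3) ℝ :=
  SpecialLinearGroup.map (Int.castRingHom ℝ) T

/-- The action of `G ⊕ id` on oriented real lines in `ℝ⁴ = ℂ²`. -/
def ray (G : SpecialLinearGroup (Fin 3) ℝ) (σ : S3) : S3 :=
  ⟨(‖extend G σ.1‖⁻¹ : ℝ) • extend G σ.1, by
    have hσ : σ.1 ≠ 0 := ne_zero_of_mem_unit_sphere σ
    have h : ‖extend G σ.1‖ ≠ 0 := norm_ne_zero_iff.mpr (extend_ne_zero G hσ)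
    rw [mem_sphere_zero_iff_norm, norm_smul, norm_inv, norm_norm, inv_mul_cancel₀ h]⟩

lemma ray_one (σ : S3) : ray 1 σ = σ := by
  apply Subtype.ext
  have h : ‖σ.1‖ = 1 := mem_sphere_zero_iff_norm.mp σ.2
  simp [ray, extend_one, h]

lemma ray_neg (G : SpecialLinearGroup (Fin 3) ℝ) (σ : S3) : ray G (-σ) = -ray G σ := by
  have h : extend G (-σ.1) = -extend G σ.1 := by
    have hre : ∀ w : C2, re3 (-w) = -re3 w := by
      intro w; funext j; fin_cases j <;> simp [re3]
    apply C2_ext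
    · rw [hre, re3_extend, re3_extend, hre, Matrix.mulVec_neg]
    · rw [extend_im]
      simp [extend_im]
  apply Subtype.ext
  simp [ray, h]

/-! ### How the three actions look in the tubular coordinates -/

lemma lin_tau (T : SpecialLinearGroup (Fin 3) ℤ) (i : Idx) (w : C2) (p : Torus3) :
    lin T (tau i w p) = tau i (extend (toReal T) w) (lin3 T p) := by
  induction p using QuotientAddGroup.induction_on with
  | H y =>
    rw [lin3, QuotientAddGroup.map_mk, tau_mk, tau_mk, lin, QuotientAddGroup.map_mk, extend_im,
      re3_extend]
    congr 1
    apply Prod.ext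
    · funext j
      simp [linHom, linHom3, toReal, Matrix.mulVec, dotProduct, Finset.mul_sum,
        ← Finset.sum_add_distrib]
      refine Finset.sum_congr rfl fun l _ => ?_
      ring
    · rfl

lemma xi_pow_succ_val (k : ZMod 3) : xi ^ (k + 1).val = xi * xi ^ k.val := by
  fin_cases k
  · change xi ^ 1 = xi * xi ^ 0; ring
  · change xi ^ 2 = xi * xi ^ 1; ring
  · change xi ^ 0 = xi * xi ^ 2; linear_combination -xi_pow_three

lemma conj_xi_pow_val (k : ZMod 3) : (starRingEnd ℂ) (xi ^ k.val) = xi ^ (-k).val := by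
  rw [map_pow, conj_xi]
  fin_cases k
  · change (xi ^ 2) ^ 0 = xi ^ 0; ring
  · change (xi ^ 2) ^ 1 = xi ^ 2; ring
  · change (xi ^ 2) ^ 2 = xi ^ 1; linear_combination xi * xi_pow_three

lemma mk_eq_of_int {z : Fin 3 → ℂ} {x x' : ℝ} (h : ∃ n : ℤ, x' = x + n) :
    (QuotientAddGroup.mk ((z, x) : V) : Torus7) = QuotientAddGroup.mk ((z, x') : V) := by
  obtain ⟨n, rfl⟩ := h
  rw [QuotientAddGroup.eq]
  refine ⟨?_, n, ?_⟩
  · simp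
  · simp

lemma alpha_tau (i : Idx) (w : C2) (p : Torus3) :
    alpha (tau i w p) = tau (i.1 + 1, i.2) w p := by
  induction p using QuotientAddGroup.induction_on with
  | H y =>
    obtain ⟨k, e⟩ := i
    rw [tau_mk, tau_mk, alpha, QuotientAddGroup.map_mk, ← QuotientAddGroup.mk_add]
    simp only [xiHom, AddMonoidHom.coe_mk, ZeroHom.coe_mk, Prod.mk_add_mk, add_zero,
      xi_pow_succ_val, mul_assoc]
    apply mk_eq_of_int
    fin_cases k
    · refine ⟨0, ?_⟩
      change _ + ((1 : ℕ) / 3 + _ : ℝ) = _ + ((0 : ℕ) / 3 + _ : ℝ) + _ + _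
      push_cast; ring
    · refine ⟨0, ?_⟩
      change _ + ((2 : ℕ) / 3 + _ : ℝ) = _ + ((1 : ℕ) / 3 + _ : ℝ) + _ + _
      push_cast; ring
    · refine ⟨-1, ?_⟩
      change _ + ((0 : ℕ) / 3 + _ : ℝ) = _ + ((2 : ℕ) / 3 + _ : ℝ) + _ + _
      push_cast; ring

lemma re3_neg (w : C2) (j : Fin 3) : re3 (-w) j = -re3 w j := by
  fin_cases j <;> simp [re3]

lemma beta_tau (i : Idx) (w : C2) (p : Torus3) :
    beta (tau i w p) = tau (-i.1, i.2) (-w) p := by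
  induction p using QuotientAddGroup.induction_on with
  | H y =>
    obtain ⟨k, e⟩ := i
    rw [tau_mk, tau_mk, beta, QuotientAddGroup.map_mk]
    have hz : (fun j => -(starRingEnd ℂ) (xi ^ k.val *
          (re3 w j + Complex.I * (Real.sqrt 3 * y j)))) =
        fun j => xi ^ (-k).val * (re3 (-w) j + Complex.I * (Real.sqrt 3 * y j)) := by
      funext j
      simp only [map_mul, conj_xi_pow_val, map_add, Complex.conj_ofReal, Complex.conj_I,
        re3_neg, Complex.ofReal_neg]
      ring
    simp only [betaHom, AddMonoidHom.coe_mk, ZeroHom.coe_mk, hz]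
    apply mk_eq_of_int
    have he : ∃ n : ℤ, (e.val : ℝ) = n := ⟨e.val, by simp⟩
    obtain ⟨n, hn⟩ := he
    fin_cases k
    · refine ⟨n, ?_⟩
      change _ + ((0 : ℕ) / 3 + _ : ℝ) = -(_ + ((0 : ℕ) / 3 + _ : ℝ)) + _
      simp [hn]; ring
    · refine ⟨1 + n, ?_⟩
      change _ + ((2 : ℕ) / 3 + _ : ℝ) = -(_ + ((1 : ℕ) / 3 + _ : ℝ)) + _
      simp [hn]; ring
    · refine ⟨1 + n, ?_⟩
      change _ + ((1 : ℕ) / 3 + _ : ℝ) = -(_ + ((2 : ℕ) / 3 + _ : ℝ)) + _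
      simp [hn]; ring

lemma lin_inv_lin (T : SpecialLinearGroup (Fin 3) ℤ) (a : Torus7) : lin T⁻¹ (lin T a) = a := by
  induction a using QuotientAddGroup.induction_on with
  | H v =>
    rw [lin, lin, QuotientAddGroup.map_mk, QuotientAddGroup.map_mk]
    congr 1
    apply Prod.ext
    · have h := congrArg (fun S : SpecialLinearGroup (Fin 3) ℤ =>
        S.1.map (Int.cast : ℤ → ℂ)) (inv_mul_cancel T)
      simp only [Matrix.SpecialLinearGroup.coe_mul] at h
      rw [show (Int.cast : ℤ → ℂ) = Int.castRingHom ℂ from rfl, Matrix.map_mul] at h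
      change (T⁻¹.1.map (Int.castRingHom ℂ)) *ᵥ ((T.1.map (Int.castRingHom ℂ)) *ᵥ v.1) = v.1
      rw [Matrix.mulVec_mulVec, h]
      simp
    · rfl

lemma alpha_alpha_alpha (a : Torus7) : alpha (alpha (alpha a)) = a := by
  induction a using QuotientAddGroup.induction_on with
  | H v =>
    simp only [alpha, QuotientAddGroup.map_mk, ← QuotientAddGroup.mk_add]
    obtain ⟨z, x⟩ := v
    simp only [xiHom, AddMonoidHom.coe_mk, ZeroHom.coe_mk, Prod.mk_add_mk, add_zero]
    have hz : (fun j => xi * (xi * (xi * z j))) = z := by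
      funext j
      linear_combination z j * xi_pow_three
    rw [hz]
    exact mk_eq_of_int ⟨-1, by push_cast; ring⟩

lemma beta_beta (a : Torus7) : beta (beta a) = a := by
  induction a using QuotientAddGroup.induction_on with
  | H v =>
    simp [beta, betaHom]

lemma alpha_lin (T : SpecialLinearGroup (Fin 3) ℤ) (a : Torus7) :
    alpha (lin T a) = lin T (alpha a) := by
  induction a using QuotientAddGroup.induction_on with
  | H v =>
    simp only [lin, alpha, QuotientAddGroup.map_mk, ← QuotientAddGroup.mk_add]
    congr 1
    apply Prod.ext
    · funext j
      simp only [xiHom, linHom, AddMonoidHom.coe_mk, ZeroHom.coe_mk, Prod.mk_add_mk, add_zero,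
        Finset.mul_sum]
      exact Finset.sum_congr rfl fun l _ => by ring
    · rfl

lemma beta_lin (T : SpecialLinearGroup (Fin 3) ℤ) (a : Torus7) :
    beta (lin T a) = lin T (beta a) := by
  induction a using QuotientAddGroup.induction_on with
  | H v =>
    simp only [lin, beta, QuotientAddGroup.map_mk]
    congr 1
    apply Prod.ext
    · funext j
      simp [betaHom, linHom]
    · rfl

lemma lin_notMem (T : SpecialLinearGroup (Fin 3) ℤ) {a : Torus7} (ha : a ∉ sing) :
    lin T a ∉ sing := by
  rintro ⟨i, p, h⟩
  exact ha ⟨i, lin3 T⁻¹ p, by rw [← lin_inv_lin T a, h, lin_tau, extend_zero]⟩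

lemma alpha_notMem {a : Torus7} (ha : a ∉ sing) : alpha a ∉ sing := by
  rintro ⟨i, p, h⟩
  exact ha ⟨_, p, by rw [← alpha_alpha_alpha a, h, alpha_tau, alpha_tau]⟩

lemma beta_notMem {a : Torus7} (ha : a ∉ sing) : beta a ∉ sing := by
  rintro ⟨i, p, h⟩
  exact ha ⟨_, p, by rw [← beta_beta a, h, beta_tau, neg_zero]⟩

/-! ### The real oriented blow-up `Y` of the 7-torus along the six 3-tori -/

/-- The points of the real oriented blow-up: the points of the torus off the six 3-tori, and the
oriented normal lines to the six 3-tori. -/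
def BlowUp : Type := {a : Torus7 // a ∉ sing} ⊕ (Idx × S3 × Torus3)

namespace BlowUp

/-- A point off the six 3-tori. -/
def off (a : {a : Torus7 // a ∉ sing}) : BlowUp := Sum.inl a

/-- A point of the boundary. -/
def bdry (i : Idx) (σ : S3) (p : Torus3) : BlowUp := Sum.inr (i, σ, p)

open Classical in
/-- The polar chart `[0, 1/12) × S³ × T³ → Y` along the `i`-th boundary component: it sends
`(ρ, σ, p)` to `τᵢ (ρ σ, p)` for `ρ > 0`, and to the boundary point `(σ, p)` for `ρ = 0`. (For
`0 ≤ ρ < 1/12` the point `τᵢ (ρ σ, p)` lies on one of the six tori only if `ρ = 0`.) -/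
def polar (q : Idx × Set.Ico (0 : ℝ) (1 / 12) × S3 × Torus3) : BlowUp :=
  if h : tau q.1 ((q.2.1 : ℝ) • (q.2.2.1 : C2)) q.2.2.2 ∈ sing then bdry q.1 q.2.2.1 q.2.2.2
  else off ⟨_, h⟩

/-- The topology glued from the complement of the six tori and the polar charts: a set is open
if and only if its preimages under `off` and `polar` are open. -/
instance : TopologicalSpace BlowUp :=
  TopologicalSpace.coinduced off inferInstance ⊔ TopologicalSpace.coinduced polar inferInstance

/-- The extension `f_Y` to `Y` of the linear action of `T ∈ SL(3, ℤ)` on the torus. -/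
def map (T : SpecialLinearGroup (Fin 3) ℤ) : BlowUp → BlowUp
  | Sum.inl a => off ⟨lin T a.1, lin_notMem T a.2⟩
  | Sum.inr (i, σ, p) => bdry i (ray (toReal T) σ) (lin3 T p)

/-- The extension of `α` to `Y`. -/
def alphaMap : BlowUp → BlowUp
  | Sum.inl a => off ⟨alpha a.1, alpha_notMem a.2⟩
  | Sum.inr (i, σ, p) => bdry (i.1 + 1, i.2) σ p

/-- The extension of `β` to `Y`. -/
def betaMap : BlowUp → BlowUp
  | Sum.inl a => off ⟨beta a.1, beta_notMem a.2⟩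
  | Sum.inr (i, σ, p) => bdry (-i.1, i.2) (-σ) p

end BlowUp

/-! ### Attaching collars: `Y'` -/

/-- The six collars `[0, 1] × S³ × T³`. -/
abbrev Collars : Type := Idx × unitInterval × S3 × Torus3

/-- The identification of the boundary of `Y` with the ends `{0} × S³ × T³` of the collars. -/
inductive GlueRel : BlowUp ⊕ Collars → BlowUp ⊕ Collars → Prop
  | glue (i : Idx) (σ : S3) (p : Torus3) :
      GlueRel (Sum.inl (BlowUp.bdry i σ p)) (Sum.inr (i, 0, σ, p))

/-- `Y'`: the space `Y` with a collar `[0, 1] × S³ × T³` glued to each boundary component. -/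
def Collared : Type := Quot GlueRel

namespace Collared

instance : TopologicalSpace Collared := inferInstanceAs (TopologicalSpace (Quot GlueRel))

/-- The inclusion of `Y`. -/
def ofBlowUp (y : BlowUp) : Collared := Quot.mk _ (Sum.inl y)

/-- The inclusion of the collars. -/
def ofCollar (c : Collars) : Collared := Quot.mk _ (Sum.inr c)

/-- `f_{Y'}`: equal to `f_Y` on `Y` and to `(r, σ, p) ↦ (r, (γ(r) ⊕ id) σ, T p)` on each collar. -/
def map (T : SpecialLinearGroup (Fin 3) ℤ)
    (γ : Path (toReal T) (1 : SpecialLinearGroup (Fin 3) ℝ)) : Collared → Collared :=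
  Quot.map
    (Sum.map (BlowUp.map T) fun c => (c.1, c.2.1, ray (γ c.2.1) c.2.2.1, lin3 T c.2.2.2)) (by
      rintro _ _ ⟨i, σ, p⟩
      simp only [Sum.map_inl, Sum.map_inr, γ.source]
      exact GlueRel.glue _ _ _)

/-- The extension of `α` to `Y'`. -/
def alphaMap : Collared → Collared :=
  Quot.map (Sum.map BlowUp.alphaMap fun c => ((c.1.1 + 1, c.1.2), c.2.1, c.2.2.1, c.2.2.2)) (by
    rintro _ _ ⟨i, σ, p⟩
    exact GlueRel.glue _ _ _)

/-- The extension of `β` to `Y'`. -/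
def betaMap : Collared → Collared :=
  Quot.map (Sum.map BlowUp.betaMap fun c => ((-c.1.1, c.1.2), c.2.1, -c.2.2.1, c.2.2.2)) (by
    rintro _ _ ⟨i, σ, p⟩
    exact GlueRel.glue _ _ _)

end Collared

/-! ### The Hopf collapse: `M̃` -/

/-- Oriented real lines over the same point of the outer boundary `{1} × S³ × T³` of a collar are
identified if they are contained in the same complex line of `ℂ²`. -/
inductive HopfRel : Collared → Collared → Prop
  | hopf (i : Idx) (σ σ' : S3) (p : Torus3) (h : ∃ c : ℂ, (σ' : C2) = c • (σ : C2)) :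
      HopfRel (Collared.ofCollar (i, 1, σ, p)) (Collared.ofCollar (i, 1, σ', p))

/-- `M̃`: the result of the Hopf collapse of the six boundary components of `Y'`. -/
def Collapsed : Type := Quot HopfRel

namespace Collapsed

instance : TopologicalSpace Collapsed := inferInstanceAs (TopologicalSpace (Quot HopfRel))

/-- `f_{M̃}`, induced by `f_{Y'}`. -/
def map (T : SpecialLinearGroup (Fin 3) ℤ)
    (γ : Path (toReal T) (1 : SpecialLinearGroup (Fin 3) ℝ)) : Collapsed → Collapsed :=
  Quot.map (Collared.map T γ) (by
    rintro _ _ ⟨i, σ, σ', p, h⟩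
    change HopfRel (Collared.ofCollar (i, 1, ray (γ 1) σ, lin3 T p))
      (Collared.ofCollar (i, 1, ray (γ 1) σ', lin3 T p))
    simp only [γ.target, ray_one]
    exact HopfRel.hopf _ _ _ _ h)

/-- The action of `α` on `M̃`. -/
def alphaMap : Collapsed → Collapsed :=
  Quot.map Collared.alphaMap (by
    rintro _ _ ⟨i, σ, σ', p, h⟩
    exact HopfRel.hopf _ _ _ _ h)

/-- The action of `β` on `M̃`. -/
def betaMap : Collapsed → Collapsed :=
  Quot.map Collared.betaMap (by
    rintro _ _ ⟨i, σ, σ', p, c, h⟩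
    exact HopfRel.hopf _ _ _ _ ⟨c, by simp [h]⟩)

lemma alphaMap_map (T : SpecialLinearGroup (Fin 3) ℤ)
    (γ : Path (toReal T) (1 : SpecialLinearGroup (Fin 3) ℝ)) (x : Collapsed) :
    alphaMap (map T γ x) = map T γ (alphaMap x) := by
  obtain ⟨⟨(a | b) | c⟩⟩ := x
  · refine congrArg (fun y => Quot.mk HopfRel (Quot.mk GlueRel (Sum.inl (Sum.inl y)))) ?_
    exact Subtype.ext (alpha_lin T a.1)
  · rfl
  · rfl

lemma betaMap_map (T : SpecialLinearGroup (Fin 3) ℤ)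
    (γ : Path (toReal T) (1 : SpecialLinearGroup (Fin 3) ℝ)) (x : Collapsed) :
    betaMap (map T γ x) = map T γ (betaMap x) := by
  obtain ⟨⟨(a | ⟨i, σ, p⟩) | ⟨i, r, σ, p⟩⟩⟩ := x
  · refine congrArg (fun y => Quot.mk HopfRel (Quot.mk GlueRel (Sum.inl (Sum.inl y)))) ?_
    exact Subtype.ext (beta_lin T a.1)
  · refine congrArg (fun τ => Quot.mk HopfRel (Quot.mk GlueRel
      (Sum.inl (Sum.inr ((-i.1, i.2), τ, lin3 T p))))) ?_
    exact (ray_neg _ σ).symm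
  · refine congrArg (fun τ => Quot.mk HopfRel (Quot.mk GlueRel
      (Sum.inr ((-i.1, i.2), r, τ, lin3 T p)))) ?_
    exact (ray_neg _ σ).symm

end Collapsed

/-! ### The quotient `M` by the finite group generated by `α` and `β` -/

/-- The relation that generates the orbit equivalence relation of the group generated by the
invertible maps `α` and `β` of `M̃`. -/
inductive OrbitRel : Collapsed → Collapsed → Prop
  | alpha (x : Collapsed) : OrbitRel x (Collapsed.alphaMap x)
  | beta (x : Collapsed) : OrbitRel x (Collapsed.betaMap x)

/-- The Joyce manifold `M`, the quotient of `M̃` by the group generated by `α` and `β`. -/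
def M : Type := Quot OrbitRel

instance : TopologicalSpace M := inferInstanceAs (TopologicalSpace (Quot OrbitRel))

/-- The map `f_T : M → M` induced by `f_{M̃}`; it depends on the choice of the path `γ` in
`SL(3, ℝ)` from `T` to the identity. -/
def fMap (T : SpecialLinearGroup (Fin 3) ℤ)
    (γ : Path (toReal T) (1 : SpecialLinearGroup (Fin 3) ℝ)) : M → M :=
  Quot.map (Collapsed.map T γ) (by
    rintro _ _ (x | x)
    · rw [← Collapsed.alphaMap_map]; exact OrbitRel.alpha _
    · rw [← Collapsed.betaMap_map]; exact OrbitRel.beta _)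

/-! ### Topological entropy -/

/-- The topological entropy of a self-map of a compact Hausdorff space (with respect to the only
uniform structure that is compatible with the topology). -/
def topologicalEntropy {X : Type*} [TopologicalSpace X] [CompactSpace X] [T2Space X]
    (f : X → X) : EReal :=
  @Dynamics.coverEntropy X uniformSpaceOfCompactR1 f Set.univ

/-- The complex eigenvalues of an integer matrix, with algebraic multiplicity. -/
def eigenvalues (T : SpecialLinearGroup (Fin 3) ℤ) : Multiset ℂ :=
  (T.1.map (Int.cast : ℤ → ℂ)).charpoly.roots

end JoyceManifold

end

noncomputable section

namespace JoyceManifold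

open Set Filter Topology Uniformity

/-! ### Finite codes -/

/-! The map on `M̃` fibres over a linear map of the torus, and its fibres carry no entropy.
Blow-down together with the collar coordinate maps `M̃` continuously to `𝔸 × [0, 1]` and intertwines
`f_{M̃}` with `T × id`. Away from the six tori a fibre has at most one point. Over a point of a
torus and a collar height `r`, the fibre is the image of one sphere `S³`. Since `r` never changes,
the sphere direction moves at every step by the same projective linear map `γ(r) ⊕ id`, whatever
happens to the `T³`-coordinate.

A projective linear map has zero entropy (`topEntropyLE_ray`): up to polynomial factors the matrix
is diagonal in eigencoordinates (`exists_eigencoordinates`), and a diagonal map preserves relative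
errors. It therefore suffices to record each eigencoordinate with a relative precision that is
polynomially small in `n`, plus an exponentially small absolute error. On a logarithmic scale this
takes only polynomially many labels (`Coded.relative`, `eventually_coded_directions`). Bowen's
inequality for fibres of zero entropy (`TopEntropyLE.of_fibers`) then bounds the entropy of `f_{M̃}`
by that of `T × id`, and `M` inherits the bound as a factor.

On the torus, `T` acts on `ℂ³`, where each eigencoordinate has real dimension two; this is the
origin of the factor `2`. The upper bound counts the cells needed to follow `n` steps
(`topEntropyLE_lin`). The lower bound compares volumes: points of a small ball whose orbits stay
close for `n` steps fill at most a polydisc of exponentially small volume (`expansionRate_le`). This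
lower bound reaches `M` because `M̃ → M` has finite fibres, so that Bowen's inequality applies
again, and because the torus map is a factor of the map on `M̃`.

The topological assertions rest on explicit continuous functions. Hausdorffness of `M̃` follows from
a continuous injection into a Hausdorff space (`Collapsed.eq_of_separating`), and `M` is its
quotient by a finite group. The inverse of `f_T` is the map built from `T⁻¹` and the pointwise
inverse path.

All entropy estimates are phrased with labellings instead of covers, since labellings multiply, pull
back and restrict to subsets that need not be invariant. -/

/-- The points of `F` can be labelled with at most `N` labels in such a way that any two points
of `F` with the same label are related by `R`. -/
def Coded {X : Type*} (F : Set X) (N : ℝ) (R : X → X → Prop) : Prop :=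
  ∃ (m : ℕ) (c : X → Fin m), (m : ℝ) ≤ N ∧ ∀ x ∈ F, ∀ y ∈ F, c x = c y → R x y

namespace Coded

variable {X Y : Type*} {F F' : Set X} {N N' : ℝ} {R R' : X → X → Prop}

lemma of_fintype {κ : Type*} [Fintype κ] (c : X → κ) (hN : (Fintype.card κ : ℝ) ≤ N)
    (h : ∀ x ∈ F, ∀ y ∈ F, c x = c y → R x y) : Coded F N R :=
  ⟨Fintype.card κ, fun x => Fintype.equivFin κ (c x), hN, fun x hx y hy hxy =>
    h x hx y hy ((Fintype.equivFin κ).injective hxy)⟩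

lemma mono (h : Coded F' N' R') (hF : F ⊆ F') (hN : N' ≤ N)
    (hR : ∀ x ∈ F, ∀ y ∈ F, R' x y → R x y) : Coded F N R := by
  obtain ⟨m, c, hm, hc⟩ := h
  exact ⟨m, c, hm.trans hN, fun x hx y hy hxy =>
    hR x hx y hy (hc x (hF hx) y (hF hy) hxy)⟩

lemma of_forall (hN : 1 ≤ N) (h : ∀ x ∈ F, ∀ y ∈ F, R x y) : Coded F N R :=
  ⟨1, fun _ => 0, by simpa using hN, fun x hx y hy _ => h x hx y hy⟩

lemma comap {F : Set Y} {R : Y → Y → Prop} (h : Coded F N R) (f : X → Y) :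
    Coded (f ⁻¹' F) N (fun x y => R (f x) (f y)) := by
  obtain ⟨m, c, hm, hc⟩ := h
  exact ⟨m, fun x => c (f x), hm, fun x hx y hy hxy => hc _ hx _ hy hxy⟩

lemma and (h : Coded F N R) (h' : Coded F N' R') :
    Coded F (N * N') (fun x y => R x y ∧ R' x y) := by
  obtain ⟨m, c, hm, hc⟩ := h
  obtain ⟨m', c', hm', hc'⟩ := h'
  refine of_fintype (fun x => (c x, c' x)) ?_ fun x hx y hy hxy => ?_
  · simp only [Fintype.card_prod, Fintype.card_fin, Nat.cast_mul]
    gcongr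
    exact (Nat.cast_nonneg m).trans hm
  · exact ⟨hc x hx y hy (congrArg Prod.fst hxy), hc' x hx y hy (congrArg Prod.snd hxy)⟩

lemma pi {ι : Type*} [Fintype ι] {N : ι → ℝ} {R : ι → X → X → Prop}
    (h : ∀ i, Coded F (N i) (R i)) : Coded F (∏ i, N i) (fun x y => ∀ i, R i x y) := by
  classical
  choose m c hm hc using h
  refine of_fintype (fun x i => c i x) ?_ fun x hx y hy hxy i => hc i x hx y hy (congrFun hxy i)
  simp only [Fintype.card_pi, Fintype.card_fin, Nat.cast_prod]
  exact Finset.prod_le_prod (fun i _ => Nat.cast_nonneg _) fun i _ => hm i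

/-- Cut the line into intervals of length `θ`. The floor of `f / θ` lies between `-⌈K/θ⌉` and
`⌈K/θ⌉`, which is fewer than `2(K/θ) + 3` values. -/
lemma floor {f : X → ℝ} {K θ : ℝ} (hθ : 0 < θ) (hf : ∀ x ∈ F, |f x| ≤ K) (hK : 0 ≤ K) :
    Coded F (2 * (K / θ) + 3) (fun x y => |f x - f y| ≤ θ) := by
  set M : ℕ := ⌈K / θ⌉₊
  have hM : (M : ℝ) < K / θ + 1 := Nat.ceil_lt_add_one (by positivity)
  have hM' : K / θ ≤ M := Nat.le_ceil _
  -- The shift by `M` makes the floor nonnegative on `F`. The truncations hidden in `toNat` and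
  -- `Fin.ofNat` only matter outside `F`.
  refine ⟨2 * M + 1, fun x => Fin.ofNat (2 * M + 1) (⌊f x / θ⌋ + M).toNat, ?_, ?_⟩
  · push_cast; linarith
  have key : ∀ x ∈ F, -(M : ℤ) ≤ ⌊f x / θ⌋ ∧ ⌊f x / θ⌋ ≤ M := by
    intro x hx
    have h := abs_le.mp (hf x hx)
    constructor
    · rw [Int.le_floor, le_div_iff₀ hθ]
      push_cast
      have := (div_le_iff₀ hθ).mp hM'
      linarith
    · have h1 : f x / θ ≤ M := (div_le_div_of_nonneg_right h.2 hθ.le).trans hM'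
      have h2 : (⌊f x / θ⌋ : ℝ) ≤ M := (Int.floor_le _).trans h1
      exact_mod_cast h2
  intro x hx y hy hxy
  have h1 := key x hx
  have h2 := key y hy
  have h3 := congrArg Fin.val hxy
  simp only [Fin.val_ofNat] at h3
  rw [Nat.mod_eq_of_lt (by omega), Nat.mod_eq_of_lt (by omega)] at h3
  have h4 : ⌊f x / θ⌋ = ⌊f y / θ⌋ := by omega
  have h5 := (Int.abs_sub_lt_one_of_floor_eq_floor h4).le
  rw [← sub_div, abs_div, abs_of_pos hθ, div_le_one hθ] at h5
  exact h5

/-- The second label may be chosen differently on each piece cut out by the first one, so the labels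
form a disjoint union over the pieces. -/
lemma bind {m : ℕ} (c : X → Fin m) (hm : (m : ℝ) ≤ N) (hN' : 0 ≤ N')
    (h : ∀ j, Coded (F ∩ c ⁻¹' {j}) N' R) : Coded F (N * N') R := by
  choose k d hk hd using h
  refine of_fintype (κ := Σ j, Fin (k j)) (fun x => ⟨c x, d (c x) x⟩) ?_ fun x hx y hy hxy => ?_
  · simp only [Fintype.card_sigma, Fintype.card_fin, Nat.cast_sum]
    calc ∑ j, (k j : ℝ) ≤ ∑ _j : Fin m, N' := Finset.sum_le_sum fun j _ => hk j
      _ = m * N' := by simp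
      _ ≤ N * N' := by gcongr
  · rw [Sigma.mk.injEq] at hxy
    obtain ⟨h1, h2⟩ := hxy
    refine hd (c x) x ⟨hx, rfl⟩ y ⟨hy, h1.symm⟩ ?_
    rw [← h1] at h2
    exact eq_of_heq h2

end Coded

/-! ### Entropy in terms of codes -/

/-- The topological entropy of `S` on `F` is at most `H`: for every neighbourhood `U` of the
diagonal, the orbit segments of length `n` that start in `F` can be labelled with `exp (n H')`
labels up to `U`-closeness, for every `H' > H` and all large `n`. -/
def TopEntropyLE {X : Type*} [TopologicalSpace X] (S : X → X) (F : Set X) (H : ℝ) : Prop :=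
  ∀ U ∈ 𝓝ˢ (diagonal X), ∀ H' > H, ∀ᶠ n : ℕ in atTop,
    Coded F (Real.exp (H' * n)) (fun x y => ∀ k < n, (S^[k] x, S^[k] y) ∈ U)

section

variable {X Y : Type*} [TopologicalSpace X] [TopologicalSpace Y] {S : X → X} {T : Y → Y} {H : ℝ}

/-- Entropy does not increase under factors: a point of `Y` receives the label of a chosen preimage.
-/
lemma TopEntropyLE.of_surjective {π : X → Y} (hS : TopEntropyLE S univ H) (hπ : Continuous π)
    (hsurj : Function.Surjective π) (h : Function.Semiconj π S T) : TopEntropyLE T univ H := by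
  intro U hU H' hH'
  have hU' : Prod.map π π ⁻¹' U ∈ 𝓝ˢ (diagonal X) := by
    refine (hπ.prodMap hπ).tendsto_nhdsSet ?_ hU
    rintro ⟨x, y⟩ (rfl : x = y)
    rfl
  filter_upwards [hS _ hU' H' hH'] with n hn
  refine (hn.comap (Function.surjInv hsurj)).mono (subset_univ _) le_rfl fun x _ y _ hxy k hk => ?_
  have := hxy k hk
  simp only [mem_preimage, Prod.map_apply] at this
  rwa [(h.iterate_right k).eq, (h.iterate_right k).eq, Function.surjInv_eq hsurj,
    Function.surjInv_eq hsurj] at this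

lemma TopEntropyLE.of_finite {F : Set X} (hF : F.Finite) (hH : 0 ≤ H) : TopEntropyLE S F H := by
  classical
  intro U hU H' hH'
  have := hF.fintype
  have hlim : Tendsto (fun n : ℕ => Real.exp (H' * n)) atTop atTop :=
    Real.tendsto_exp_atTop.comp
      (tendsto_natCast_atTop_atTop.const_mul_atTop (hH.trans_lt hH'))
  filter_upwards [hlim.eventually_ge_atTop (Fintype.card (Option F) : ℝ)] with n hn
  -- The label `none` is a default for points outside `F`.
  refine Coded.of_fintype (fun x => if h : x ∈ F then some (⟨x, h⟩ : F) else none) hn ?_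
  intro x hx y hy hxy k hk
  simp only [hx, hy, dif_pos, Option.some.injEq, Subtype.mk.injEq] at hxy
  rw [hxy]
  exact subset_of_mem_nhdsSet hU rfl

/-- On a compact Hausdorff space the entourages are the neighbourhoods of the diagonal. A cover by
dynamical `V`-balls labels each point by a centre, and equal labels are `V ∘ V`-close. Conversely,
one representative for each label gives a dynamical cover. -/
lemma topologicalEntropy_le_iff [CompactSpace X] [T2Space X] [Nonempty X] :
    topologicalEntropy S ≤ H ↔ TopEntropyLE S univ H := by
  let _ : UniformSpace X := uniformSpaceOfCompactR1
  have hU : 𝓝ˢ (diagonal X) = 𝓤 X := nhdsSet_diagonal_eq_uniformity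
  rw [topologicalEntropy, Dynamics.coverEntropy, TopEntropyLE, hU]
  have hexp : ∀ (b : ℝ) (n : ℕ), EReal.exp ((b : EReal) * n) = ENNReal.ofReal (Real.exp (b * n)) := by
    intro b n
    rw [← EReal.exp_coe]
    push_cast
    rfl
  constructor
  · intro h U hU H' hH'
    obtain ⟨V, hV, hVs, hVU⟩ := comp_symm_mem_uniformity_sets hU
    have h1 := (Dynamics.coverEntropyEntourage_le_coverEntropy S univ hV).trans h
    rw [Dynamics.coverEntropyEntourage, ExpGrowth.expGrowthSup_le_iff] at h1
    filter_upwards [h1 H' (by exact_mod_cast hH')] with n hn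
    rw [hexp] at hn
    have hfin : Dynamics.coverMincard S univ V n < ⊤ := by
      rw [lt_top_iff_ne_top]
      intro htop
      rw [htop] at hn
      simp at hn
    obtain ⟨s, hs, hcard⟩ := (Dynamics.coverMincard_finite_iff S univ V n).1 hfin
    rw [← hcard] at hn
    have hn' : (s.card : ℝ) ≤ Real.exp (H' * n) := by
      have h2 : ENNReal.ofReal (s.card : ℝ) ≤ ENNReal.ofReal (Real.exp (H' * n)) := by
        simpa using hn
      exact (ENNReal.ofReal_le_ofReal_iff (Real.exp_pos _).le).1 h2
    have hs' : ∀ x : X, ∃ y : s, (x, (y : X)) ∈ Dynamics.dynEntourage S V n := by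
      intro x
      obtain ⟨y, hy, hxy⟩ := hs (mem_univ x)
      exact ⟨⟨y, hy⟩, hxy⟩
    choose c hc using hs'
    refine Coded.of_fintype c (by simpa using hn') fun x _ y _ hxy k hk => ?_
    apply hVU
    have h1 := Dynamics.mem_dynEntourage.1 (hc x) k hk
    have h2 := Dynamics.mem_dynEntourage.1 (hc y) k hk
    rw [← hxy] at h2
    exact ⟨_, h1, hVs.symm _ _ h2⟩
  · intro h
    refine iSup₂_le fun U hU => ?_
    rw [Dynamics.coverEntropyEntourage, ExpGrowth.expGrowthSup_le_iff]
    intro b hb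
    obtain ⟨H', hH', hb'⟩ := EReal.lt_iff_exists_real_btwn.1 hb
    filter_upwards [h U hU H' (by exact_mod_cast hH')] with n hn
    obtain ⟨m, c, hm, hc⟩ := hn
    classical
    obtain ⟨x₀⟩ := ‹Nonempty X›
    -- The point `x₀` only serves labels that no point carries.
    set rep : Fin m → X := fun j => if hj : ∃ x, c x = j then hj.choose else x₀
    have hrep : ∀ x, c (rep (c x)) = c x := by
      intro x
      have hj : ∃ y, c y = c x := ⟨x, rfl⟩
      simp only [rep, dif_pos hj]
      exact hj.choose_spec
    have hcov : Dynamics.IsDynCoverOf S univ U n (Finset.univ.image rep : Finset X) := by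
      intro x _
      refine ⟨rep (c x), by simp, Dynamics.mem_dynEntourage.2 fun k hk => ?_⟩
      exact hc x (mem_univ _) _ (mem_univ _) (hrep x).symm k hk
    have h1 := hcov.coverMincard_le_card
    have h2 : (Finset.univ.image rep).card ≤ m := by
      simpa using Finset.card_image_le (s := Finset.univ) (f := rep)
    calc ((Dynamics.coverMincard S univ U n : ℕ∞) : ENNReal)
        ≤ (((Finset.univ.image rep).card : ℕ∞) : ENNReal) := by exact_mod_cast h1
      _ ≤ ENNReal.ofReal (m : ℝ) := by simpa using h2
      _ ≤ ENNReal.ofReal (Real.exp (H' * n)) := ENNReal.ofReal_le_ofReal hm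
      _ = EReal.exp ((H' : EReal) * n) := (hexp _ _).symm
      _ ≤ EReal.exp (b * n) := by gcongr

/-! ### Bowen's inequality for zero entropy fibres -/

variable [CompactSpace X] [T2Space X] [T2Space Y] {π : X → Y}

/-- A labelling of the fibre extends to a neighbourhood: finitely many orbit steps are shadowed by
fibre points on an open set, and by compactness this open set contains the preimage of a
neighbourhood of `y`. The closeness of `z` and `z'` follows along the chain `z, x, x', z'` with `x`,
`x'` in the fibre. -/
lemma TopEntropyLE.exists_nhds_coded (hS : Continuous S) (hπ : Continuous π) {y : Y}
    (hf : TopEntropyLE S (π ⁻¹' {y}) 0) {U : Set (X × X)} (hU : U ∈ 𝓝ˢ (diagonal X)) {δ : ℝ}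
    (hδ : 0 < δ) :
    ∃ m : ℕ, 0 < m ∧ ∃ W ∈ 𝓝 y, Coded (π ⁻¹' W) (Real.exp (δ * m))
      (fun x x' => ∀ k < m, (S^[k] x, S^[k] x') ∈ U) := by
  classical
  let _ : UniformSpace X := uniformSpaceOfCompactR1
  have hU' : 𝓝ˢ (diagonal X) = 𝓤 X := nhdsSet_diagonal_eq_uniformity
  rw [hU'] at hU
  obtain ⟨V', hV', hVU'⟩ := comp_mem_uniformity_sets hU
  obtain ⟨V, hV, hVo, hVs, hVU⟩ := comp_open_symm_mem_uniformity_sets hV'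
  obtain ⟨m, hm, k, c, hk, hc⟩ :=
    ((eventually_gt_atTop 0).and (hf V (hU' ▸ hV) δ hδ)).exists
  -- The points shadowed for `m` steps by a fibre point with label `j`.
  set O : Fin k → Set X := fun j =>
    {z | ∃ x, π x = y ∧ c x = j ∧ ∀ l < m, (S^[l] x, S^[l] z) ∈ V}
  have hO : ∀ j, IsOpen (O j) := by
    intro j
    have : O j = ⋃ x ∈ {x | π x = y ∧ c x = j},
        ⋂ l ∈ Finset.range m, {z | (S^[l] x, S^[l] z) ∈ V} := by
      ext z
      simp only [O, mem_ofPred_eq, mem_iUnion, mem_iInter, Finset.mem_range, exists_prop, and_assoc]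
    rw [this]
    refine isOpen_biUnion fun x _ => isOpen_biInter_finset fun l _ => ?_
    exact hVo.preimage (continuous_const.prodMk (hS.iterate l))
  have hOc : π ⁻¹' {y} ⊆ ⋃ j, O j := fun x hx =>
    mem_iUnion.2 ⟨c x, x, hx, rfl, fun l _ => refl_mem_uniformity hV⟩
  -- Tube lemma: `π` is a closed map because `X` is compact and `Y` is Hausdorff.
  refine ⟨m, hm, (π '' (⋃ j, O j)ᶜ)ᶜ, ?_, ?_⟩
  · refine IsOpen.mem_nhds ?_ ?_
    · exact (hπ.isClosedMap _ (isOpen_iUnion hO).isClosed_compl).isOpen_compl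
    · rintro ⟨x, hx, hxy⟩
      exact hx (hOc hxy)
  · refine ⟨k, fun z => if h : ∃ j, z ∈ O j then h.choose else c z, hk, ?_⟩
    have key : ∀ z ∈ π ⁻¹' (π '' (⋃ j, O j)ᶜ)ᶜ, ∃ j, z ∈ O j := by
      intro z hz
      by_contra hcon
      exact hz ⟨z, fun h => hcon (mem_iUnion.1 h), rfl⟩
    intro z hz z' hz' hzz
    have h := key z hz
    have h' := key z' hz'
    simp only [dif_pos h, dif_pos h'] at hzz
    obtain ⟨x, hx, hxj, hxV⟩ := h.choose_spec
    obtain ⟨x', hx', hxj', hxV'⟩ := h'.choose_spec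
    intro l hl
    have h3 := hc x hx x' hx' (hxj.trans (hzz.trans hxj'.symm)) l hl
    exact hVU' ⟨_, hVU ⟨_, hVs.symm _ _ (hxV l hl), h3⟩,
      hVU ⟨_, hxV' l hl, refl_mem_uniformity hV⟩⟩

/-- Each fibre has a neighbourhood on which some number `m` of steps costs only `exp (δ m)` labels.
Following a base orbit, blocks from finitely many such neighbourhoods are concatenated, so a whole
orbit tube costs about `exp (δ n)` labels on top of the labelling of the base. -/
theorem TopEntropyLE.of_fibers [CompactSpace Y] (hS : Continuous S) (hπ : Continuous π)
    (hsemi : Function.Semiconj π S T) (hT : TopEntropyLE T univ H)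
    (hf : ∀ y, TopEntropyLE S (π ⁻¹' {y}) 0) : TopEntropyLE S univ H := by
  classical
  intro U hU H' hH'
  -- One third of the gap goes to the base labelling and two thirds to the tubes, since `δ (n + M) ≤
  -- 2 δ n` once `n ≥ M`.
  set δ : ℝ := (H' - H) / 3 with hδ_def
  have hδ : 0 < δ := by have := sub_pos.2 hH'; positivity
  choose m hm W hW hcW using fun y => (hf y).exists_nhds_coded hS hπ hU hδ
  obtain ⟨t, -, ht⟩ := isCompact_univ.elim_nhds_subcover (fun y => interior (W y))
    fun y _ => interior_mem_nhds.2 (hW y)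
  let _ : UniformSpace Y := uniformSpaceOfCompactR1
  have hUY : 𝓝ˢ (diagonal Y) = 𝓤 Y := nhdsSet_diagonal_eq_uniformity
  obtain ⟨D, hD, hDW⟩ := lebesgue_number_lemma (U := fun i : t => interior (W i)) isCompact_univ
    (fun _ => isOpen_interior) (by
      intro y hy
      obtain ⟨i, hi, hyi⟩ := mem_iUnion₂.1 (ht hy)
      exact mem_iUnion.2 ⟨⟨i, hi⟩, hyi⟩)
  set M : ℕ := t.sup m
  -- Induction on `n`: the Lebesgue number places the `D`-neighbourhood of `y` in some `W i`, whose
  -- labelling handles the first `m i` steps. The extra `M` pays for the last block, which may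
  -- overshoot `n`.
  have hball : ∀ n y, Coded {z : X | ∀ k < n, (T^[k] y, T^[k] (π z)) ∈ D}
      (Real.exp (δ * (n + M))) (fun x x' => ∀ k < n, (S^[k] x, S^[k] x') ∈ U) := by
    intro n
    induction n using Nat.strong_induction_on with
    | _ n ih =>
      intro y
      rcases Nat.eq_zero_or_pos n with rfl | hn
      · exact Coded.of_forall (Real.one_le_exp (by positivity)) (by simp)
      obtain ⟨⟨i, hit⟩, hi⟩ := hDW y (mem_univ y)
      have hiM : m i ≤ M := Finset.le_sup (f := m) hit
      have hsub : ∀ z : X, (∀ k < n, (T^[k] y, T^[k] (π z)) ∈ D) → z ∈ π ⁻¹' W i :=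
        fun z hz => show π z ∈ W i from interior_subset (hi (hz 0 hn))
      rcases le_or_gt n (m i) with hni | hni
      · refine (hcW i).mono hsub ?_ fun x _ x' _ hxx k hk => hxx k (hk.trans_le hni)
        gcongr
        have : (m i : ℝ) ≤ M := by exact_mod_cast hiM
        have h0 : (0 : ℝ) ≤ n := Nat.cast_nonneg n
        linarith
      · have h2 := (ih (n - m i) (Nat.sub_lt hn (hm i)) (T^[m i] y)).comap (S^[m i])
        refine ((hcW i).mono (R := fun x x' => ∀ k < m i, (S^[k] x, S^[k] x') ∈ U)
          (F := {z : X | ∀ k < n, (T^[k] y, T^[k] (π z)) ∈ D}) hsub le_rfl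
            fun _ _ _ _ h => h).and (h2.mono (F := {z : X | ∀ k < n, (T^[k] y, T^[k] (π z)) ∈ D})
              ?_ le_rfl fun _ _ _ _ h => h) |>.mono subset_rfl ?_ ?_
        · intro z hz k hk
          rw [(hsemi.iterate_right (m i)).eq, ← Function.iterate_add_apply,
            ← Function.iterate_add_apply]
          exact hz _ (by omega)
        · rw [← Real.exp_add]
          apply Real.exp_le_exp.2
          rw [Nat.cast_sub hni.le]
          apply le_of_eq
          ring
        · rintro x - x' - ⟨h3, h4⟩ k hk
          rcases lt_or_ge k (m i) with hki | hki
          · exact h3 k hki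
          · have := h4 (k - m i) (by omega)
            rwa [← Function.iterate_add_apply, ← Function.iterate_add_apply,
              Nat.sub_add_cancel hki] at this
  filter_upwards [hT D (hUY ▸ hD) (H + δ) (by linarith), eventually_ge_atTop M] with n hn hnM
  obtain ⟨N, c, hN, hc⟩ := hn
  refine (Coded.bind (F := univ) (N' := Real.exp (δ * (n + M))) (fun x => c (π x)) hN
    (Real.exp_pos _).le (R := fun x x' => ∀ k < n, (S^[k] x, S^[k] x') ∈ U) ?_).mono
      subset_rfl ?_ fun _ _ _ _ h => h
  · intro j
    by_cases hj : ∃ y, c y = j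
    · obtain ⟨y, hy⟩ := hj
      refine (hball n y).mono ?_ le_rfl fun _ _ _ _ h => h
      rintro z ⟨-, hz⟩
      exact hc y (mem_univ _) _ (mem_univ _) (hy.trans hz.symm)
    -- A label `j` that no base point carries has an empty piece.
    · refine Coded.of_forall (Real.one_le_exp (by positivity)) ?_
      rintro x ⟨-, hx⟩
      exact absurd ⟨_, hx⟩ hj
  · rw [← Real.exp_add]
    apply Real.exp_le_exp.2
    have h1 : (M : ℝ) ≤ n := by exact_mod_cast hnM
    have h2 : H' = H + 3 * δ := by rw [hδ_def]; ring
    rw [h2]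
    nlinarith [mul_le_mul_of_nonneg_left h1 hδ.le]

end

/-! ### Powers of a complex matrix up to polynomial factors -/

section Powers

variable {W : Type*} [NormedAddCommGroup W] [NormedSpace ℂ W] [FiniteDimensional ℂ W]

/-- In the binomial expansion only the powers of `N` below the nilpotency order survive, and their
binomial coefficients are polynomial in `k`. -/
lemma exists_norm_one_add_nilpotent_pow_le {N : Module.End ℂ W} (hN : IsNilpotent N) :
    ∃ (C : ℝ) (m : ℕ), 0 < C ∧ ∀ (k : ℕ) (v : W), ‖((1 + N) ^ k) v‖ ≤ C * (1 + k) ^ m * ‖v‖ := by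
  obtain ⟨m, hm⟩ := hN
  have hb : ∀ j, ∃ B : ℝ, 0 < B ∧ ∀ v, ‖(N ^ j) v‖ ≤ B * ‖v‖ := fun j =>
    ⟨‖LinearMap.toContinuousLinearMap (N ^ j)‖ + 1, by positivity, fun v =>
      ((LinearMap.toContinuousLinearMap (N ^ j)).le_opNorm v).trans
        (by gcongr; linarith)⟩
  choose B hB hB' using hb
  refine ⟨1 + ∑ j ∈ Finset.range m, B j, m, ?_, fun k v => ?_⟩
  · have : 0 ≤ ∑ j ∈ Finset.range m, B j := Finset.sum_nonneg fun j _ => (hB j).le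
    linarith
  have hexp : ((1 + N) ^ k) v = ∑ j ∈ Finset.range (k + 1), (k.choose j : ℂ) • (N ^ j) v := by
    rw [add_comm, (Commute.one_right N).add_pow, LinearMap.sum_apply]
    refine Finset.sum_congr rfl fun j _ => ?_
    rw [one_pow, mul_one, ← nsmul_eq_mul', LinearMap.smul_apply, Nat.cast_smul_eq_nsmul]
  have hterm : ∀ j, ‖(k.choose j : ℂ) • (N ^ j) v‖ ≤
      if j < m then B j * (1 + k) ^ m * ‖v‖ else 0 := by
    intro j
    split_ifs with hj
    · rw [norm_smul, Complex.norm_natCast]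
      have h1 : (k.choose j : ℝ) ≤ (1 + k) ^ m := by
        calc (k.choose j : ℝ) ≤ (k : ℝ) ^ j := by exact_mod_cast Nat.choose_le_pow k j
          _ ≤ (1 + k) ^ j := by gcongr; linarith
          _ ≤ (1 + k) ^ m := pow_le_pow_right₀ (by linarith [(Nat.cast_nonneg k : (0 : ℝ) ≤ k)]) hj.le
      calc (k.choose j : ℝ) * ‖(N ^ j) v‖ ≤ (1 + k) ^ m * (B j * ‖v‖) := by
            gcongr; exact hB' j v
        _ = _ := by ring
    · have : N ^ j = 0 := by
        rw [← Nat.sub_add_cancel (not_lt.1 hj), pow_add, hm, mul_zero]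
      simp [this]
  rw [hexp]
  calc _ ≤ ∑ j ∈ Finset.range (k + 1), ‖(k.choose j : ℂ) • (N ^ j) v‖ := norm_sum_le _ _
    _ ≤ ∑ j ∈ Finset.range (k + 1), if j < m then B j * (1 + k) ^ m * ‖v‖ else 0 :=
        Finset.sum_le_sum fun j _ => hterm j
    _ = ∑ j ∈ (Finset.range (k + 1)).filter (· < m), B j * (1 + k) ^ m * ‖v‖ :=
        (Finset.sum_filter _ _).symm
    _ ≤ ∑ j ∈ Finset.range m, B j * (1 + k) ^ m * ‖v‖ := by
        refine Finset.sum_le_sum_of_subset_of_nonneg (fun j hj => ?_) fun j _ _ => ?_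
        · simpa using (Finset.mem_filter.1 hj).2
        · have := (hB j).le; positivity
    _ = (∑ j ∈ Finset.range m, B j) * (1 + k) ^ m * ‖v‖ := by
        rw [Finset.sum_mul, Finset.sum_mul]
    _ ≤ _ := by gcongr; linarith

/-- Write `f = (1 + g⁻¹(f - g)) g` with commuting factors; the first one is unipotent and its powers
grow polynomially. The conditions are nearly symmetric in `f` and `g`, which later yields bounds in
both directions. -/
lemma exists_norm_pow_le_of_isNilpotent_sub {f g : Module.End ℂ W} (hfg : Commute f g)
    (hg : IsUnit g) (hn : IsNilpotent (f - g)) :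
    ∃ (C : ℝ) (m : ℕ), 0 < C ∧ ∀ (k : ℕ) (v : W), ‖(f ^ k) v‖ ≤ C * (1 + k) ^ m * ‖(g ^ k) v‖ := by
  obtain ⟨g, rfl⟩ := hg
  have hc : Commute f (↑g⁻¹ : Module.End ℂ W) := hfg.units_inv_right
  have hN : IsNilpotent (↑g⁻¹ * (f - ↑g)) :=
    (hc.symm.sub_right (Commute.refl g.1).units_inv_left).isNilpotent_mul_left hn
  obtain ⟨C, m, hC, h⟩ := exists_norm_one_add_nilpotent_pow_le hN
  refine ⟨C, m, hC, fun k v => ?_⟩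
  have hf : f = (1 + ↑g⁻¹ * (f - ↑g)) * ↑g := by
    have h1 : ((g⁻¹ : (Module.End ℂ W)ˣ) : Module.End ℂ W) * f * g = f := by
      rw [← hc.eq, mul_assoc, Units.inv_mul, mul_one]
    rw [add_mul, mul_sub, sub_mul, one_mul, h1, Units.inv_mul, one_mul]
    abel
  have hcomm : Commute (1 + ↑g⁻¹ * (f - ↑g)) (g : Module.End ℂ W) :=
    (Commute.one_left _).add_left
      (Commute.mul_left (Commute.refl g.1).units_inv_left (hfg.sub_left (Commute.refl _)))
  conv_lhs => rw [hf, hcomm.mul_pow]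
  exact h k _

end Powers

/-! ### Generalised eigenspaces and eigencoordinates. -/

/-- The basis is assembled from bases of the generalised eigenspaces. The eigenvalue list agrees
with the roots of the characteristic polynomial because algebraic multiplicity is the dimension of
the generalised eigenspace. -/
lemma exists_basis_maxGenEigenspace {d : ℕ} (f : Module.End ℂ (Fin d → ℂ)) :
    ∃ (l : Fin d → ℂ) (b : Module.Basis (Fin d) ℂ (Fin d → ℂ)),
      (∀ i, b i ∈ f.maxGenEigenspace (l i)) ∧
      (∀ μ, ∀ x ∈ f.maxGenEigenspace μ, ∀ i, μ ≠ l i → b.repr x i = 0) ∧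
      f.charpoly.roots = Finset.univ.val.map l := by
  classical
  have hint : DirectSum.IsInternal f.maxGenEigenspace :=
    DirectSum.isInternal_submodule_of_iSupIndep_of_iSup_eq_top f.independent_maxGenEigenspace
      (Module.End.iSup_maxGenEigenspace_eq_top f)
  set b' := hint.collectedBasis fun μ => Module.finBasis ℂ (f.maxGenEigenspace μ) with hb'
  set e := b'.indexEquiv (Pi.basisFun ℂ (Fin d)) with he
  refine ⟨fun i => (e.symm i).1, b'.reindex e, fun i => ?_, fun μ x hx i hi => ?_, ?_⟩
  · rw [Module.Basis.reindex_apply]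
    exact hint.collectedBasis_mem _ _
  · rw [Module.Basis.repr_reindex_apply]
    exact hint.collectedBasis_repr_of_mem_ne _ hi hx
  · ext μ
    rw [Polynomial.count_roots, ← LinearMap.finrank_maxGenEigenspace_eq, Multiset.count_map]
    change _ = (Finset.univ.filter fun i => μ = (e.symm i).1).card
    rw [← Fintype.card_subtype]
    have e1 : {a : Σ ν, Fin (Module.finrank ℂ (f.maxGenEigenspace ν)) // μ = a.1} ≃
        Fin (Module.finrank ℂ (f.maxGenEigenspace μ)) :=
      { toFun := fun a => a.2 ▸ a.1.2
        invFun := fun j => ⟨⟨μ, j⟩, rfl⟩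
        left_inv := by
          rintro ⟨⟨ν, j⟩, h⟩
          dsimp only at h
          subst h
          rfl
        right_inv := fun j => rfl }
    have e2 : {i // μ = (e.symm i).1} ≃
        {a : Σ ν, Fin (Module.finrank ℂ (f.maxGenEigenspace ν)) // μ = a.1} :=
      e.symm.subtypeEquiv fun i => Iff.rfl
    rw [Fintype.card_congr (e2.trans e1), Fintype.card_fin]

/-- This is the Jordan–Chevalley decomposition. The operator `s` is the scalar `μ` on the whole
generalised eigenspace of `μ`, which `f` preserves, hence it commutes with `f`. It is invertible
because it differs from `f` by a commuting nilpotent. -/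
lemma exists_diagonal_add_nilpotent {d : ℕ} {f : Module.End ℂ (Fin d → ℂ)} (hfu : IsUnit f) :
    ∃ (l : Fin d → ℂ) (b : Module.Basis (Fin d) ℂ (Fin d → ℂ)) (s : Module.End ℂ (Fin d → ℂ)),
      (∀ i, s (b i) = l i • b i) ∧ Commute f s ∧ IsNilpotent (f - s) ∧ IsUnit s ∧ (∀ i, l i ≠ 0) ∧
      f.charpoly.roots = Finset.univ.val.map l := by
  obtain ⟨l, b, hbmem, hrepr, hroots⟩ := exists_basis_maxGenEigenspace f
  set s : Module.End ℂ (Fin d → ℂ) := b.constr ℂ fun i => l i • b i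
  have hsb : ∀ i, s (b i) = l i • b i := fun i => b.constr_basis _ _ _
  have hs : ∀ μ, ∀ x ∈ f.maxGenEigenspace μ, s x = μ • x := by
    intro μ x hx
    conv_lhs => rw [← b.sum_repr x]
    conv_rhs => rw [← b.sum_repr x]
    rw [map_sum, Finset.smul_sum]
    refine Finset.sum_congr rfl fun i _ => ?_
    rw [map_smul, hsb, smul_comm]
    by_cases hi : μ = l i
    · rw [hi]
    · simp [hrepr μ x hx i hi]
  have hfmem : ∀ μ, ∀ x ∈ f.maxGenEigenspace μ, f x ∈ f.maxGenEigenspace μ := fun μ =>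
    f.mapsTo_maxGenEigenspace_of_comm (Commute.refl f) μ
  have hcomm : Commute f s := by
    refine b.ext fun i => ?_
    simp only [Module.End.mul_apply]
    rw [hsb, hs _ _ (hfmem _ _ (hbmem i)), map_smul]
  have hnil : IsNilpotent (f - s) := by
    refine ⟨d, b.ext fun i => ?_⟩
    -- On a generalised eigenspace `f - s` is `f` minus its eigenvalue, whose `d`-th power vanishes
    -- there.
    have key : ∀ k, ((f - s) ^ k) (b i) = ((f - algebraMap ℂ _ (l i)) ^ k) (b i) ∧
        ((f - s) ^ k) (b i) ∈ f.maxGenEigenspace (l i) := by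
      intro k
      induction k with
      | zero => exact ⟨rfl, hbmem i⟩
      | succ k ih =>
        have h1 : (f - s) (((f - s) ^ k) (b i)) = f (((f - s) ^ k) (b i)) - l i • ((f - s) ^ k) (b i) := by
          rw [LinearMap.sub_apply, hs _ _ ih.2]
        rw [pow_succ', pow_succ', Module.End.mul_apply, Module.End.mul_apply, h1]
        refine ⟨?_, ?_⟩
        · rw [← ih.1]; simp [Module.algebraMap_end_apply]
        · exact Submodule.sub_mem _ (hfmem _ _ ih.2) (Submodule.smul_mem _ _ ih.2)
    rw [(key d).1]
    have h2 := hbmem i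
    rw [Module.End.maxGenEigenspace_eq_genEigenspace_finrank, Module.finrank_fin_fun,
      Module.End.mem_genEigenspace_nat, LinearMap.mem_ker] at h2
    simpa [Algebra.algebraMap_eq_smul_one] using h2
  have hsu : IsUnit s := by
    have h3 : IsNilpotent (s - f) := by rw [← neg_sub]; exact hnil.neg
    have h4 : s = f + (s - f) := by abel
    rw [h4]
    exact h3.isUnit_add_left_of_commute hfu (hcomm.symm.sub_left (Commute.refl f))
  refine ⟨l, b, s, hsb, hcomm, hnil, hsu, fun i hi => ?_, hroots⟩
  have h6 : s (b i) = 0 := by rw [hsb, hi, zero_smul]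
  have h7 := (Module.End.isUnit_iff s).1 hsu
  exact b.ne_zero i (h7.injective (h6.trans (map_zero s).symm))

/-- The unipotent part of the Jordan–Chevalley decomposition and its inverse have polynomially
growing powers, so `A ^ k` is a diagonal power up to polynomial factors. This replaces an explicit
Jordan form in every entropy estimate below. -/
theorem exists_eigencoordinates {d : ℕ} (A : Matrix (Fin d) (Fin d) ℂ) (hA : IsUnit A.det) :
    ∃ (l : Fin d → ℂ) (L : (Fin d → ℂ) ≃L[ℂ] (Fin d → ℂ)) (C : ℝ) (m : ℕ), 1 ≤ C ∧
      A.charpoly.roots = Finset.univ.val.map l ∧ (∀ i, l i ≠ 0) ∧ ∀ (k : ℕ) (v : Fin d → ℂ),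
        ‖A ^ k *ᵥ v‖ ≤ C * (1 + k) ^ m * ‖fun i => l i ^ k * L v i‖ ∧
        ‖fun i => l i ^ k * L v i‖ ≤ C * (1 + k) ^ m * ‖A ^ k *ᵥ v‖ := by
  set f : Module.End ℂ (Fin d → ℂ) := Matrix.toLin' A with hf_def
  have hfu : IsUnit f := by
    rw [LinearMap.isUnit_iff_isUnit_det, hf_def, LinearMap.det_toLin']
    exact hA
  obtain ⟨l, b, s, hsb, hcomm, hnil, hsu, hl, hroots⟩ := exists_diagonal_add_nilpotent hfu
  obtain ⟨C₁, m₁, hC₁, h₁⟩ := exists_norm_pow_le_of_isNilpotent_sub hcomm hsu hnil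
  obtain ⟨C₂, m₂, hC₂, h₂⟩ := exists_norm_pow_le_of_isNilpotent_sub hcomm.symm hfu
    (by rw [← neg_sub]; exact hnil.neg)
  set L : (Fin d → ℂ) ≃L[ℂ] (Fin d → ℂ) := b.equivFun.toContinuousLinearEquiv
  have hLs1 : ∀ w i, L (s w) i = l i * L w i := by
    intro w i
    have h1 : (b.coord i) ∘ₗ s = l i • b.coord i := by
      refine b.ext fun j => ?_
      rw [LinearMap.comp_apply, hsb, map_smul, LinearMap.smul_apply, b.coord_apply,
        b.repr_self, Finsupp.single_apply]
      split_ifs with hji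
      · rw [hji]
      · simp
    exact LinearMap.congr_fun h1 w
  have hLs : ∀ k v, L ((s ^ k) v) = fun i => l i ^ k * L v i := by
    intro k v
    induction k with
    | zero => simp
    | succ k ih =>
      rw [pow_succ', Module.End.mul_apply]
      funext i
      rw [hLs1, congrFun ih i, pow_succ', mul_assoc]
  have hAf : ∀ k v, A ^ k *ᵥ v = (f ^ k) v := by
    intro k v
    rw [hf_def, ← Matrix.toLin'_pow, Matrix.toLin'_apply]
  set K : ℝ := 1 + ‖(L : (Fin d → ℂ) →L[ℂ] (Fin d → ℂ))‖ + ‖(L.symm : (Fin d → ℂ) →L[ℂ] (Fin d → ℂ))‖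
  have hK1 : ∀ v, ‖L v‖ ≤ K * ‖v‖ := fun v =>
    ((L : (Fin d → ℂ) →L[ℂ] (Fin d → ℂ)).le_opNorm v).trans (by
      gcongr
      have := norm_nonneg (L.symm : (Fin d → ℂ) →L[ℂ] (Fin d → ℂ))
      simp only [K]; linarith)
  have hK2 : ∀ v, ‖v‖ ≤ K * ‖L v‖ := fun v => by
    have := ((L.symm : (Fin d → ℂ) →L[ℂ] (Fin d → ℂ)).le_opNorm (L v))
    simp only [ContinuousLinearEquiv.coe_coe, ContinuousLinearEquiv.symm_apply_apply] at this
    refine this.trans ?_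
    gcongr
    have := norm_nonneg (L : (Fin d → ℂ) →L[ℂ] (Fin d → ℂ))
    simp only [K]; linarith
  have hK0 : 1 ≤ K := by
    have := norm_nonneg (L : (Fin d → ℂ) →L[ℂ] (Fin d → ℂ))
    have := norm_nonneg (L.symm : (Fin d → ℂ) →L[ℂ] (Fin d → ℂ))
    simp only [K]; linarith
  -- Merges the constants of the two directions into a common constant and exponent.
  have hq : ∀ (C C' : ℝ) (m m' k : ℕ), 0 < C → C ≤ C' → m ≤ m' → C * K * (1 + (k : ℝ)) ^ m ≤
      (1 + C' * K) * (1 + k) ^ m' := by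
    intro C C' m m' k hC hCC hmm
    have h1 : (1 + (k : ℝ)) ^ m ≤ (1 + k) ^ m' :=
      pow_le_pow_right₀ (by linarith [(Nat.cast_nonneg k : (0 : ℝ) ≤ k)]) hmm
    have h2 : C * K ≤ 1 + C' * K := by nlinarith
    have h3 : 0 ≤ C * K := by positivity
    gcongr
    linarith
  refine ⟨l, L, 1 + (C₁ + C₂) * K, m₁ + m₂, ?_, ?_, ?_, fun k v => ⟨?_, ?_⟩⟩
  · have : 0 < (C₁ + C₂) * K := by positivity
    linarith
  · rw [← hroots, hf_def, Matrix.charpoly_toLin']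
  · exact hl
  · rw [hAf, ← hLs]
    calc ‖(f ^ k) v‖ ≤ C₁ * (1 + k) ^ m₁ * ‖(s ^ k) v‖ := h₁ k v
      _ ≤ C₁ * (1 + k) ^ m₁ * (K * ‖L ((s ^ k) v)‖) := by gcongr; exact hK2 _
      _ = C₁ * K * (1 + k) ^ m₁ * ‖L ((s ^ k) v)‖ := by ring
      _ ≤ _ := by
        gcongr ?_ * _
        exact hq _ _ _ _ _ hC₁ (by linarith) (by omega)
  · rw [hAf, ← hLs]
    calc ‖L ((s ^ k) v)‖ ≤ K * ‖(s ^ k) v‖ := hK1 _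
      _ ≤ K * (C₂ * (1 + k) ^ m₂ * ‖(f ^ k) v‖) := by gcongr; exact h₂ k v
      _ = C₂ * K * (1 + k) ^ m₂ * ‖(f ^ k) v‖ := by ring
      _ ≤ _ := by
        gcongr ?_ * _
        exact hq _ _ _ _ _ hC₂ (by linarith) (by omega)

/-! ### The entropy of a linear map on oriented lines -/

lemma eventually_polynomial_le_exp (c : ℝ) (M : ℕ) {H : ℝ} (hH : 0 < H) :
    ∀ᶠ n : ℕ in atTop, c * (1 + n) ^ M ≤ Real.exp (H * n) := by
  have h1 : Tendsto (fun x : ℝ => x ^ M / Real.exp (H * x)) atTop (𝓝 0) := (isLittleO_pow_exp_pos_mul_atTop M hH).tendsto_div_nhds_zero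
  have h2 : Tendsto (fun n : ℕ => (1 + n : ℝ)) atTop atTop :=
    tendsto_atTop_add_const_left _ _ tendsto_natCast_atTop_atTop
  have h3 := ((h1.comp h2).const_mul (|c| * Real.exp H))
  rw [mul_zero] at h3
  filter_upwards [h3.eventually_le_const one_pos] with n hn
  simp only [Function.comp_apply] at hn
  rw [mul_add, mul_one, Real.exp_add, ← mul_div_assoc, mul_assoc, mul_left_comm,
    mul_div_mul_left _ _ (Real.exp_pos H).ne', div_le_one (Real.exp_pos _)] at hn
  refine le_trans ?_ hn
  gcongr
  exact le_abs_self c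

/-- The derivative of `sinh` is `cosh ≤ 1 + |sinh|`. Thus uniform precision in `arsinh t` amounts to
mixed absolute and relative precision in `t`. -/
lemma abs_sinh_sub_sinh_le {x y η : ℝ} (h : |x - y| ≤ η) (hη : η ≤ 1) :
    |Real.sinh x - Real.sinh y| ≤ 2 * η * (1 + |Real.sinh x|) := by
  have hexp : ∀ a b : ℝ, |a - b| ≤ η → |Real.exp a - Real.exp b| ≤ Real.exp a * (2 * η) := by
    intro a b hab
    have h1 := Real.abs_exp_sub_one_le (x := b - a) (by rw [abs_sub_comm]; linarith)
    have h2 : Real.exp a - Real.exp b = -(Real.exp a * (Real.exp (b - a) - 1)) := by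
      rw [mul_sub, ← Real.exp_add]; ring_nf
    rw [h2, abs_neg, abs_mul, abs_of_pos (Real.exp_pos a)]
    rw [abs_sub_comm] at hab
    gcongr
    linarith
  have hcosh : Real.cosh x ≤ 1 + |Real.sinh x| := by
    have := Real.cosh_sq x
    nlinarith [abs_nonneg (Real.sinh x), sq_abs (Real.sinh x), Real.cosh_pos x]
  have h1 := abs_le.1 (hexp x y h)
  have h2 := abs_le.1 (hexp (-x) (-y) (by rwa [neg_sub_neg, abs_sub_comm]))
  have h0 : 0 ≤ η := (abs_nonneg _).trans h
  have h3 : 2 * η * Real.cosh x ≤ 2 * η * (1 + |Real.sinh x|) := by gcongr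
  rw [Real.cosh_eq] at h3
  rw [abs_le]
  generalize |Real.sinh x| = t at *
  rw [Real.sinh_eq x, Real.sinh_eq y]
  constructor <;> linarith

/-- Label by equal intervals on the scale of `arsinh (g R ^ n)`. This scale is linear for `|g|`
below about `R ^ (-n)` and logarithmic above, so it gives relative precision with an absolute floor
`R ^ (-n)`. Its range has length linear in `n`, hence only about `n / η` labels are needed. -/
lemma Coded.relative {X : Type*} {F : Set X} {g : X → ℝ} {K R η : ℝ} (n : ℕ) (hK : 0 ≤ K)
    (hg : ∀ x ∈ F, |g x| ≤ K) (hR : 1 ≤ R) (hη : 0 < η) (hη1 : η ≤ 1) :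
    Coded F (2 * ((Real.log (1 + 2 * K) + n * Real.log R) / η) + 3)
      (fun x y => |g x - g y| ≤ 2 * η * ((R ^ n)⁻¹ + |g x|)) := by
  have hRn : 1 ≤ R ^ n := one_le_pow₀ hR
  have hK' : 0 ≤ Real.log (1 + 2 * K) + n * Real.log R :=
    add_nonneg (Real.log_nonneg (by linarith)) (mul_nonneg n.cast_nonneg (Real.log_nonneg hR))
  have hars : ∀ t : ℝ, t ≤ K → Real.arsinh (t * R ^ n) ≤ Real.log (1 + 2 * K) + n * Real.log R := by
    intro t ht
    have h1 : Real.arsinh (t * R ^ n) ≤ Real.arsinh (K * R ^ n) := by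
      rw [Real.arsinh_le_arsinh]; gcongr
    refine h1.trans ?_
    have hpos : 0 ≤ K * R ^ n := by positivity
    rw [← Real.log_pow, ← Real.log_mul (by positivity) (by positivity), Real.arsinh]
    apply Real.log_le_log (by positivity)
    have : √(1 + (K * R ^ n) ^ 2) ≤ 1 + K * R ^ n := by
      rw [Real.sqrt_le_left (by positivity)]; nlinarith
    nlinarith
  have hf : ∀ x ∈ F, |Real.arsinh (g x * R ^ n)| ≤ Real.log (1 + 2 * K) + n * Real.log R := by
    intro x hx
    have h := abs_le.1 (hg x hx)
    rw [abs_le]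
    refine ⟨?_, hars _ h.2⟩
    have := hars (-g x) (by linarith)
    rw [neg_mul, Real.arsinh_neg] at this
    linarith
  refine (Coded.floor hη hf hK').mono subset_rfl le_rfl fun x _ y _ hxy => ?_
  have h1 := abs_sinh_sub_sinh_le hxy hη1
  rw [Real.sinh_arsinh, Real.sinh_arsinh, ← sub_mul, abs_mul, abs_mul,
    abs_of_pos (by positivity : 0 < R ^ n)] at h1
  have h2 : |g x - g y| * R ^ n * (R ^ n)⁻¹ ≤
      2 * η * (1 + |g x| * R ^ n) * (R ^ n)⁻¹ := by gcongr
  rw [mul_assoc, mul_inv_cancel₀ (by positivity), mul_one] at h2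
  refine h2.trans (le_of_eq ?_)
  field_simp

lemma exists_between_norms {d : ℕ} {l : Fin d → ℂ} (hl : ∀ i, l i ≠ 0) :
    ∃ a b : ℝ, 0 < a ∧ a ≤ b ∧ ∀ i, a ≤ ‖l i‖ ∧ ‖l i‖ ≤ b := by
  refine ⟨(1 + ∑ i, ‖l i‖⁻¹)⁻¹, 1 + ∑ i, ‖l i‖, by positivity, ?_, fun i => ⟨?_, ?_⟩⟩
  · calc (1 + ∑ i, ‖l i‖⁻¹)⁻¹ ≤ 1 := inv_le_one_of_one_le₀ (le_add_of_nonneg_right (by positivity))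
      _ ≤ _ := le_add_of_nonneg_right (by positivity)
  · rw [inv_le_comm₀ (by positivity) (norm_pos_iff.2 (hl i))]
    have := Finset.single_le_sum (f := fun i => ‖l i‖⁻¹) (fun _ _ => by positivity)
      (Finset.mem_univ i)
    linarith
  · have := Finset.single_le_sum (f := fun i => ‖l i‖) (fun _ _ => by positivity)
      (Finset.mem_univ i)
    linarith

/-- A diagonal map multiplies an eigencoordinate and its error by the same factor, so relative
errors do not grow. The polynomial distortion between `A ^ k` and its diagonal part is compensated
by a polynomially small `η`, and the number of labels stays polynomial in `n`. -/
theorem eventually_coded_directions {d : ℕ} {A : Matrix (Fin d) (Fin d) ℂ} (hA : IsUnit A.det)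
    {θ : ℝ} (hθ : 0 < θ) (hθ1 : θ ≤ 1) {H : ℝ} (hH : 0 < H) :
    ∀ᶠ n : ℕ in atTop, Coded {v : Fin d → ℂ | 1 / 2 ≤ ‖v‖ ∧ ‖v‖ ≤ 1} (Real.exp (H * n))
      (fun v w => ∀ k < n, ‖A ^ k *ᵥ (v - w)‖ ≤ θ * ‖A ^ k *ᵥ v‖) := by
  obtain ⟨l, L, C, m, hC, -, hl, hAL⟩ := exists_eigencoordinates A hA
  obtain ⟨a, b, ha, hab, hlab⟩ := exists_between_norms hl
  have hb : 0 < b := ha.trans_le hab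
  -- The greatest possible ratio between the growth of two eigencoordinates in one step. An absolute
  -- error `R ^ (-n)` stays harmless for `n` steps.
  set R : ℝ := b / a
  have hR : 1 ≤ R := (one_le_div ha).2 hab
  set c₀ : ℝ := 8 * (2 * C + 1) * C ^ 2 / θ with hc₀
  have hc₀' : 0 < c₀ := by positivity
  have hc₁ : 0 ≤ Real.log (1 + 2 * C) := Real.log_nonneg (by linarith)
  have hc₂ : 0 ≤ Real.log R := Real.log_nonneg hR
  set c : ℝ := 2 * ((Real.log (1 + 2 * C) + Real.log R) * c₀) + 3
  filter_upwards [eventually_polynomial_le_exp ((c * c) ^ d) ((2 * m + 1 + (2 * m + 1)) * d) hH]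
    with n hn
  have hn1 : (1 : ℝ) ≤ 1 + n := by linarith [(Nat.cast_nonneg n : (0 : ℝ) ≤ n)]
  set q : ℝ := C * (1 + n) ^ m with hq
  have hq1 : 1 ≤ q := one_le_mul_of_one_le_of_one_le hC (one_le_pow₀ hn1)
  -- The final estimate is `4 η (2 C + 1) q ^ 2 = θ / 2`: a factor `q` is lost on passing to
  -- eigencoordinates and another on returning, and `2 C + 1` absorbs the absolute error.
  set η : ℝ := θ / (8 * (2 * C + 1) * q ^ 2) with hη_def
  have hη : 0 < η := by positivity
  have hη1 : η ≤ 1 := by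
    rw [hη_def, div_le_one (by positivity)]
    nlinarith [one_le_pow₀ hq1 (n := 2)]
  have hηinv : η⁻¹ = c₀ * (1 + n) ^ (2 * m) := by
    rw [hη_def, hc₀, hq]; field_simp; ring
  have hL0 : ∀ v, ‖L v‖ ≤ C * ‖v‖ ∧ ‖v‖ ≤ C * ‖L v‖ := by
    intro v
    have := hAL 0 v
    simp only [pow_zero, Matrix.one_mulVec, one_mul, Nat.cast_zero, add_zero, one_pow,
      mul_one] at this
    exact ⟨this.2, this.1⟩
  have hcount : 2 * ((Real.log (1 + 2 * C) + n * Real.log R) / η) + 3 ≤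
      c * (1 + n) ^ (2 * m + 1) := by
    rw [div_eq_mul_inv, hηinv]
    have h1 : (1 : ℝ) ≤ (1 + n) ^ (2 * m + 1) := one_le_pow₀ hn1
    have h2 : Real.log (1 + 2 * C) + n * Real.log R ≤
        (Real.log (1 + 2 * C) + Real.log R) * (1 + n) := by
      nlinarith [(Nat.cast_nonneg n : (0 : ℝ) ≤ n)]
    calc _ ≤ 2 * (((Real.log (1 + 2 * C) + Real.log R) * (1 + n)) * (c₀ * (1 + n) ^ (2 * m))) +
          3 * (1 + n) ^ (2 * m + 1) := by gcongr; linarith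
      _ = _ := by simp only [c]; ring
  set F : Set (Fin d → ℂ) := {v | 1 / 2 ≤ ‖v‖ ∧ ‖v‖ ≤ 1}
  have hbound : ∀ v ∈ F, ∀ i, ‖L v i‖ ≤ C := by
    intro v hv i
    calc ‖L v i‖ ≤ ‖L v‖ := norm_le_pi_norm _ i
      _ ≤ C * ‖v‖ := (hL0 v).1
      _ ≤ C * 1 := by gcongr; exact hv.2
      _ = C := mul_one _
  have hcode := Coded.pi (F := F) fun i =>
    (Coded.relative (g := fun v => (L v i).re) n (by positivity)
      (fun v hv => (Complex.abs_re_le_norm _).trans (hbound v hv i)) hR hη hη1).and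
    (Coded.relative (g := fun v => (L v i).im) n (by positivity)
      (fun v hv => (Complex.abs_im_le_norm _).trans (hbound v hv i)) hR hη hη1)
  refine hcode.mono subset_rfl ?_ ?_
  · rw [Finset.prod_const, Finset.card_univ, Fintype.card_fin]
    refine le_trans ?_ hn
    have h0 : 0 ≤ 2 * ((Real.log (1 + 2 * C) + n * Real.log R) / η) + 3 := by positivity
    calc _ ≤ (c * (1 + n) ^ (2 * m + 1) * (c * (1 + n) ^ (2 * m + 1))) ^ d := by
          gcongr
      _ = _ := by rw [mul_mul_mul_comm, ← pow_add, mul_pow _ _ d, ← pow_mul]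
  · intro v hv w hw hvw k hk
    have hx : 1 ≤ 2 * C * ‖L v‖ := by
      have := (hL0 v).2
      have := hv.1
      linarith
    have hqk : C * (1 + k) ^ m ≤ q := by
      rw [hq]
      have : (k : ℝ) ≤ n := by exact_mod_cast hk.le
      gcongr
    set z : ℝ := ‖fun i => l i ^ k * L v i‖ with hz
    have hz1 : ∀ i, ‖l i‖ ^ k * ‖L v i‖ ≤ z := by
      intro i
      have := norm_le_pi_norm (fun i => l i ^ k * L v i) i
      rwa [norm_mul, norm_pow] at this
    -- The orbit cannot shrink faster than the smallest eigenvalue permits; here the lower bound `1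
    -- / 2` on the initial norm enters.
    have hz2 : a ^ k ≤ 2 * C * z := by
      have : a ^ k * ‖L v‖ ≤ z := by
        have h1 : ‖L v‖ ≤ (a ^ k)⁻¹ * z := by
          refine (pi_norm_le_iff_of_nonneg (by positivity)).2 fun i => ?_
          rw [inv_mul_eq_div, le_div_iff₀ (by positivity), mul_comm]
          refine le_trans ?_ (hz1 i)
          gcongr
          exact (hlab i).1
        calc a ^ k * ‖L v‖ ≤ a ^ k * ((a ^ k)⁻¹ * z) := by gcongr
          _ = z := by field_simp
      calc a ^ k ≤ a ^ k * (2 * C * ‖L v‖) := le_mul_of_one_le_right (by positivity) hx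
        _ = 2 * C * (a ^ k * ‖L v‖) := by ring
        _ ≤ _ := by gcongr
    -- The absolute error grows at most like `b ^ k`, yet for `k < n` it stays below `a ^ k`, hence
    -- below a multiple of the orbit's size.
    have hs : (R ^ n)⁻¹ * b ^ k ≤ a ^ k := by
      have h1 : R ^ k ≤ R ^ n := pow_le_pow_right₀ hR hk.le
      calc (R ^ n)⁻¹ * b ^ k ≤ (R ^ k)⁻¹ * b ^ k := by gcongr
        _ = a ^ k := by simp only [R]; rw [div_pow]; field_simp
    have hmain : ‖fun i => l i ^ k * L (v - w) i‖ ≤ 4 * η * ((2 * C + 1) * z) := by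
      refine (pi_norm_le_iff_of_nonneg (by positivity)).2 fun i => ?_
      obtain ⟨h1, h2⟩ := hvw i
      have h3 : ‖L (v - w) i‖ ≤ 4 * η * ((R ^ n)⁻¹ + ‖L v i‖) := by
        have h4 := Complex.norm_le_abs_re_add_abs_im (L (v - w) i)
        rw [map_sub, Pi.sub_apply, Complex.sub_re, Complex.sub_im] at h4
        have h5 : 2 * η * ((R ^ n)⁻¹ + |(L v i).re|) ≤ 2 * η * ((R ^ n)⁻¹ + ‖L v i‖) := by
          gcongr; exact Complex.abs_re_le_norm _
        have h6 : 2 * η * ((R ^ n)⁻¹ + |(L v i).im|) ≤ 2 * η * ((R ^ n)⁻¹ + ‖L v i‖) := by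
          gcongr; exact Complex.abs_im_le_norm _
        rw [map_sub, Pi.sub_apply]
        linarith
      rw [norm_mul, norm_pow]
      calc ‖l i‖ ^ k * ‖L (v - w) i‖ ≤ ‖l i‖ ^ k * (4 * η * ((R ^ n)⁻¹ + ‖L v i‖)) := by gcongr
        _ = 4 * η * ((R ^ n)⁻¹ * ‖l i‖ ^ k + ‖l i‖ ^ k * ‖L v i‖) := by ring
        _ ≤ 4 * η * ((R ^ n)⁻¹ * b ^ k + z) := by
          gcongr
          · exact (hlab i).2
          · exact hz1 i
        _ ≤ 4 * η * ((2 * C + 1) * z) := by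
          gcongr
          linarith
    have hz0 : 0 ≤ z := norm_nonneg _
    calc ‖A ^ k *ᵥ (v - w)‖ ≤ C * (1 + k) ^ m * ‖fun i => l i ^ k * L (v - w) i‖ := (hAL k _).1
      _ ≤ q * (4 * η * ((2 * C + 1) * z)) := by gcongr
      _ ≤ q * (4 * η * ((2 * C + 1) * (q * ‖A ^ k *ᵥ v‖))) := by
        gcongr
        refine (hAL k v).2.trans ?_
        gcongr
      _ = θ / 2 * ‖A ^ k *ᵥ v‖ := by rw [hη_def]; field_simp; norm_num
      _ ≤ θ * ‖A ^ k *ᵥ v‖ := by gcongr; linarith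

/-! ### The entropy of the projective action on oriented lines -/

/-- The real coordinates `(a₁, b₁, a₂, b₂)` of a point of `ℂ²`, as complex numbers. -/
def coords : C2 →ₗ[ℝ] (Fin 4 → ℂ) where
  toFun w := ![((w 0).re : ℂ), ((w 0).im : ℂ), ((w 1).re : ℂ), ((w 1).im : ℂ)]
  map_add' w w' := by
    funext i
    fin_cases i <;> simp
  map_smul' c w := by
    funext i
    fin_cases i <;> simp

lemma coords_castSucc (w : C2) (j : Fin 3) : coords w j.castSucc = (re3 w j : ℂ) := by
  fin_cases j <;> rfl

lemma coords_last (w : C2) : coords w (Fin.last 3) = ((w 1).im : ℂ) := rfl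

lemma norm_coords_le (w : C2) : ‖coords w‖ ≤ ‖w‖ := by
  have h : ∀ (j : Fin 2), ‖w j‖ ≤ ‖w‖ := fun j => PiLp.norm_apply_le w j
  refine (pi_norm_le_iff_of_nonneg (norm_nonneg w)).2 fun i => ?_
  refine Fin.lastCases ?_ (fun j => ?_) i
  · rw [coords_last, Complex.norm_real]
    exact (Complex.abs_im_le_norm _).trans (h 1)
  · rw [coords_castSucc, Complex.norm_real]
    fin_cases j
    · exact (Complex.abs_re_le_norm _).trans (h 0)
    · exact (Complex.abs_im_le_norm _).trans (h 0)
    · exact (Complex.abs_re_le_norm _).trans (h 1)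

lemma norm_sq_eq_coords (w : C2) :
    ‖w‖ ^ 2 = ∑ j, re3 w j ^ 2 + (w 1).im ^ 2 := by
  rw [EuclideanSpace.norm_sq_eq, Fin.sum_univ_two, Fin.sum_univ_three, Complex.sq_norm,
    Complex.sq_norm, Complex.normSq_apply, Complex.normSq_apply]
  simp only [re3, Matrix.cons_val_zero, Matrix.cons_val_one, Matrix.cons_val]
  ring

lemma norm_le_coords (w : C2) : ‖w‖ ≤ 2 * ‖coords w‖ := by
  have h : ∀ i, ‖coords w i‖ ^ 2 ≤ ‖coords w‖ ^ 2 := fun i => by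
    gcongr; exact norm_le_pi_norm _ i
  have h0 := h (Fin.last 3)
  rw [coords_last, Complex.norm_real, Real.norm_eq_abs, sq_abs] at h0
  have h1 : ∀ j, re3 w j ^ 2 ≤ ‖coords w‖ ^ 2 := fun j => by
    have := h j.castSucc
    rwa [coords_castSucc, Complex.norm_real, Real.norm_eq_abs, sq_abs] at this
  apply le_of_sq_le_sq _ (by positivity)
  rw [norm_sq_eq_coords, Fin.sum_univ_three]
  linarith [h1 0, h1 1, h1 2]

/-- The matrix of `G ⊕ id` in the coordinates `coords`. -/
def extendMatrix (G : SpecialLinearGroup (Fin 3) ℝ) : Matrix (Fin 4) (Fin 4) ℂ :=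
  Matrix.reindex finSumFinEquiv finSumFinEquiv
    (Matrix.fromBlocks (G.1.map ((↑) : ℝ → ℂ)) 0 0 (1 : Matrix (Fin 1) (Fin 1) ℂ))

lemma isUnit_det_extendMatrix (G : SpecialLinearGroup (Fin 3) ℝ) :
    IsUnit (extendMatrix G).det := by
  rw [extendMatrix, Matrix.det_reindex_self, Matrix.det_fromBlocks_zero₂₁, Matrix.det_one, mul_one]
  have h : (G.1.map ((↑) : ℝ → ℂ)).det = ((G.1.det : ℝ) : ℂ) :=
    (RingHom.map_det Complex.ofRealHom G.1).symm
  rw [h, G.2]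
  simp

lemma coords_extend (G : SpecialLinearGroup (Fin 3) ℝ) (w : C2) :
    coords (extend G w) = extendMatrix G *ᵥ coords w := by
  have hw : coords w ∘ (finSumFinEquiv : Fin 3 ⊕ Fin 1 ≃ Fin 4) = Sum.elim (fun j => (re3 w j : ℂ)) (fun _ => ((w 1).im : ℂ)) := by
    funext i
    rcases i with j | j
    · exact coords_castSucc w j
    · obtain rfl := Subsingleton.elim j 0
      exact coords_last w
  rw [extendMatrix, Matrix.reindex_apply, Matrix.submatrix_mulVec_equiv, Equiv.symm_symm, hw,
    Matrix.fromBlocks_mulVec]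
  funext i
  refine Fin.lastCases ?_ (fun j => ?_) i
  · rw [coords_last, extend_im]
    have : finSumFinEquiv.symm (Fin.last 3) = (Sum.inr 0 : Fin 3 ⊕ Fin 1) := by
      rw [Equiv.symm_apply_eq]; rfl
    rw [Function.comp_apply, this, Sum.elim_inr]
    simp
  · rw [coords_castSucc, re3_extend]
    have : finSumFinEquiv.symm j.castSucc = (Sum.inl j : Fin 3 ⊕ Fin 1) := by
      rw [Equiv.symm_apply_eq]; rfl
    simp [this, Matrix.mulVec, dotProduct]

lemma coords_extend_iterate (G : SpecialLinearGroup (Fin 3) ℝ) (k : ℕ) (w : C2) :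
    coords ((extend G)^[k] w) = extendMatrix G ^ k *ᵥ coords w := by
  induction k with
  | zero => simp
  | succ k ih => rw [Function.iterate_succ_apply', coords_extend, ih, Matrix.mulVec_mulVec, pow_succ']

lemma coords_injective : Function.Injective coords := by
  rw [← LinearMap.ker_eq_bot, LinearMap.ker_eq_bot']
  intro w hw
  have := norm_le_coords w
  rw [hw, norm_zero, mul_zero] at this
  exact norm_le_zero_iff.1 this

lemma extend_smul (G : SpecialLinearGroup (Fin 3) ℝ) (c : ℝ) (w : C2) :
    extend G (c • w) = c • extend G w := by
  apply coords_injective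
  rw [coords_extend, map_smul, map_smul, coords_extend, Matrix.mulVec_smul]

lemma ray_iterate (G : SpecialLinearGroup (Fin 3) ℝ) (k : ℕ) (σ : S3) :
    (((ray G)^[k] σ : S3) : C2) = (‖(extend G)^[k] σ.1‖⁻¹ : ℝ) • (extend G)^[k] σ.1 := by
  induction k with
  | zero => simp [mem_sphere_zero_iff_norm.mp σ.2]
  | succ k ih =>
    have hne : ∀ k, (extend G)^[k] σ.1 ≠ 0 := by
      intro k
      induction k with
      | zero => exact ne_zero_of_mem_unit_sphere σ
      | succ k ih => rw [Function.iterate_succ_apply']; exact extend_ne_zero G ih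
    have h0 : ‖(extend G)^[k] σ.1‖ ≠ 0 := norm_ne_zero_iff.2 (hne k)
    rw [Function.iterate_succ_apply', Function.iterate_succ_apply']
    change (‖extend G ((ray G)^[k] σ).1‖⁻¹ : ℝ) • extend G ((ray G)^[k] σ).1 = _
    rw [ih, extend_smul, norm_smul, smul_smul, norm_inv, norm_norm]
    congr 1
    field_simp

lemma norm_normalize_sub_le {E : Type*} [NormedAddCommGroup E] [NormedSpace ℝ E] {u v : E}
    (hu : u ≠ 0) (hv : v ≠ 0) : ‖(‖u‖⁻¹ : ℝ) • u - (‖v‖⁻¹ : ℝ) • v‖ ≤ 2 * ‖u - v‖ / ‖u‖ := by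
  have hu' : 0 < ‖u‖ := norm_pos_iff.2 hu
  have hv' : 0 < ‖v‖ := norm_pos_iff.2 hv
  have h : (‖u‖⁻¹ : ℝ) • u - (‖v‖⁻¹ : ℝ) • v =
      (‖u‖⁻¹ : ℝ) • (u - v) + ((‖u‖⁻¹ : ℝ) * (‖v‖ - ‖u‖) * ‖v‖⁻¹) • v := by
    have h1 : (‖u‖⁻¹ : ℝ) * (‖v‖ - ‖u‖) * ‖v‖⁻¹ = ‖u‖⁻¹ - ‖v‖⁻¹ := by field_simp
    rw [h1, smul_sub, sub_smul]
    abel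
  rw [h]
  refine (norm_add_le _ _).trans ?_
  rw [norm_smul, norm_smul, norm_mul, norm_mul, norm_inv, norm_inv, norm_norm, norm_norm,
    mul_assoc, inv_mul_cancel₀ hv'.ne', mul_one, Real.norm_eq_abs]
  have h2 : |‖v‖ - ‖u‖| ≤ ‖u - v‖ := by
    rw [abs_sub_comm]; exact abs_norm_sub_norm_le u v
  calc _ ≤ ‖u‖⁻¹ * ‖u - v‖ + ‖u‖⁻¹ * ‖u - v‖ := by gcongr
    _ = _ := by field_simp; ring

/-- Normalised vectors are close when the vectors are close relative to their length, so
polynomially many labels for the linear orbits suffice. The sphere lies in the shell `1 / 2 ≤ ‖·‖ ≤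
1` of the sup norm of `coords`. -/
theorem topEntropyLE_ray (G : SpecialLinearGroup (Fin 3) ℝ) : TopEntropyLE (ray G) univ 0 := by
  intro U hU H hH
  rw [nhdsSet_diagonal_eq_uniformity] at hU
  obtain ⟨ε, hε, hεU⟩ := Metric.mem_uniformity_dist.1 hU
  -- Normalising costs a factor `2` and the comparison of norms another `2`, so `ε / 8` leaves `ε /
  -- 2`.
  set θ : ℝ := min 1 (ε / 8)
  have hθ : 0 < θ := lt_min one_pos (by positivity)
  filter_upwards [eventually_coded_directions (isUnit_det_extendMatrix G) hθ (min_le_left _ _) hH]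
    with n hn
  refine (hn.comap fun σ : S3 => coords σ).mono ?_ le_rfl fun σ _ σ' _ h k hk => hεU ?_
  · intro σ _
    have h1 := norm_le_coords σ.1
    have h2 := norm_coords_le σ.1
    rw [mem_sphere_zero_iff_norm.mp σ.2] at h1 h2
    exact ⟨by linarith, h2⟩
  have hne : ∀ σ : S3, (extend G)^[k] σ.1 ≠ 0 := by
    intro σ
    clear hk
    induction k with
    | zero => exact ne_zero_of_mem_unit_sphere σ
    | succ k ih => rw [Function.iterate_succ_apply']; exact extend_ne_zero G ih
  have h1 := h k hk
  rw [Matrix.mulVec_sub, ← coords_extend_iterate, ← coords_extend_iterate, ← map_sub] at h1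
  rw [Subtype.dist_eq, dist_eq_norm, ray_iterate, ray_iterate]
  refine (norm_normalize_sub_le (hne σ) (hne σ')).trans_lt ?_
  rw [div_lt_iff₀ (norm_pos_iff.2 (hne σ))]
  have h2 := norm_le_coords ((extend G)^[k] σ.1 - (extend G)^[k] σ'.1)
  have h3 := norm_coords_le ((extend G)^[k] σ.1)
  have h4 : 0 < ‖(extend G)^[k] σ.1‖ := norm_pos_iff.2 (hne σ)
  have h5 : θ ≤ ε / 8 := min_le_right _ _
  have h6 : θ * ‖coords ((extend G)^[k] σ.1)‖ ≤ ε / 8 * ‖(extend G)^[k] σ.1‖ := by gcongr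
  nlinarith

/-! ### The tori as compact Hausdorff groups -/

lemma xi_re : xi.re = -1 / 2 := by
  have h := congrArg Complex.re one_add_two_xi
  simp at h
  linarith

lemma xi_im : xi.im = √3 / 2 := by
  have h := congrArg Complex.im one_add_two_xi
  simp at h
  linarith

lemma norm_xi : ‖xi‖ = 1 :=
  Complex.norm_eq_one_of_pow_eq_one xi_pow_three (by norm_num)

/-- The imaginary part is `n √3 / 2` and `√3 / 2 > 1 / 2`, which forces `n = 0`. -/
lemma eq_zero_of_norm_add_xi_mul_lt {m n : ℤ} (h : ‖(m : ℂ) + xi * n‖ < 1 / 2) : m = 0 ∧ n = 0 := by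
  have h3 : (1 : ℝ) < √3 := by
    rw [Real.lt_sqrt (by norm_num)]; norm_num
  have hn : n = 0 := by
    have h1 := (Complex.abs_im_le_norm _).trans_lt h
    simp only [Complex.add_im, Complex.intCast_im, Complex.mul_im, Complex.intCast_re, xi_im] at h1
    by_contra hn
    have h2 : (1 : ℝ) ≤ |(n : ℝ)| := by exact_mod_cast Int.one_le_abs hn
    have h4 : 0 + (xi.re * 0 + √3 / 2 * n) = √3 / 2 * n := by ring
    rw [h4, abs_mul, abs_of_pos (by positivity)] at h1
    nlinarith
  subst hn
  refine ⟨?_, rfl⟩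
  by_contra hm
  have h2 : (1 : ℝ) ≤ |(m : ℝ)| := by exact_mod_cast Int.one_le_abs hm
  have h5 : ‖(m : ℂ) + xi * (0 : ℤ)‖ = |(m : ℝ)| := by simp
  rw [h5] at h
  linarith

lemma eq_zero_of_mem_lattice {v : V} (hv : v ∈ lattice) (h : ‖v‖ < 1 / 2) : v = 0 := by
  obtain ⟨⟨m, n, hz⟩, k, hk⟩ := hv
  have h1 : ‖v.1‖ < 1 / 2 := (norm_fst_le v).trans_lt h
  have h2 : ‖v.2‖ < 1 / 2 := (norm_snd_le v).trans_lt h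
  apply Prod.ext
  · funext j
    have h3 := (norm_le_pi_norm v.1 j).trans_lt h1
    rw [hz j] at h3 ⊢
    obtain ⟨h4, h5⟩ := eq_zero_of_norm_add_xi_mul_lt h3
    simp [h4, h5]
  · have hk' : v.2 = k := by simpa using hk.symm
    have : k = 0 := by
      by_contra hk0
      have h2' : (1 : ℝ) ≤ |(k : ℝ)| := by exact_mod_cast Int.one_le_abs hk0
      rw [hk', Real.norm_eq_abs] at h2
      linarith
    simp [hk', this]

instance : DiscreteTopology lattice := by
  refine discreteTopology_of_isOpen_singleton_zero ?_
  have : ({0} : Set lattice) = Metric.ball 0 (1 / 2) := by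
    ext v
    simp only [mem_singleton_iff, Metric.mem_ball, dist_zero_right]
    refine ⟨fun h => by simp [h], fun h => Subtype.ext (eq_zero_of_mem_lattice v.2 h)⟩
  rw [this]
  exact Metric.isOpen_ball

instance : IsClosed (lattice : Set V) := AddSubgroup.isClosed_of_discrete

instance : T2Space Torus7 := inferInstance

/-- Take fractional parts in the real basis `1, ξ`. The bound yields compactness and supplies the
bounded lifts that are labelled in the upper entropy bound. -/
lemma exists_mk_eq_norm_le (a : Torus7) : ∃ v : V, QuotientAddGroup.mk v = a ∧ ‖v‖ ≤ 2 := by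
  induction a using QuotientAddGroup.induction_on with
  | H v =>
    have hs : √3 / 2 ≠ 0 := by positivity
    set q : Fin 3 → ℝ := fun j => (v.1 j).im / (√3 / 2)
    set p : Fin 3 → ℝ := fun j => (v.1 j).re + q j / 2
    have hpq : ∀ j, v.1 j = p j + xi * q j := by
      intro j
      apply Complex.ext
      · simp only [Complex.add_re, Complex.ofReal_re, Complex.mul_re, Complex.ofReal_im, xi_re, p]
        ring
      · simp only [Complex.add_im, Complex.ofReal_re, Complex.mul_im, Complex.ofReal_im, xi_im, q]
        field_simp
        ring
    refine ⟨(fun j => ((Int.fract (p j) : ℝ) : ℂ) + xi * (Int.fract (q j) : ℝ), Int.fract v.2), ?_, ?_⟩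
    · rw [QuotientAddGroup.eq]
      refine ⟨⟨fun j => ⌊p j⌋, fun j => ⌊q j⌋, fun j => ?_⟩, ⌊v.2⌋, ?_⟩
      · have h1 : (p j : ℂ) = ⌊p j⌋ + (Int.fract (p j) : ℝ) := by
          exact_mod_cast (Int.floor_add_fract (p j)).symm
        have h2 : (q j : ℂ) = ⌊q j⌋ + (Int.fract (q j) : ℝ) := by
          exact_mod_cast (Int.floor_add_fract (q j)).symm
        have h3 := hpq j
        rw [h1, h2] at h3
        simp only [Prod.fst_add, Prod.fst_neg, Pi.add_apply, Pi.neg_apply]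
        rw [h3]
        ring
      · have := Int.floor_add_fract v.2
        simp
        linarith
    · refine max_le ((pi_norm_le_iff_of_nonneg (by norm_num)).2 fun j => ?_) ?_
      · refine (norm_add_le _ _).trans ?_
        rw [norm_mul, norm_xi, one_mul, Complex.norm_real, Complex.norm_real, Real.norm_eq_abs,
          Real.norm_eq_abs, Int.abs_fract, Int.abs_fract]
        linarith [Int.fract_lt_one (p j), Int.fract_lt_one (q j)]
      · rw [Real.norm_eq_abs, Int.abs_fract]
        linarith [Int.fract_lt_one v.2]

instance : CompactSpace Torus7 := by
  refine ⟨?_⟩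
  have : (univ : Set Torus7) = QuotientAddGroup.mk '' Metric.closedBall (0 : V) 2 := by
    refine (eq_univ_of_forall fun a => ?_).symm
    obtain ⟨v, rfl, hv⟩ := exists_mk_eq_norm_le a
    exact ⟨v, by simpa using hv, rfl⟩
  rw [this]
  exact (isCompact_closedBall _ _).image continuous_quotient_mk'

instance : CompactSpace Torus3 := by
  refine ⟨?_⟩
  have : (univ : Set Torus3) = QuotientAddGroup.mk '' Metric.closedBall (0 : Fin 3 → ℝ) 1 := by
    refine (eq_univ_of_forall fun p => ?_).symm
    induction p using QuotientAddGroup.induction_on with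
    | H y =>
      refine ⟨fun j => Int.fract (y j), ?_, ?_⟩
      · rw [mem_closedBall_zero_iff]
        refine (pi_norm_le_iff_of_nonneg zero_le_one).2 fun j => ?_
        rw [Real.norm_eq_abs, Int.abs_fract]
        exact (Int.fract_lt_one _).le
      · rw [QuotientAddGroup.eq]
        refine ⟨fun j => ⌊y j⌋, fun j => ?_⟩
        have := Int.floor_add_fract (y j)
        simp only [Pi.add_apply, Pi.neg_apply]
        linarith
  rw [this]
  exact (isCompact_closedBall _ _).image continuous_quotient_mk'

/-! ### The linear map and its eigenvalues -/

/-- The complex matrix of `T`. -/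
def complexMatrix (T : SpecialLinearGroup (Fin 3) ℤ) : Matrix (Fin 3) (Fin 3) ℂ :=
  T.1.map (Int.cast : ℤ → ℂ)

lemma isUnit_det_complexMatrix (T : SpecialLinearGroup (Fin 3) ℤ) :
    IsUnit (complexMatrix T).det := by
  have h : (complexMatrix T).det = ((T.1.det : ℤ) : ℂ) :=
    (RingHom.map_det (Int.castRingHom ℂ) T.1).symm
  rw [h, T.2]
  simp

lemma lin_iterate_mk (T : SpecialLinearGroup (Fin 3) ℤ) (k : ℕ) (v : V) :
    (lin T)^[k] (QuotientAddGroup.mk v) =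
      QuotientAddGroup.mk ((complexMatrix T ^ k *ᵥ v.1, v.2) : V) := by
  induction k with
  | zero => simp
  | succ k ih =>
    rw [Function.iterate_succ_apply', ih, lin, QuotientAddGroup.map_mk, pow_succ',
      ← Matrix.mulVec_mulVec]
    rfl

open Classical in
/-- Twice the sum of `log |l|` over the eigenvalues with `|l| > 1`. -/
def expansionRate (T : SpecialLinearGroup (Fin 3) ℤ) : ℝ :=
  2 * (((eigenvalues T).filter fun l => 1 < ‖l‖).map fun l => Real.log ‖l‖).sum

lemma expansionRate_eq {T : SpecialLinearGroup (Fin 3) ℤ} {l : Fin 3 → ℂ}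
    (hl : (complexMatrix T).charpoly.roots = Finset.univ.val.map l) :
    expansionRate T = 2 * ∑ i, Real.log (max 1 ‖l i‖) := by
  classical
  have h : eigenvalues T = Finset.univ.val.map l := hl
  rw [expansionRate, h, Multiset.filter_map, Multiset.map_map]
  congr 1
  change ∑ i ∈ Finset.univ.filter _, _ = _
  rw [Finset.sum_filter]
  refine Finset.sum_congr rfl fun i _ => ?_
  simp only [Function.comp_apply]
  split_ifs with h1
  · rw [max_eq_right h1.le]
  · rw [max_eq_left (not_lt.1 h1), Real.log_one]

/-- Each factor counts, up to constants, the square cells of side `max 1 |l| ^ (-n)` in a bounded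
region of one complex eigencoordinate; the square is the source of the `2` in the entropy. -/
lemma prod_max_pow {T : SpecialLinearGroup (Fin 3) ℤ} {l : Fin 3 → ℂ}
    (hl : (complexMatrix T).charpoly.roots = Finset.univ.val.map l) (n : ℕ) :
    ∏ i, (max 1 ‖l i‖ ^ n) ^ 2 = Real.exp (expansionRate T * n) := by
  rw [expansionRate_eq hl, mul_comm, ← mul_assoc, Finset.mul_sum, Real.exp_sum]
  refine Finset.prod_congr rfl fun i _ => ?_
  rw [← pow_mul, ← Real.exp_log (pow_pos (lt_max_of_lt_left one_pos : 0 < max 1 ‖l i‖) _),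
    Real.log_pow]
  push_cast
  rfl

/-! ### The entropy of the linear map of the torus: upper bound -/

/-- The uniformity of a compact group is translation invariant, so one `ε` measured in the universal
cover works at all points. -/
lemma exists_pos_of_mem_nhdsSet_diagonal {U : Set ((Torus7 × unitInterval) × (Torus7 × unitInterval))}
    (hU : U ∈ 𝓝ˢ (diagonal (Torus7 × unitInterval))) :
    ∃ ε > 0, ∀ (v v' : V) (r r' : unitInterval), ‖v - v'‖ < ε → |(r : ℝ) - r'| < ε →
      (((QuotientAddGroup.mk v : Torus7), r), ((QuotientAddGroup.mk v' : Torus7), r')) ∈ U := by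
  let _ : UniformSpace Torus7 := IsTopologicalAddGroup.rightUniformSpace Torus7
  rw [nhdsSet_diagonal_eq_uniformity, uniformity_prod, Filter.mem_inf_iff_superset] at hU
  obtain ⟨U₁, ⟨W₁, hW₁, h₁⟩, U₂, ⟨W₂, hW₂, h₂⟩, hU⟩ := hU
  obtain ⟨ε₂, hε₂, h₂'⟩ := Metric.mem_uniformity_dist.1 hW₂
  rw [uniformity_eq_comap_nhds_zero'] at hW₁
  obtain ⟨N, hN, hNW⟩ := hW₁
  have hN' : (QuotientAddGroup.mk : V → Torus7) ⁻¹' N ∈ 𝓝 (0 : V) :=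
    (continuous_quotient_mk' : Continuous (QuotientAddGroup.mk : V → Torus7)).continuousAt hN
  obtain ⟨ε₁, hε₁, h₁'⟩ := Metric.mem_nhds_iff.1 hN'
  refine ⟨min ε₁ ε₂, lt_min hε₁ hε₂, fun v v' r r' hv hr => hU ⟨h₁ (hNW ?_), h₂ (h₂' ?_)⟩⟩
  · have : v' - v ∈ Metric.ball (0 : V) ε₁ := by
      rw [mem_ball_zero_iff, norm_sub_rev]
      exact hv.trans_le (min_le_left _ _)
    exact h₁' this
  · exact hr.trans_le (min_le_right _ _)

/-- Choose bounded lifts and label their eigencoordinates finely enough to survive `n` steps; only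
expanding coordinates need exponentially many labels. The factor `[0, 1]`, on which the map is the
identity, adds only boundedly many labels; it is included because the base of the later fibration
carries the collar coordinate. -/
theorem topEntropyLE_lin (T : SpecialLinearGroup (Fin 3) ℤ) :
    TopEntropyLE (Prod.map (lin T) (id : unitInterval → unitInterval)) univ (expansionRate T) := by
  intro U hU H hH
  obtain ⟨ε, hε, hεU⟩ := exists_pos_of_mem_nhdsSet_diagonal hU
  obtain ⟨l, L, C, m, hC, hroots, hl, hAL⟩ :=
    exists_eigencoordinates (complexMatrix T) (isUnit_det_complexMatrix T)
  choose rep hrep hrep2 using exists_mk_eq_norm_le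
  set c : ℝ := 16 * C ^ 2 / ε + 3
  set c' : ℝ := (2 * (2 / (ε / 2)) + 3) * (2 * (1 / (ε / 2)) + 3)
  filter_upwards [eventually_polynomial_le_exp ((c ^ 2) ^ 3 * c') (m * 2 * 3) (sub_pos.2 hH)]
    with n hn
  have hn1 : (1 : ℝ) ≤ 1 + n := by linarith [(Nat.cast_nonneg n : (0 : ℝ) ≤ n)]
  set q : ℝ := C * (1 + n) ^ m with hq
  have hq0 : 0 < q := by positivity
  -- Real and imaginary parts together give an error `2 θ i`, which expansion and the polynomial
  -- factor `q` raise to `ε / 2`. The maximum with `1` keeps contracting coordinates accurate at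
  -- time zero.
  set θ : Fin 3 → ℝ := fun i => ε / (4 * q * max 1 ‖l i‖ ^ n) with hθ_def
  have hM : ∀ i, 1 ≤ max 1 ‖l i‖ := fun i => le_max_left _ _
  have hMn : ∀ i, 1 ≤ max 1 ‖l i‖ ^ n := fun i => one_le_pow₀ (hM i)
  have hM0 : ∀ i, 0 < max 1 ‖l i‖ ^ n := fun i => one_pos.trans_le (hMn i)
  have hθ : ∀ i, 0 < θ i := fun i => by
    have := hM0 i
    simp only [hθ_def]; positivity
  have hbound : ∀ (a : Torus7 × unitInterval) i, ‖L (rep a.1).1 i‖ ≤ 2 * C := by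
    intro a i
    have := (hAL 0 (rep a.1).1).2
    simp only [pow_zero, Matrix.one_mulVec, one_mul, Nat.cast_zero, add_zero, one_pow,
      mul_one] at this
    calc ‖L (rep a.1).1 i‖ ≤ ‖L (rep a.1).1‖ := norm_le_pi_norm _ i
      _ ≤ C * ‖(rep a.1).1‖ := this
      _ ≤ C * 2 := by gcongr; exact (norm_fst_le _).trans (hrep2 _)
      _ = 2 * C := mul_comm _ _
  have hcode := (Coded.pi (F := (univ : Set (Torus7 × unitInterval))) fun i =>
    (Coded.floor (f := fun a => (L (rep a.1).1 i).re) (hθ i)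
      (fun a _ => (Complex.abs_re_le_norm _).trans (hbound a i)) (by positivity)).and
    (Coded.floor (f := fun a => (L (rep a.1).1 i).im) (hθ i)
      (fun a _ => (Complex.abs_im_le_norm _).trans (hbound a i)) (by positivity))).and
    ((Coded.floor (F := (univ : Set (Torus7 × unitInterval))) (f := fun a => (rep a.1).2)
      (half_pos hε) (fun a _ => (norm_snd_le _).trans (hrep2 _)) (by norm_num)).and
    (Coded.floor (f := fun a => (a.2 : ℝ)) (half_pos hε)
      (fun a _ => abs_le.2 ⟨by linarith [a.2.2.1], a.2.2.2⟩) (by norm_num)))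
  refine hcode.mono subset_rfl ?_ ?_
  · have hcount : ∀ i, 2 * (2 * C / θ i) + 3 ≤ c * (1 + n) ^ m * max 1 ‖l i‖ ^ n := by
      intro i
      have h1 : (1 : ℝ) ≤ (1 + n) ^ m * max 1 ‖l i‖ ^ n :=
        one_le_mul_of_one_le_of_one_le (one_le_pow₀ hn1) (hMn i)
      have h2 : 2 * (2 * C / θ i) = 16 * C ^ 2 / ε * ((1 + n) ^ m * max 1 ‖l i‖ ^ n) := by
        have := (hM0 i).ne'
        simp only [hθ_def, hq]
        field_simp
        norm_num
      rw [h2, mul_assoc]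
      simp only [c]
      rw [add_mul]
      linarith
    calc _ ≤ (∏ i, (c * (1 + n) ^ m * max 1 ‖l i‖ ^ n) ^ 2) * c' := by
          gcongr with i _
          rw [← sq]
          have := hθ i
          exact pow_le_pow_left₀ (by positivity) (hcount i) 2
      _ = (c ^ 2) ^ 3 * c' * (1 + n) ^ (m * 2 * 3) * ∏ i, (max 1 ‖l i‖ ^ n) ^ 2 := by
          simp only [mul_pow, Finset.prod_mul_distrib, Finset.prod_const, Finset.card_univ,
            Fintype.card_fin, ← pow_mul]
          ring
      _ ≤ Real.exp ((H - expansionRate T) * n) * Real.exp (expansionRate T * n) := by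
          rw [prod_max_pow hroots]
          gcongr
      _ = Real.exp (H * n) := by
          rw [← Real.exp_add]; ring_nf
  · rintro ⟨a, r⟩ - ⟨a', r'⟩ - ⟨hz, hx, hr⟩ k hk
    simp only at hz hx hr
    rw [Prod.map_iterate, Function.iterate_id, Prod.map_apply, Prod.map_apply, ← hrep a, ← hrep a',
      lin_iterate_mk, lin_iterate_mk]
    refine hεU _ _ _ _ ?_ (hr.trans_lt (half_lt_self hε))
    rw [Prod.mk_sub_mk, ← Matrix.mulVec_sub]
    refine max_lt ?_ (hx.trans_lt (half_lt_self hε))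
    refine lt_of_le_of_lt ?_ (half_lt_self hε)
    have hqk : C * (1 + k) ^ m ≤ q := by
      rw [hq]
      have : (k : ℝ) ≤ n := by exact_mod_cast hk.le
      gcongr
    calc _ ≤ C * (1 + k) ^ m * ‖fun i => l i ^ k * L ((rep a).1 - (rep a').1) i‖ := (hAL k _).1
      _ ≤ q * (ε / 2 / q) := by
        gcongr
        refine (pi_norm_le_iff_of_nonneg (by positivity)).2 fun i => ?_
        rw [norm_mul, norm_pow, map_sub, Pi.sub_apply]
        have h1 : ‖l i‖ ^ k ≤ max 1 ‖l i‖ ^ n :=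
          (pow_le_pow_left₀ (norm_nonneg _) (le_max_right _ _) k).trans
            (pow_le_pow_right₀ (hM i) hk.le)
        have h2 : ‖L (rep a).1 i - L (rep a').1 i‖ ≤ 2 * θ i := by
          refine (Complex.norm_le_abs_re_add_abs_im _).trans ?_
          rw [Complex.sub_re, Complex.sub_im]
          linarith [(hz i).1, (hz i).2]
        calc _ ≤ max 1 ‖l i‖ ^ n * (2 * θ i) := by gcongr
          _ = ε / 2 / q := by
            have := (hM0 i).ne'
            simp only [hθ_def]
            field_simp
            norm_num
      _ = ε / 2 := by field_simp

/-! ### The entropy of the linear map of the torus: lower bound -/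

lemma mem_nhdsSet_diagonal_of_pos {ε : ℝ} (hε : 0 < ε) :
    {x : Torus7 × Torus7 | ∃ v : V, ‖v‖ < ε ∧ x.1 - x.2 = QuotientAddGroup.mk v} ∈
      𝓝ˢ (diagonal Torus7) := by
  have ho : IsOpen ((QuotientAddGroup.mk : V → Torus7) '' Metric.ball 0 ε) :=
    QuotientAddGroup.isOpenMap_coe _ Metric.isOpen_ball
  have : {x : Torus7 × Torus7 | ∃ v : V, ‖v‖ < ε ∧ x.1 - x.2 = QuotientAddGroup.mk v} =
      (fun x => x.1 - x.2) ⁻¹' ((QuotientAddGroup.mk : V → Torus7) '' Metric.ball 0 ε) := by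
    ext x
    simp [eq_comm]
  rw [this]
  refine (ho.preimage (by fun_prop)).mem_nhdsSet.2 ?_
  rintro ⟨x, y⟩ (rfl : x = y)
  exact ⟨0, by simpa using hε, by simp⟩

/-- Closeness on the torus lifts to closeness in `ℂ³`, one step at a time. If the lifts are
`ε`-close at time `k`, then at time `k + 1` they are `B ε`-close, and they are also `ε`-close up to
a lattice vector; that vector has norm below `1 / 2` and therefore vanishes. -/
lemma norm_pow_mulVec_lt_of_lin_iterate {T : SpecialLinearGroup (Fin 3) ℤ} {B ε : ℝ}
    (hB : ∀ z, ‖complexMatrix T *ᵥ z‖ ≤ B * ‖z‖) (hB0 : 0 ≤ B) (hε : (B + 1) * ε < 1 / 2)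
    {z z' : Fin 3 → ℂ} (hz : ‖z - z'‖ < ε) {n : ℕ}
    (h : ∀ k < n, ∃ v : V, ‖v‖ < ε ∧
      (lin T)^[k] (QuotientAddGroup.mk ((z, 0) : V)) -
        (lin T)^[k] (QuotientAddGroup.mk ((z', 0) : V)) = QuotientAddGroup.mk v) :
    ∀ k < n, ‖complexMatrix T ^ k *ᵥ (z - z')‖ < ε := by
  intro k
  induction k with
  | zero => simpa using fun _ => hz
  | succ k ih =>
    intro hk
    have h1 := ih (by omega)
    obtain ⟨v, hv, hvk⟩ := h (k + 1) hk
    rw [lin_iterate_mk, lin_iterate_mk, ← QuotientAddGroup.mk_sub, Prod.mk_sub_mk, sub_zero,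
      ← Matrix.mulVec_sub, QuotientAddGroup.eq] at hvk
    set w := complexMatrix T ^ (k + 1) *ᵥ (z - z') with hw
    have h2 : ‖w‖ ≤ B * ε := by
      rw [hw, pow_succ', ← Matrix.mulVec_mulVec]
      exact (hB _).trans (by gcongr)
    have h3 : ‖((w, 0) : V)‖ = ‖w‖ := by rw [Prod.norm_mk, norm_zero, max_eq_left (norm_nonneg _)]
    have h4 : ‖-((w, 0) : V) + v‖ < 1 / 2 := by
      refine (norm_add_le _ _).trans_lt ?_
      rw [norm_neg, h3]
      linarith
    have h5 := eq_zero_of_mem_lattice hvk h4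
    have h6 : v = (w, 0) := by
      rw [neg_add_eq_zero] at h5
      exact h5.symm
    rw [← h3, ← h6]
    exact hv

open MeasureTheory in
lemma volume_pi_closedBall (x : Fin 3 → ℂ) {r : Fin 3 → ℝ} (hr : ∀ i, 0 ≤ r i) :
    volume (Set.pi univ fun i => Metric.closedBall (x i) (r i)) =
      ENNReal.ofReal (Real.pi ^ 3 * ∏ i, r i ^ 2) := by
  rw [volume_pi_pi]
  simp only [Complex.volume_closedBall]
  have h : (NNReal.pi : ENNReal) = ENNReal.ofReal Real.pi := by
    rw [← NNReal.coe_real_pi, ENNReal.ofReal_coe_nnreal]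
  rw [h, Finset.prod_mul_distrib, Finset.prod_const, Finset.card_univ, Fintype.card_fin,
    mul_comm, ENNReal.ofReal_mul (by positivity), ENNReal.ofReal_pow Real.pi_pos.le,
    ENNReal.ofReal_prod_of_nonneg fun i _ => by positivity]
  congr 1
  exact Finset.prod_congr rfl fun i _ => (ENNReal.ofReal_pow (hr i) 2).symm

open MeasureTheory in
-- Points of a small ball with equal labels remain close in the cover for `n` steps, so their
-- eigencoordinates lie in a polydisc of volume about `exp (-expansionRate T · n)`. These pieces
-- must cover a set of fixed positive volume, so there are exponentially many of them.
theorem expansionRate_le {T : SpecialLinearGroup (Fin 3) ℤ} {H₀ : ℝ}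
    (h : TopEntropyLE (lin T) univ H₀) : expansionRate T ≤ H₀ := by
  by_contra! hlt
  set δ : ℝ := (expansionRate T - H₀) / 2 with hδ
  have hδ0 : 0 < δ := by have := sub_pos.2 hlt; positivity
  obtain ⟨l, L, C, m, hC, hroots, hl, hAL⟩ :=
    exists_eigencoordinates (complexMatrix T) (isUnit_det_complexMatrix T)
  set A := complexMatrix T
  obtain ⟨B, hB0, hB⟩ : ∃ B : ℝ, 0 ≤ B ∧ ∀ z, ‖A *ᵥ z‖ ≤ B * ‖z‖ :=
    ⟨_, norm_nonneg _, (LinearMap.toContinuousLinearMap A.mulVecLin).le_opNorm⟩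
  set ε : ℝ := 1 / (4 * (B + 1)) with hε_def
  have hε : 0 < ε := by positivity
  have hBε : (B + 1) * ε < 1 / 2 := by
    rw [hε_def]; field_simp; norm_num
  -- Volumes are measured in eigencoordinates, where the pieces are contained in polydiscs.
  set S : Set (Fin 3 → ℂ) := L '' Metric.ball 0 (ε / 2)
  have hS : 0 < volume S :=
    (L.toHomeomorph.isOpenMap _ Metric.isOpen_ball).measure_pos volume
      ((Metric.nonempty_ball.2 (by positivity)).image _)
  obtain ⟨v₀, hv₀, hv₀S⟩ := ENNReal.lt_iff_exists_nnreal_btwn.1 hS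
  have hv₀' : 0 < (v₀ : ℝ) := by exact_mod_cast hv₀
  set K : ℝ := Real.pi ^ 3 * (C * ε) ^ 6 * Real.exp (expansionRate T) with hK
  obtain ⟨n, hn1, hnK, N, c, hN, hc⟩ := ((eventually_ge_atTop 1).and
    ((eventually_polynomial_le_exp (K / v₀ + 1) (m * 6) hδ0).and
      (h _ (mem_nhdsSet_diagonal_of_pos hε) (H₀ + δ) (by linarith)))).exists
  set q : ℝ := C * (1 + n) ^ m with hq
  have hq0 : 0 < q := by positivity
  -- The exponent is `n - 1` because closeness is known only at times `k < n`: expanding coordinates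
  -- use the last time, the others time zero. The lost step reappears as the factor `exp
  -- (expansionRate T)` in `K`.
  set r : Fin 3 → ℝ := fun i => q * ε / max 1 ‖l i‖ ^ (n - 1) with hr_def
  have hM0 : ∀ i, 0 < max 1 ‖l i‖ ^ (n - 1) := fun i => pow_pos (lt_max_of_lt_left one_pos) _
  have hr : ∀ i, 0 ≤ r i := fun i => by have := hM0 i; simp only [hr_def]; positivity
  set P : Fin N → Set (Fin 3 → ℂ) := fun j =>
    {z | z ∈ Metric.ball 0 (ε / 2) ∧ c (QuotientAddGroup.mk ((z, 0) : V)) = j}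
  have hSP : S ⊆ ⋃ j, L '' P j := by
    rintro _ ⟨z, hz, rfl⟩
    exact mem_iUnion.2 ⟨_, z, ⟨hz, rfl⟩, rfl⟩
  have hP : ∀ j, volume (L '' P j) ≤ ENNReal.ofReal (Real.pi ^ 3 * ∏ i, r i ^ 2) := by
    intro j
    rcases (P j).eq_empty_or_nonempty with hj | ⟨z', hz', hzj'⟩
    · simp [hj]
    rw [← volume_pi_closedBall (L z') hr]
    refine measure_mono ?_
    rintro _ ⟨z, ⟨hz, hzj⟩, rfl⟩ i -
    rw [mem_ball_zero_iff] at hz hz'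
    have hzz : ‖z - z'‖ < ε := (norm_sub_le _ _).trans_lt (by linarith)
    have h1 := norm_pow_mulVec_lt_of_lin_iterate hB hB0 hBε hzz
      (hc _ (mem_univ _) _ (mem_univ _) (hzj.trans hzj'.symm))
    have h2 : ∀ k < n, ‖l i‖ ^ k * ‖L (z - z') i‖ ≤ q * ε := by
      intro k hk
      have h3 := norm_le_pi_norm (fun i => l i ^ k * L (z - z') i) i
      simp only [norm_mul, norm_pow] at h3
      refine h3.trans ((hAL k (z - z')).2.trans ?_)
      have : (k : ℝ) ≤ n := by exact_mod_cast hk.le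
      rw [hq]
      gcongr
      exact (h1 k hk).le
    rw [mem_closedBall_iff_norm, ← Pi.sub_apply, ← map_sub, hr_def, le_div_iff₀ (hM0 i), mul_comm]
    rcases le_total 1 ‖l i‖ with h4 | h4
    · rw [max_eq_right h4]
      exact h2 _ (by omega)
    · rw [max_eq_left h4, one_pow]
      simpa using h2 0 (by omega)
  have hvol : volume S ≤ ENNReal.ofReal (N * (Real.pi ^ 3 * ∏ i, r i ^ 2)) := by
    calc volume S ≤ ∑ j, volume (L '' P j) :=
          (measure_mono hSP).trans (measure_iUnion_fintype_le _ _)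
      _ ≤ ∑ _j : Fin N, ENNReal.ofReal (Real.pi ^ 3 * ∏ i, r i ^ 2) :=
          Finset.sum_le_sum fun j _ => hP j
      _ = _ := by
        rw [Finset.sum_const, Finset.card_univ, Fintype.card_fin, nsmul_eq_mul,
          ENNReal.ofReal_mul (Nat.cast_nonneg N), ENNReal.ofReal_natCast]
  have hreal : (v₀ : ℝ) ≤ N * (Real.pi ^ 3 * ∏ i, r i ^ 2) := by
    have h1 := hv₀S.le.trans hvol
    rw [← ENNReal.ofReal_coe_nnreal] at h1
    refine (ENNReal.ofReal_le_ofReal_iff ?_).1 h1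
    positivity
  have hprod : ∏ i, r i ^ 2 = (q * ε) ^ 6 / Real.exp (expansionRate T * (n - 1 : ℕ)) := by
    rw [← prod_max_pow hroots]
    simp only [hr_def, div_pow, Finset.prod_div_distrib, Finset.prod_const, Finset.card_univ,
      Fintype.card_fin, ← pow_mul]
  have hfin : (v₀ : ℝ) * Real.exp (δ * n) ≤ K * (1 + n) ^ (m * 6) := by
    calc (v₀ : ℝ) * Real.exp (δ * n)
        ≤ N * (Real.pi ^ 3 * ∏ i, r i ^ 2) * Real.exp (δ * n) := by gcongr
      _ ≤ Real.exp ((H₀ + δ) * n) * (Real.pi ^ 3 * ∏ i, r i ^ 2) * Real.exp (δ * n) := by gcongr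
      _ = Real.pi ^ 3 * (q * ε) ^ 6 * (Real.exp ((H₀ + δ) * n) * Real.exp (δ * n) /
            Real.exp (expansionRate T * (n - 1 : ℕ))) := by rw [hprod]; ring
      _ = Real.pi ^ 3 * (q * ε) ^ 6 * Real.exp (expansionRate T) := by
          rw [← Real.exp_add, ← Real.exp_sub]
          congr 2
          rw [Nat.cast_sub hn1, hδ]
          push_cast
          ring
      _ = K * (1 + n) ^ (m * 6) := by rw [hK, hq]; ring
  -- The `+ 1` in the constant `K / v₀ + 1` makes the contradiction strict.
  have h1 : K * (1 + n) ^ (m * 6) < v₀ * ((K / v₀ + 1) * (1 + n) ^ (m * 6)) := by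
    have : (0 : ℝ) < (1 + n) ^ (m * 6) := by positivity
    have h2 : v₀ * ((K / v₀ + 1) * (1 + n) ^ (m * 6)) =
        K * (1 + n) ^ (m * 6) + v₀ * (1 + n) ^ (m * 6 : ℕ) := by field_simp
    rw [h2]
    have : (0 : ℝ) < v₀ * (1 + n) ^ (m * 6) := by positivity
    linarith
  have h3 : v₀ * ((K / v₀ + 1) * (1 + n) ^ (m * 6)) ≤ v₀ * Real.exp (δ * n) := by gcongr
  linarith

/-! ### Normal and tangential coordinates -/

lemma xi_ne_zero : xi ≠ 0 := by
  intro h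
  have := xi_pow_three
  simp [h] at this

/-- The `x`-coordinate of the `i`-th torus. -/
def center (i : Idx) : ℝ := (i.1.val : ℝ) / 3 + (i.2.val : ℝ) / 2

/-- The point of `ℂ²` with real coordinates `(s, x)`. -/
def ofCoords (s : Fin 3 → ℝ) (x : ℝ) : C2 :=
  !₂[(s 0 : ℂ) + (s 1 : ℂ) * Complex.I, (s 2 : ℂ) + (x : ℂ) * Complex.I]

lemma re3_ofCoords (s : Fin 3 → ℝ) (x : ℝ) : re3 (ofCoords s x) = s := by
  funext j; fin_cases j <;> simp [re3, ofCoords]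

lemma im_ofCoords (s : Fin 3 → ℝ) (x : ℝ) : (ofCoords s x 1).im = x := by
  simp [ofCoords]

lemma continuous_ofCoords : Continuous fun q : (Fin 3 → ℝ) × ℝ => ofCoords q.1 q.2 := by
  refine (PiLp.continuous_toLp 2 _).comp (continuous_pi fun j => ?_)
  fin_cases j <;> simp <;> fun_prop

/-- The coordinates normal to the `i`-th torus, on the universal cover. -/
def normalCoord (i : Idx) (v : V) : C2 :=
  ofCoords (fun j => ((xi ^ i.1.val)⁻¹ * v.1 j).re) (v.2 - center i)

/-- The coordinates along the `i`-th torus, on the universal cover. -/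
def tangentCoord (i : Idx) (v : V) : Fin 3 → ℝ := fun j => ((xi ^ i.1.val)⁻¹ * v.1 j).im / √3

lemma re3_normalCoord (i : Idx) (v : V) (j : Fin 3) :
    re3 (normalCoord i v) j = ((xi ^ i.1.val)⁻¹ * v.1 j).re := by
  rw [normalCoord, re3_ofCoords]

lemma im_normalCoord (i : Idx) (v : V) : (normalCoord i v 1).im = v.2 - center i :=
  im_ofCoords _ _

lemma mk_eq_tau (i : Idx) (v : V) :
    (QuotientAddGroup.mk v : Torus7) =
      tau i (normalCoord i v) (QuotientAddGroup.mk (tangentCoord i v)) := by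
  rw [tau_mk]
  congr 1
  apply Prod.ext
  · funext j
    have h3 : (√3 : ℂ) ≠ 0 := by
      rw [Ne, Complex.ofReal_eq_zero]; positivity
    have hx : xi ^ i.1.val ≠ 0 := pow_ne_zero _ xi_ne_zero
    simp only [re3_normalCoord, tangentCoord]
    rw [Complex.ofReal_div, mul_div_cancel₀ _ h3, mul_comm Complex.I, Complex.re_add_im,
      mul_inv_cancel_left₀ hx]
  · simp only [im_normalCoord, center]
    ring

lemma abs_re3_le_norm (w : C2) (j : Fin 3) : |re3 w j| ≤ ‖w‖ := by
  have h := (norm_le_pi_norm (coords w) j.castSucc).trans (norm_coords_le w)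
  rwa [coords_castSucc, Complex.norm_real] at h

lemma abs_im_le_norm (w : C2) : |(w 1).im| ≤ ‖w‖ := by
  have h := (norm_le_pi_norm (coords w) (Fin.last 3)).trans (norm_coords_le w)
  rwa [coords_last, Complex.norm_real] at h

/-- The centres `k/3 + e/2` are distinct in `(1/6)ℤ / ℤ`, while each displacement is below `1/12`,
so the `x`-coordinate determines the index. After rotating by `ξ ^ (-k)`, the lattice difference has
real part below `1/6` in `½ℤ`, hence zero; such Eisenstein integers are the multiples of `i √3`,
which are exactly the periods of the tangential coordinate. -/
lemma tau_injective {i i' : Idx} {w w' : C2} {p p' : Torus3} (hw : ‖w‖ < 1 / 12)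
    (hw' : ‖w'‖ < 1 / 12) (h : tau i w p = tau i' w' p') : i = i' ∧ w = w' ∧ p = p' := by
  induction p using QuotientAddGroup.induction_on with
  | H y =>
  induction p' using QuotientAddGroup.induction_on with
  | H y' =>
  rw [tau_mk, tau_mk, QuotientAddGroup.eq] at h
  obtain ⟨hz, n, hn⟩ := h
  simp only [Prod.snd_add, Prod.snd_neg] at hn
  have h1 := abs_lt.1 ((abs_im_le_norm w).trans_lt hw)
  have h1' := abs_lt.1 ((abs_im_le_norm w').trans_lt hw')
  obtain ⟨k, e⟩ := i
  obtain ⟨k', e'⟩ := i'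
  have hi : (k, e) = (k', e') := by
    have h2 : ((2 * (k'.val : ℤ) - 2 * k.val + 3 * e'.val - 3 * e.val - 6 * n : ℤ) : ℝ) =
        6 * ((w 1).im - (w' 1).im) := by
      have : (n : ℝ) = -((w 1).im + (k.val / 3 + e.val / 2)) +
          ((w' 1).im + (k'.val / 3 + e'.val / 2)) := by simpa using hn
      push_cast
      linarith
    have h3 : |((2 * (k'.val : ℤ) - 2 * k.val + 3 * e'.val - 3 * e.val - 6 * n : ℤ) : ℝ)| < 1 := by
      rw [h2, abs_lt]
      constructor <;> linarith [h1.1, h1.2, h1'.1, h1'.2]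
    have h4 : |2 * (k'.val : ℤ) - 2 * k.val + 3 * e'.val - 3 * e.val - 6 * n| < 1 := by
      exact_mod_cast h3
    rw [Int.abs_lt_one_iff] at h4
    have h5 := ZMod.val_lt k
    have h6 := ZMod.val_lt k'
    have h7 := e.2
    have h8 := e'.2
    have h9 : k.val = k'.val := by omega
    have h10 : e.val = e'.val := by omega
    rw [ZMod.val_injective 3 h9, Fin.ext h10]
  rw [Prod.mk.injEq] at hi
  obtain ⟨rfl, rfl⟩ := hi
  obtain ⟨m, l, hz⟩ := hz
  -- Multiplication by `ξ ^ (2k) = ξ ^ (-k)` undoes the rotation inside the lattice.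
  obtain ⟨m', l', hz'⟩ := xi_pow_lattice (2 * k.val) m l
  have hx : xi ^ (2 * k.val) * xi ^ k.val = 1 := by
    rw [← pow_add, ← Nat.succ_mul, pow_mul, xi_pow_three, one_pow]
  have key : ∀ j, ((re3 w' j - re3 w j : ℝ) : ℂ) + ((√3 * (y' j - y j) : ℝ) : ℂ) * Complex.I =
      m' j + xi * l' j := by
    intro j
    have h2 := hz j
    simp only [Prod.fst_add, Prod.fst_neg, Pi.add_apply, Pi.neg_apply] at h2
    have h3 := hz' j
    simp only at h3
    rw [← h3, ← h2]
    push_cast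
    linear_combination -((re3 w' j : ℂ) - re3 w j + √3 * (y' j - y j) * Complex.I) * hx
  have hml : ∀ j, re3 w' j = re3 w j ∧ y' j - y j = m' j := by
    intro j
    have hre := congrArg Complex.re (key j)
    have him := congrArg Complex.im (key j)
    simp only [Complex.add_re, Complex.ofReal_re, Complex.mul_re, Complex.ofReal_im, Complex.I_re,
      Complex.I_im, Complex.intCast_re, Complex.intCast_im, xi_re, Complex.add_im,
      Complex.mul_im, xi_im] at hre him
    have h2 := abs_lt.1 ((abs_re3_le_norm w j).trans_lt hw)
    have h2' := abs_lt.1 ((abs_re3_le_norm w' j).trans_lt hw')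
    have h3 : |((2 * m' j - l' j : ℤ) : ℝ)| < 1 := by
      push_cast
      rw [abs_lt]
      constructor <;> linarith [h2.1, h2.2, h2'.1, h2'.2]
    have h4 : |2 * m' j - l' j| < 1 := by exact_mod_cast h3
    rw [Int.abs_lt_one_iff] at h4
    have h5 : (l' j : ℝ) = 2 * m' j := by
      have : l' j = 2 * m' j := by omega
      rw [this]; push_cast; ring
    have h6 : √3 ≠ 0 := by positivity
    rw [h5] at hre him
    refine ⟨by linarith, mul_left_cancel₀ h6 (by linarith)⟩
  refine ⟨rfl, C2_ext (funext fun j => (hml j).1.symm) ?_, ?_⟩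
  · have h2 : (n : ℝ) = (w' 1).im - (w 1).im := by
      have : (n : ℝ) = -((w 1).im + (k.val / 3 + e.val / 2)) +
          ((w' 1).im + (k.val / 3 + e.val / 2)) := by simpa using hn
      linarith
    have h3 : |(n : ℝ)| < 1 := by
      rw [h2, abs_lt]
      constructor <;> linarith [h1.1, h1.2, h1'.1, h1'.2]
    have h4 : |n| < 1 := by exact_mod_cast h3
    rw [Int.abs_lt_one_iff.1 h4, Int.cast_zero] at h2
    linarith
  · rw [QuotientAddGroup.eq]
    refine ⟨m', fun j => ?_⟩
    rw [← (hml j).2, Pi.add_apply, Pi.neg_apply]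
    ring

lemma tau_mem_sing_iff {i : Idx} {w : C2} {p : Torus3} (hw : ‖w‖ < 1 / 12) :
    tau i w p ∈ sing ↔ w = 0 := by
  constructor
  · rintro ⟨i', p', h⟩
    exact (tau_injective hw (by norm_num) h).2.1
  · rintro rfl
    exact ⟨i, p, rfl⟩

lemma continuous_re3 : Continuous re3 := by
  refine continuous_pi fun j => ?_
  have h : ∀ w : C2, re3 w j = (coords w j.castSucc).re := fun w => by
    rw [coords_castSucc, Complex.ofReal_re]
  simp only [h]
  exact Complex.continuous_re.comp ((continuous_apply _).comp coords.continuous_of_finiteDimensional)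

lemma continuous_tau (i : Idx) : Continuous fun q : C2 × Torus3 => tau i q.1 q.2 := by
  have h3 := continuous_re3
  have h1 : Continuous fun q : C2 × (Fin 3 → ℝ) =>
      tau i q.1 (QuotientAddGroup.mk q.2) := by
    simp only [tau_mk]
    refine continuous_quotient_mk'.comp (Continuous.prodMk (continuous_pi fun j => ?_) ?_)
    · have : Continuous fun q : C2 × (Fin 3 → ℝ) => re3 q.1 j :=
        (continuous_apply j).comp (h3.comp continuous_fst)
      fun_prop
    · fun_prop
  have hq : IsOpenQuotientMap (Prod.map (id : C2 → C2)
      (QuotientAddGroup.mk : (Fin 3 → ℝ) → Torus3)) :=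
    IsOpenQuotientMap.id.prodMap QuotientAddGroup.isOpenQuotientMap_mk
  exact hq.isQuotientMap.continuous_iff.2 h1

lemma continuous_normalCoord (i : Idx) : Continuous (normalCoord i) :=
  continuous_ofCoords.comp (Continuous.prodMk (by fun_prop) (by fun_prop))

/-! ### Functions on the torus that vanish on one of the six tori -/

/-- The frequencies of the four periodic normal coordinates. -/
def freq : Fin 4 → ℂ := ![4 * Real.pi * Complex.I, 4 * Real.pi * Complex.I,
  4 * Real.pi * Complex.I, 2 * Real.pi * Complex.I]

lemma freq_castSucc (j : Fin 3) : freq j.castSucc = 4 * Real.pi * Complex.I := by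
  fin_cases j <;> rfl

lemma freq_last : freq (Fin.last 3) = 2 * Real.pi * Complex.I := rfl

lemma freq_ne_zero (i : Fin 4) : freq i ≠ 0 := by
  have h : (Real.pi : ℂ) ≠ 0 := by exact_mod_cast Real.pi_ne_zero
  refine Fin.lastCases ?_ (fun j => ?_) i
  · rw [freq_last]; simp [h]
  · rw [freq_castSucc]; simp [h]

/-- The periodic function `(exp (4πi a₁) - 1, …, exp (2πi b₂) - 1)` of the normal coordinates. -/
def expCoord (w : C2) : Fin 4 → ℂ := fun i => Complex.exp (freq i * coords w i) - 1

/-- Eisenstein integers have real part in `½ℤ`, which is why three of the frequencies are `4πi`; the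
`x`-coordinate has period `1` and frequency `2πi`. -/
lemma expCoord_normalCoord_add (i : Idx) (v : V) {l : V} (hl : l ∈ lattice) :
    expCoord (normalCoord i (v + l)) = expCoord (normalCoord i v) := by
  obtain ⟨⟨m, n, hz⟩, k, hk⟩ := hl
  funext s
  simp only [expCoord]
  congr 1
  refine Fin.lastCases ?_ (fun j => ?_) s
  · rw [coords_last, coords_last, im_normalCoord, im_normalCoord, freq_last,
      Complex.exp_eq_exp_iff_exists_int]
    refine ⟨k, ?_⟩
    have : l.2 = k := by simpa using hk.symm
    rw [Prod.snd_add, this]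
    push_cast
    ring
  · rw [coords_castSucc, coords_castSucc, re3_normalCoord, re3_normalCoord, freq_castSucc,
      Complex.exp_eq_exp_iff_exists_int]
    obtain ⟨m', n', hz'⟩ := xi_pow_lattice (2 * i.1.val) m n
    have hinv : (xi ^ i.1.val)⁻¹ = xi ^ (2 * i.1.val) := by
      refine inv_eq_of_mul_eq_one_right ?_
      rw [← pow_add, add_comm, ← Nat.succ_mul, pow_mul, xi_pow_three, one_pow]
    refine ⟨2 * m' j - n' j, ?_⟩
    have h1 := hz' j
    simp only at h1
    rw [Prod.fst_add, Pi.add_apply, mul_add, Complex.add_re, hz j, hinv, h1]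
    simp only [Complex.add_re, Complex.mul_re, Complex.intCast_re, Complex.intCast_im, xi_re]
    push_cast
    ring

/-- The function `expCoord` of the coordinates normal to the `i`-th torus. -/
def normalExp (i : Idx) : Torus7 → (Fin 4 → ℂ) :=
  Quotient.lift (fun v => expCoord (normalCoord i v)) (by
    intro v v' h
    have h' : -v + v' ∈ lattice := QuotientAddGroup.leftRel_apply.1 h
    simpa using (expCoord_normalCoord_add i v h').symm)

lemma normalExp_mk (i : Idx) (v : V) :
    normalExp i (QuotientAddGroup.mk v) = expCoord (normalCoord i v) := rfl

lemma continuous_coords : Continuous coords := coords.continuous_of_finiteDimensional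

lemma continuous_expCoord : Continuous expCoord := by
  refine continuous_pi fun s => ?_
  have := (continuous_apply s).comp continuous_coords
  simp only [Function.comp_def] at this
  unfold expCoord
  fun_prop

lemma continuous_normalExp (i : Idx) : Continuous (normalExp i) :=
  Continuous.quotient_lift (continuous_expCoord.comp (continuous_normalCoord i)) _

lemma normalExp_tau (i : Idx) (w : C2) (p : Torus3) : normalExp i (tau i w p) = expCoord w := by
  induction p using QuotientAddGroup.induction_on with
  | H y =>
    rw [tau_mk, normalExp_mk]
    congr 1
    refine C2_ext (funext fun j => ?_) ?_
    · rw [re3_normalCoord]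
      simp only
      rw [inv_mul_cancel_left₀ (pow_ne_zero _ xi_ne_zero)]
      simp
    · rw [im_normalCoord]
      simp [center]

/-- The common zero set is the single torus `T_i`: the first three normal coordinates lie in `½ℤ`
and the last in `ℤ`, and some lattice vector realises precisely this displacement. -/
lemma exists_eq_tau_zero_of_normalExp_eq_zero {i : Idx} {a : Torus7} (h : normalExp i a = 0) :
    ∃ p, a = tau i 0 p := by
  induction a using QuotientAddGroup.induction_on with
  | H v =>
    rw [normalExp_mk] at h
    have h1 : ∀ s, ∃ n : ℤ, freq s * coords (normalCoord i v) s = n * (2 * Real.pi * Complex.I) :=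
      fun s => Complex.exp_eq_one_iff.1 (sub_eq_zero.1 (congrFun h s))
    choose n hn using h1
    have hpi : (2 * Real.pi * Complex.I : ℂ) ≠ 0 := Complex.two_pi_I_ne_zero
    have hre : ∀ j : Fin 3, ((xi ^ i.1.val)⁻¹ * v.1 j).re = n j.castSucc / 2 := by
      intro j
      have h2 := hn j.castSucc
      rw [freq_castSucc, coords_castSucc, re3_normalCoord] at h2
      have h3 : (((xi ^ i.1.val)⁻¹ * v.1 j).re : ℂ) = n j.castSucc / 2 := by
        apply mul_left_cancel₀ hpi
        linear_combination h2 / 2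
      exact_mod_cast h3
    have him : v.2 - center i = n (Fin.last 3) := by
      have h2 := hn (Fin.last 3)
      rw [freq_last, coords_last, im_normalCoord, mul_comm] at h2
      exact_mod_cast mul_right_cancel₀ hpi h2
    -- Since `Re ξ = -1/2`, the vector `ξ n_j` cancels a real part `n_j / 2`.
    set l : V := (fun j => xi ^ i.1.val * ((0 : Fin 3 → ℤ) j + xi * (n j.castSucc : ℤ)),
      -(n (Fin.last 3) : ℝ))
    have hl : l ∈ lattice :=
      ⟨xi_pow_lattice i.1.val 0 fun j => n j.castSucc, -n (Fin.last 3), by simp [l]⟩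
    have hmk : (QuotientAddGroup.mk v : Torus7) = QuotientAddGroup.mk (v + l) := by
      rw [QuotientAddGroup.eq]
      simpa using hl
    refine ⟨QuotientAddGroup.mk (tangentCoord i (v + l)),
      (hmk.trans (mk_eq_tau i (v + l))).trans (congrArg (tau i · _) ?_)⟩
    refine C2_ext (funext fun j => ?_) ?_
    · rw [re3_normalCoord, Prod.fst_add, Pi.add_apply, mul_add, Complex.add_re, hre j]
      simp only [l]
      rw [inv_mul_cancel_left₀ (pow_ne_zero _ xi_ne_zero)]
      have h0 : re3 0 j = 0 := by fin_cases j <;> simp [re3]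
      rw [h0]
      simp [xi_re]
      ring
    · rw [im_normalCoord]
      have h0 : ((0 : C2) 1).im = 0 := by simp
      rw [h0]
      simp only [l, Prod.snd_add]
      linarith

/-! ### The topology of the blow-up -/

lemma norm_smul_sphere {ρ : ℝ} (hρ : 0 ≤ ρ) (σ : S3) : ‖ρ • (σ : C2)‖ = ρ := by
  rw [norm_smul, mem_sphere_zero_iff_norm.mp σ.2, mul_one, Real.norm_of_nonneg hρ]

namespace BlowUp

/-- The domain of the polar chart. -/
abbrev PolarDomain : Type := Idx × Set.Ico (0 : ℝ) (1 / 12) × S3 × Torus3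

lemma continuous_off : Continuous off :=
  continuous_iff_coinduced_le.2 le_sup_left

lemma continuous_polar : Continuous polar :=
  continuous_iff_coinduced_le.2 le_sup_right

lemma continuous_iff {Z : Type*} [TopologicalSpace Z] {f : BlowUp → Z} :
    Continuous f ↔ Continuous (f ∘ off) ∧ Continuous (f ∘ polar) := by
  exact continuous_sup_dom.trans (and_congr continuous_coinduced_dom continuous_coinduced_dom)

lemma tau_polar_mem_sing_iff (q : PolarDomain) :
    tau q.1 ((q.2.1 : ℝ) • (q.2.2.1 : C2)) q.2.2.2 ∈ sing ↔ (q.2.1 : ℝ) = 0 := by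
  rw [tau_mem_sing_iff]
  · rw [smul_eq_zero, or_iff_left (ne_zero_of_mem_unit_sphere _)]
  · rw [norm_smul_sphere q.2.1.2.1]
    exact q.2.1.2.2

lemma polar_of_eq_zero {q : PolarDomain} (h : (q.2.1 : ℝ) = 0) :
    polar q = bdry q.1 q.2.2.1 q.2.2.2 :=
  dif_pos ((tau_polar_mem_sing_iff q).2 h)

lemma polar_of_ne_zero {q : PolarDomain} (h : (q.2.1 : ℝ) ≠ 0) :
    polar q = off ⟨tau q.1 ((q.2.1 : ℝ) • (q.2.2.1 : C2)) q.2.2.2,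
      fun hs => h ((tau_polar_mem_sing_iff q).1 hs)⟩ :=
  dif_neg fun hs => h ((tau_polar_mem_sing_iff q).1 hs)

lemma bdry_eq_polar (i : Idx) (σ : S3) (p : Torus3) :
    bdry i σ p = polar (i, ⟨0, by norm_num⟩, σ, p) :=
  (polar_of_eq_zero (q := (i, ⟨0, by norm_num⟩, σ, p)) rfl).symm

/-- The index set is discrete, so the index is locally constant. -/
lemma continuous_tau_comp {Z : Type*} [TopologicalSpace Z] {i : Z → Idx} {w : Z → C2}
    {p : Z → Torus3} (hi : Continuous i) (hw : Continuous w) (hp : Continuous p) :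
    Continuous fun z => tau (i z) (w z) (p z) := by
  refine continuous_iff_continuousAt.2 fun z₀ => ?_
  have h1 : Continuous fun z => tau (i z₀) (w z) (p z) := by
    have h0 := continuous_tau (i z₀)
    generalize tau (i z₀) = t at h0 ⊢
    exact h0.comp (f := fun z => (w z, p z)) (hw.prodMk hp)
  refine h1.continuousAt.congr ?_
  have h2 : {i z₀} ∈ 𝓝 (i z₀) := (isOpen_discrete _).mem_nhds rfl
  refine (hi.continuousAt.eventually h2).mono fun z hz => ?_
  have hz' : i z = i z₀ := hz
  exact congrArg (fun j => tau j (w z) (p z)) hz'.symm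

lemma continuous_tau_polar :
    Continuous fun q : PolarDomain => tau q.1 ((q.2.1 : ℝ) • (q.2.2.1 : C2)) q.2.2.2 :=
  continuous_tau_comp (by fun_prop) (by fun_prop) (by fun_prop)

/-- The blow-down map. -/
def blowDown : BlowUp → Torus7
  | Sum.inl a => a.1
  | Sum.inr (i, _, p) => tau i 0 p

lemma continuous_blowDown : Continuous blowDown := by
  refine continuous_iff.2 ⟨continuous_subtype_val, ?_⟩
  convert continuous_tau_polar using 1
  funext q
  by_cases h : (q.2.1 : ℝ) = 0
  · rw [Function.comp_apply, polar_of_eq_zero h, h, zero_smul]; rfl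
  · rw [Function.comp_apply, polar_of_ne_zero h]; rfl

/-- `(exp z - 1) / z`. -/
def expSlope : ℂ → ℂ := dslope Complex.exp 0

lemma continuous_expSlope : Continuous expSlope := by
  rw [← continuousOn_univ, expSlope, continuousOn_dslope univ_mem]
  exact ⟨Complex.continuous_exp.continuousOn, Complex.differentiableAt_exp⟩

lemma expSlope_zero : expSlope 0 = 1 := by
  rw [expSlope, dslope_same, Complex.deriv_exp, Complex.exp_zero]

lemma mul_expSlope (z : ℂ) : z * expSlope z = Complex.exp z - 1 := by
  have := sub_smul_dslope Complex.exp 0 z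
  simpa [expSlope] using this

/-- `expCoord (ρ w) / ρ`, extended continuously to `ρ = 0`. -/
def expDir (ρ : ℝ) (w : C2) : Fin 4 → ℂ := fun s =>
  freq s * coords w s * expSlope (ρ * (freq s * coords w s))

lemma expCoord_smul (ρ : ℝ) (w : C2) : expCoord (ρ • w) = ρ • expDir ρ w := by
  funext s
  simp only [expCoord, expDir, map_smul, Pi.smul_apply, Complex.real_smul]
  rw [mul_left_comm, ← mul_expSlope]
  ring

lemma continuous_expDir : Continuous fun q : ℝ × C2 => expDir q.1 q.2 := by
  refine continuous_pi fun s => ?_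
  have h1 : Continuous fun q : ℝ × C2 => coords q.2 s :=
    ((continuous_apply s).comp continuous_coords).comp continuous_snd
  have := continuous_expSlope
  unfold expDir
  fun_prop

lemma expDir_zero (w : C2) (s : Fin 4) : expDir 0 w s = freq s * coords w s := by
  simp [expDir, expSlope_zero]

/-- At `ρ = 0` this is the injective linear map `freq · coords`. For `ρ > 0` a zero would put `τ(ρσ,
p)` on one of the six tori. -/
lemma expDir_ne_zero (q : PolarDomain) : expDir q.2.1 q.2.2.1 ≠ 0 := by
  by_cases h : (q.2.1 : ℝ) = 0
  · rw [h]
    intro h0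
    refine ne_zero_of_mem_unit_sphere q.2.2.1 (coords_injective (funext fun s => ?_))
    have := congrFun h0 s
    rw [expDir_zero, Pi.zero_apply, mul_eq_zero, or_iff_right (freq_ne_zero s)] at this
    simpa using this
  · intro h0
    have h1 : normalExp q.1 (tau q.1 ((q.2.1 : ℝ) • (q.2.2.1 : C2)) q.2.2.2) = 0 := by
      rw [normalExp_tau, expCoord_smul, h0, smul_zero]
    obtain ⟨p, hp⟩ := exists_eq_tau_zero_of_normalExp_eq_zero h1
    exact h ((tau_polar_mem_sing_iff q).1 ⟨_, p, hp⟩)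

/-- The rescaling of a vector to length one. -/
def unit {E : Type*} [NormedAddCommGroup E] [NormedSpace ℝ E] (v : E) : E := (‖v‖⁻¹ : ℝ) • v

lemma unit_smul {E : Type*} [NormedAddCommGroup E] [NormedSpace ℝ E] {c : ℝ} (hc : 0 < c) (v : E) :
    unit (c • v) = unit v := by
  rw [unit, unit, norm_smul, smul_smul, Real.norm_of_nonneg hc.le]
  congr 1
  field_simp

lemma continuous_unit {E Z : Type*} [NormedAddCommGroup E] [NormedSpace ℝ E] [TopologicalSpace Z]
    {f : Z → E} (hf : Continuous f) (h0 : ∀ z, f z ≠ 0) : Continuous fun z => unit (f z) :=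
  (hf.norm.inv₀ fun z => norm_ne_zero_iff.2 (h0 z)).smul hf

/-- A continuous function on the blow-up that separates the directions normal to the `i`-th
torus. -/
def direction (i : Idx) : BlowUp → (Fin 4 → ℂ)
  | Sum.inl a => unit (normalExp i a.1)
  | Sum.inr (j, σ, p) => if j = i then unit (expDir 0 σ) else unit (normalExp i (tau j 0 p))

lemma normalExp_ne_zero {i : Idx} {a : Torus7} (ha : ∀ p, a ≠ tau i 0 p) : normalExp i a ≠ 0 :=
  fun h => by
    obtain ⟨p, hp⟩ := exists_eq_tau_zero_of_normalExp_eq_zero h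
    exact ha p hp

/-- In the polar chart of the `i`-th torus, `normalExp` equals `ρ` times `expDir`; rescaling to
length one removes `ρ`, and the result extends to `ρ = 0`. In the other charts `normalExp i` has no
zeros. -/
lemma continuous_direction (i : Idx) : Continuous (direction i) := by
  refine continuous_iff.2 ⟨?_, continuous_prod_of_discrete_left.2 fun j => ?_⟩
  · exact continuous_unit ((continuous_normalExp i).comp continuous_subtype_val)
      fun a => normalExp_ne_zero fun p hp => a.2 ⟨i, p, hp⟩
  · by_cases hj : j = i
    · subst hj
      have h1 : Continuous fun q : Set.Ico (0 : ℝ) (1 / 12) × S3 × Torus3 =>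
          unit (expDir q.1 q.2.1) :=
        continuous_unit (continuous_expDir.comp (f := fun q : Set.Ico (0 : ℝ) (1 / 12) × S3 × Torus3
          => ((q.1 : ℝ), (q.2.1 : C2))) (by fun_prop)) fun q => expDir_ne_zero (j, q)
      convert h1 using 1
      funext q
      by_cases h : (q.1 : ℝ) = 0
      · rw [Function.comp_apply, polar_of_eq_zero h, h]
        exact if_pos rfl
      · rw [Function.comp_apply, polar_of_ne_zero h]
        change unit (normalExp j (tau j _ _)) = _
        rw [normalExp_tau, expCoord_smul, unit_smul (lt_of_le_of_ne q.1.2.1 (Ne.symm h))]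
    · have h1 : Continuous fun q : Set.Ico (0 : ℝ) (1 / 12) × S3 × Torus3 =>
          unit (normalExp i (tau j ((q.1 : ℝ) • (q.2.1 : C2)) q.2.2)) := by
        refine continuous_unit ((continuous_normalExp i).comp
          (continuous_tau_polar.comp (f := fun q => (j, q)) (by fun_prop))) fun q => ?_
        refine normalExp_ne_zero fun p hp => hj ?_
        refine (tau_injective ?_ (by norm_num) hp).1
        rw [norm_smul_sphere q.1.2.1]
        exact q.1.2.2
      convert h1 using 1
      funext q
      by_cases h : (q.1 : ℝ) = 0
      · rw [Function.comp_apply, polar_of_eq_zero h, h, zero_smul]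
        exact if_neg hj
      · rw [Function.comp_apply, polar_of_ne_zero h]
        rfl

lemma direction_bdry_self (i : Idx) (σ : S3) (p : Torus3) :
    direction i (bdry i σ p) = unit (expDir 0 σ) := if_pos rfl

/-- At `ρ = 0` the function is linear and injective up to positive scaling, and positive multiples
on the unit sphere are equal. -/
lemma unit_expDir_zero_injective {σ σ' : S3} (h : unit (expDir 0 σ) = unit (expDir 0 σ')) :
    σ = σ' := by
  have hne : ∀ σ : S3, expDir 0 σ ≠ 0 := fun σ =>
    expDir_ne_zero (0, ⟨0, by norm_num⟩, σ, 0)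
  set c : ℝ := ‖expDir 0 σ‖⁻¹
  set c' : ℝ := ‖expDir 0 σ'‖⁻¹
  have hc : 0 < c := inv_pos.2 (norm_pos_iff.2 (hne σ))
  have hc' : 0 < c' := inv_pos.2 (norm_pos_iff.2 (hne σ'))
  have h1 : c • (σ : C2) = c' • (σ' : C2) := by
    refine coords_injective (funext fun s => ?_)
    have h2 := congrFun h s
    change c • expDir 0 σ s = c' • expDir 0 σ' s at h2
    rw [expDir_zero, expDir_zero, ← mul_smul_comm, ← mul_smul_comm] at h2
    rw [map_smul, map_smul]
    exact mul_left_cancel₀ (freq_ne_zero s) h2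
  have h2 := congrArg norm h1
  rw [norm_smul_sphere hc.le, norm_smul_sphere hc'.le] at h2
  rw [← h2] at h1
  exact Subtype.ext (smul_right_injective C2 hc.ne' h1)

/-! ### Compactness -/

lemma exists_polar_eq_off {i : Idx} {w : C2} {p : Torus3} {ρ₀ : ℝ} (hw : ‖w‖ ≤ ρ₀)
    (hρ : ρ₀ < 1 / 12) (h : tau i w p ∉ sing) :
    ∃ q : PolarDomain, (q.2.1 : ℝ) ≤ ρ₀ ∧ polar q = off ⟨_, h⟩ := by
  have hw' : w ≠ 0 := by
    rintro rfl
    exact h ⟨i, p, rfl⟩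
  have hn : ‖w‖ ≠ 0 := norm_ne_zero_iff.2 hw'
  refine ⟨(i, ⟨‖w‖, norm_nonneg w, hw.trans_lt hρ⟩, ⟨(‖w‖⁻¹ : ℝ) • w, ?_⟩, p), hw, ?_⟩
  · rw [mem_sphere_zero_iff_norm, norm_smul, norm_inv, norm_norm, inv_mul_cancel₀ hn]
  · rw [polar_of_ne_zero hn]
    congr 1
    refine Subtype.ext ?_
    simp only [smul_smul, mul_inv_cancel₀ hn, one_smul]

/-- The polar charts are half open and not compact. Their closed parts of radius at most `1/24` are,
and the complement of the open tubes of that radius is a closed subset of the torus; the images of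
both cover `Y`. -/
instance : CompactSpace BlowUp := by
  set O : Set Torus7 := ⋃ i, QuotientAddGroup.mk '' {v : V | ‖normalCoord i v‖ < 1 / 24}
  have hO : IsOpen O := isOpen_iUnion fun i => QuotientAddGroup.isOpenMap_coe _
    (isOpen_lt (continuous_normalCoord i).norm continuous_const)
  have hsing : sing ⊆ O := by
    rintro _ ⟨i, p, rfl⟩
    induction p using QuotientAddGroup.induction_on with
    | H y =>
      refine mem_iUnion.2 ⟨i, _, ?_, (tau_mk i 0 y).symm⟩
      have : normalCoord i (fun j => xi ^ i.1.val * (re3 0 j + Complex.I * (√3 * y j)),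
          ((0 : C2) 1).im + ((i.1.val : ℝ) / 3 + (i.2.val : ℝ) / 2)) = 0 := by
        refine C2_ext (funext fun j => ?_) ?_
        · rw [re3_normalCoord]
          simp only
          rw [inv_mul_cancel_left₀ (pow_ne_zero _ xi_ne_zero)]
          simp
        · rw [im_normalCoord]
          simp [center]
      rw [mem_ofPred_eq, this, norm_zero]
      norm_num
  have hK₁ : IsCompact {q : PolarDomain | (q.2.1 : ℝ) ≤ 1 / 24} := by
    have : {q : PolarDomain | (q.2.1 : ℝ) ≤ 1 / 24} =
        (univ : Set Idx) ×ˢ {ρ : Set.Ico (0 : ℝ) (1 / 12) | (ρ : ℝ) ≤ 1 / 24} ×ˢ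
          (univ : Set (S3 × Torus3)) := by
      ext q; simp
    rw [this]
    refine isCompact_univ.prod (IsCompact.prod ?_ isCompact_univ)
    rw [Subtype.isCompact_iff]
    convert isCompact_Icc (a := (0 : ℝ)) (b := 1 / 24) using 1
    ext ρ
    simp only [mem_image, mem_ofPred_eq, Subtype.exists, mem_Ico, exists_and_left, exists_prop,
      exists_eq_right_right, mem_Icc]
    constructor
    · rintro ⟨h1, h2, h3⟩; exact ⟨h2, h1⟩
    · rintro ⟨h1, h2⟩; exact ⟨h2, h1, by linarith⟩
  have hK₂ : IsCompact {a : {a : Torus7 // a ∉ sing} | a.1 ∉ O} := by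
    rw [Subtype.isCompact_iff]
    convert hO.isClosed_compl.isCompact using 1
    ext a
    simp only [mem_image, mem_ofPred_eq, Subtype.exists, exists_and_left, exists_prop,
      exists_eq_right_right, mem_compl_iff]
    exact ⟨fun h => h.1, fun h => ⟨h, fun hs => h (hsing hs)⟩⟩
  refine ⟨?_⟩
  convert (hK₁.image continuous_polar).union (hK₂.image continuous_off) using 1
  refine (eq_univ_of_forall fun y => ?_).symm
  rcases y with a | ⟨i, σ, p⟩
  · by_cases ha : a.1 ∈ O
    · left
      obtain ⟨i, v, hv, hva⟩ := mem_iUnion.1 ha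
      rw [mk_eq_tau i] at hva
      obtain ⟨a, ha'⟩ := a
      subst hva
      exact exists_polar_eq_off (le_of_lt hv) (by norm_num) ha'
    · exact Or.inr ⟨a, ha, rfl⟩
  · left
    exact ⟨(i, ⟨0, by norm_num⟩, σ, p), by simp, (bdry_eq_polar i σ p).symm⟩

/-! ### Continuity of the three maps -/

/-- At the boundary, continuity comes from a lift to the polar charts; elsewhere it comes from the
torus. The lift is required only on a neighbourhood of `ρ = 0`, since a linear map may push a point
out of the tube. -/
lemma continuous_map_of_polar {f : BlowUp → BlowUp} {g : {a : Torus7 // a ∉ sing} → Torus7}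
    (hg : Continuous g) (hgs : ∀ a, g a ∉ sing) (hf : ∀ a, f (off a) = off ⟨g a, hgs a⟩)
    {W : Set PolarDomain} (hW : IsOpen W) (hW0 : ∀ q : PolarDomain, (q.2.1 : ℝ) = 0 → q ∈ W)
    {h : W → PolarDomain} (hh : Continuous h) (hfh : ∀ q : W, f (polar q) = polar (h q)) :
    Continuous f := by
  have hoff : Continuous (f ∘ off) := by
    have : f ∘ off = fun a => off ⟨g a, hgs a⟩ := funext hf
    rw [this]
    exact continuous_off.comp (hg.subtype_mk _)
  refine continuous_iff.2 ⟨hoff, continuous_iff_continuousAt.2 fun q => ?_⟩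
  by_cases hq : (q.2.1 : ℝ) = 0
  · have : ContinuousOn (f ∘ polar) W := by
      rw [continuousOn_iff_continuous_domRestrict]
      have : W.domRestrict (f ∘ polar) = fun q => polar (h q) := funext hfh
      rw [this]
      exact continuous_polar.comp hh
    exact this.continuousAt (hW.mem_nhds (hW0 q hq))
  · have hopen : IsOpen {q : PolarDomain | (q.2.1 : ℝ) ≠ 0} :=
      isOpen_ne_fun (by fun_prop) continuous_const
    have : ContinuousOn (f ∘ polar) {q : PolarDomain | (q.2.1 : ℝ) ≠ 0} := by
      rw [continuousOn_iff_continuous_domRestrict]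
      have : ({q : PolarDomain | (q.2.1 : ℝ) ≠ 0}).domRestrict (f ∘ polar) = fun q =>
          (f ∘ off) ⟨_, fun hs => q.2 ((tau_polar_mem_sing_iff q.1).1 hs)⟩ := by
        funext q
        change f (polar q.1) = _
        rw [polar_of_ne_zero q.2]
        rfl
      rw [this]
      exact hoff.comp ((continuous_tau_polar.comp continuous_subtype_val).subtype_mk _)
    exact this.continuousAt (hopen.mem_nhds hq)

end BlowUp

/-! ### Continuity of the maps of the tori, of the spheres and of the blow-up. -/

lemma continuous_quotient_map {G : Type*} [AddCommGroup G] [TopologicalSpace G]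
    {s : AddSubgroup G} {f : G →+ G} (hf : Continuous f) (h : s ≤ s.comap f) :
    Continuous (QuotientAddGroup.map s s f h) :=
  Continuous.quotient_lift (continuous_quotient_mk'.comp hf) _

lemma continuous_lin (T : SpecialLinearGroup (Fin 3) ℤ) : Continuous (lin T) := by
  refine continuous_quotient_map (f := linHom T) ?_ _
  change Continuous fun v : V => ((fun i => ∑ j, (T.1 i j : ℂ) * v.1 j : Fin 3 → ℂ), v.2)
  fun_prop

lemma continuous_lin3 (T : SpecialLinearGroup (Fin 3) ℤ) : Continuous (lin3 T) := by
  refine continuous_quotient_map (f := linHom3 T) ?_ _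
  change Continuous fun v : Fin 3 → ℝ => (fun i => ∑ j, (T.1 i j : ℝ) * v j : Fin 3 → ℝ)
  fun_prop

lemma continuous_alpha : Continuous alpha := by
  have h : Continuous xiHom := by
    change Continuous fun v : V => ((fun j => xi * v.1 j : Fin 3 → ℂ), v.2)
    fun_prop
  exact (continuous_quotient_map h xiHom_lattice).add continuous_const

lemma continuous_beta : Continuous beta := by
  have h : Continuous betaHom := by
    change Continuous fun v : V => ((fun j => -(starRingEnd ℂ) (v.1 j) : Fin 3 → ℂ), -v.2)
    fun_prop
  exact continuous_quotient_map h betaHom_lattice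

lemma extend_eq_ofCoords (G : SpecialLinearGroup (Fin 3) ℝ) (w : C2) :
    extend G w = ofCoords (G.1 *ᵥ re3 w) (w 1).im := rfl

lemma continuous_extend :
    Continuous fun q : SpecialLinearGroup (Fin 3) ℝ × C2 => extend q.1 q.2 := by
  simp only [extend_eq_ofCoords]
  have h1 : Continuous fun w : C2 => (w 1).im := by fun_prop
  have h2 : Continuous fun q : SpecialLinearGroup (Fin 3) ℝ × C2 => q.1.1 *ᵥ re3 q.2 :=
    (continuous_subtype_val.comp continuous_fst).matrix_mulVec
      (continuous_re3.comp continuous_snd)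
  exact continuous_ofCoords.comp
    (f := fun q : SpecialLinearGroup (Fin 3) ℝ × C2 => (q.1.1 *ᵥ re3 q.2, (q.2 1).im))
    (h2.prodMk (h1.comp continuous_snd))

lemma continuous_ray :
    Continuous fun q : SpecialLinearGroup (Fin 3) ℝ × S3 => ray q.1 q.2 := by
  have h : Continuous fun q : SpecialLinearGroup (Fin 3) ℝ × S3 => extend q.1 (q.2 : C2) :=
    continuous_extend.comp (f := fun q : SpecialLinearGroup (Fin 3) ℝ × S3 => (q.1, (q.2 : C2)))
      (by fun_prop)
  exact (BlowUp.continuous_unit h fun q =>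
    extend_ne_zero q.1 (ne_zero_of_mem_unit_sphere q.2)).subtype_mk _

namespace BlowUp

lemma continuous_map (T : SpecialLinearGroup (Fin 3) ℤ) : Continuous (map T) := by
  set G := toReal T
  have hext : Continuous fun q : PolarDomain => ‖extend G (q.2.2.1 : C2)‖ :=
    (continuous_extend.comp (f := fun q : PolarDomain => (G, (q.2.2.1 : C2))) (by fun_prop)).norm
  have hmul : Continuous fun q : PolarDomain => (q.2.1 : ℝ) * ‖extend G (q.2.2.1 : C2)‖ :=
    Continuous.mul (by fun_prop) hext
  refine continuous_map_of_polar (f := map T) (g := fun a => lin T a.1)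
    -- The points whose image radius `ρ ‖(T ⊕ id) σ‖` still lies in the range of the polar chart.
    (W := {q | (q.2.1 : ℝ) * ‖extend G (q.2.2.1 : C2)‖ < 1 / 12})
    (h := fun q => (q.1.1, ⟨(q.1.2.1 : ℝ) * ‖extend G (q.1.2.2.1 : C2)‖,
      mul_nonneg q.1.2.1.2.1 (norm_nonneg _), q.2⟩, ray G q.1.2.2.1, lin3 T q.1.2.2.2))
    ((continuous_lin T).comp continuous_subtype_val) (fun a => lin_notMem T a.2) (fun _ => rfl)
    (isOpen_lt hmul continuous_const) (fun q hq => ?_) ?_ ?_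
  · simp only [mem_ofPred_eq, hq, zero_mul]; norm_num
  · refine Continuous.prodMk (by fun_prop) (Continuous.prodMk
      ((hmul.comp continuous_subtype_val).subtype_mk _) (Continuous.prodMk ?_ ?_))
    · exact continuous_ray.comp (f := fun q : {q : PolarDomain | (q.2.1 : ℝ) *
        ‖extend G (q.2.2.1 : C2)‖ < 1 / 12} => (G, q.1.2.2.1)) (by fun_prop)
    · exact (continuous_lin3 T).comp (by fun_prop)
  · rintro ⟨q, hq⟩
    have hne : ‖extend G (q.2.2.1 : C2)‖ ≠ 0 :=
      norm_ne_zero_iff.2 (extend_ne_zero G (ne_zero_of_mem_unit_sphere _))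
    by_cases h : (q.2.1 : ℝ) = 0
    · rw [polar_of_eq_zero h, polar_of_eq_zero (by simp [h])]
      rfl
    · rw [polar_of_ne_zero h, polar_of_ne_zero (mul_ne_zero h hne)]
      refine congrArg off (Subtype.ext ?_)
      simp only
      rw [lin_tau, extend_smul]
      congr 1
      change _ = _ • (‖extend G (q.2.2.1 : C2)‖⁻¹ : ℝ) • extend G (q.2.2.1 : C2)
      rw [smul_smul, mul_assoc, mul_inv_cancel₀ hne, mul_one]

lemma continuous_alphaMap : Continuous alphaMap := by
  refine continuous_map_of_polar (f := alphaMap) (g := fun a => alpha a.1) (W := univ)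
    (h := fun q => ((q.1.1.1 + 1, q.1.1.2), q.1.2))
    (continuous_alpha.comp continuous_subtype_val) (fun a => alpha_notMem a.2) (fun _ => rfl)
    isOpen_univ (fun _ _ => mem_univ _) ?_ ?_
  · have : Continuous fun i : Idx => (i.1 + 1, i.2) := continuous_of_discreteTopology
    exact (this.comp (by fun_prop)).prodMk (by fun_prop)
  · rintro ⟨q, -⟩
    by_cases h : (q.2.1 : ℝ) = 0
    · rw [polar_of_eq_zero h]
      exact (polar_of_eq_zero (q := ((q.1.1 + 1, q.1.2), q.2)) h).symm
    · rw [polar_of_ne_zero h]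
      exact (congrArg off (Subtype.ext (alpha_tau _ _ _))).trans
        (polar_of_ne_zero (q := ((q.1.1 + 1, q.1.2), q.2)) h).symm

lemma continuous_betaMap : Continuous betaMap := by
  refine continuous_map_of_polar (f := betaMap) (g := fun a => beta a.1) (W := univ)
    (h := fun q => ((-q.1.1.1, q.1.1.2), q.1.2.1, -q.1.2.2.1, q.1.2.2.2))
    (continuous_beta.comp continuous_subtype_val) (fun a => beta_notMem a.2) (fun _ => rfl)
    isOpen_univ (fun _ _ => mem_univ _) ?_ ?_
  · have : Continuous fun i : Idx => (-i.1, i.2) := continuous_of_discreteTopology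
    exact (this.comp (by fun_prop)).prodMk (by fun_prop)
  · rintro ⟨q, -⟩
    by_cases h : (q.2.1 : ℝ) = 0
    · rw [polar_of_eq_zero h]
      exact (polar_of_eq_zero (q := ((-q.1.1, q.1.2), q.2.1, -q.2.2.1, q.2.2.2)) h).symm
    · rw [polar_of_ne_zero h]
      refine (congrArg off (Subtype.ext ((beta_tau _ _ _).trans ?_))).trans
        (polar_of_ne_zero (q := ((-q.1.1, q.1.2), q.2.1, -q.2.2.1, q.2.2.2)) h).symm
      simp

end BlowUp

/-! ### The collapsed space: compactness, continuous maps and separating functions. -/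

namespace Collapsed

/-- The projection of the disjoint union of `Y` and the collars. -/
def proj (s : BlowUp ⊕ Collars) : Collapsed := Quot.mk HopfRel (Quot.mk GlueRel s)

/-- A point of a collar. -/
def collar (i : Idx) (r : unitInterval) (σ : S3) (p : Torus3) : Collapsed :=
  proj (Sum.inr (i, r, σ, p))

/-- A point off the six 3-tori. -/
def off (a : {a : Torus7 // a ∉ sing}) : Collapsed := proj (Sum.inl (BlowUp.off a))

lemma isQuotientMap_proj : IsQuotientMap proj :=
  (isQuotientMap_quot_mk (r := HopfRel)).comp (isQuotientMap_quot_mk (r := GlueRel))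

/-- Boundary points of `Y` are also collar points at `r = 0`, so two kinds of points suffice in all
later case distinctions. -/
lemma exists_eq_off_or_collar (x : Collapsed) :
    (∃ a, x = off a) ∨ ∃ i r σ p, x = collar i r σ p := by
  obtain ⟨⟨(a | ⟨i, σ, p⟩) | ⟨i, r, σ, p⟩⟩⟩ := x
  · exact Or.inl ⟨a, rfl⟩
  · exact Or.inr ⟨i, 0, σ, p, congrArg (Quot.mk HopfRel) (Quot.sound (GlueRel.glue i σ p))⟩
  · exact Or.inr ⟨i, r, σ, p, rfl⟩

lemma continuous_collar :
    Continuous fun q : Idx × unitInterval × S3 × Torus3 => collar q.1 q.2.1 q.2.2.1 q.2.2.2 :=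
  isQuotientMap_proj.continuous.comp continuous_inr

instance : CompactSpace Collapsed :=
  isQuotientMap_proj.surjective.compactSpace isQuotientMap_proj.continuous

/-! ### Continuity of the three maps -/

lemma continuous_of_proj {f : Collapsed → Collapsed} {g : BlowUp → BlowUp} {h : Collars → Collars}
    (hg : Continuous g) (hh : Continuous h) (hf : ∀ s, f (proj s) = proj (Sum.map g h s)) :
    Continuous f := by
  rw [isQuotientMap_proj.continuous_iff, show f ∘ proj = proj ∘ Sum.map g h from funext hf]
  exact isQuotientMap_proj.continuous.comp (hg.sumMap hh)

lemma continuous_map (T : SpecialLinearGroup (Fin 3) ℤ)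
    (γ : Path (toReal T) (1 : SpecialLinearGroup (Fin 3) ℝ)) : Continuous (map T γ) := by
  refine continuous_of_proj (BlowUp.continuous_map T)
    (h := fun c => (c.1, c.2.1, ray (γ c.2.1) c.2.2.1, lin3 T c.2.2.2)) ?_ fun _ => rfl
  have h1 : Continuous fun c : Collars => ray (γ c.2.1) c.2.2.1 :=
    continuous_ray.comp (f := fun c : Collars => (γ c.2.1, c.2.2.1))
      ((γ.continuous.comp (by fun_prop)).prodMk (by fun_prop))
  have h2 : Continuous fun c : Collars => lin3 T c.2.2.2 :=
    (continuous_lin3 T).comp (by fun_prop)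
  exact Continuous.prodMk (by fun_prop) (Continuous.prodMk (by fun_prop) (h1.prodMk h2))

lemma continuous_alphaMap : Continuous alphaMap := by
  refine continuous_of_proj BlowUp.continuous_alphaMap
    (h := fun c => ((c.1.1 + 1, c.1.2), c.2.1, c.2.2.1, c.2.2.2)) ?_ fun _ => rfl
  have : Continuous fun i : Idx => (i.1 + 1, i.2) := continuous_of_discreteTopology
  exact (this.comp (by fun_prop)).prodMk (by fun_prop)

lemma continuous_betaMap : Continuous betaMap := by
  refine continuous_of_proj BlowUp.continuous_betaMap
    (h := fun c => ((-c.1.1, c.1.2), c.2.1, -c.2.2.1, c.2.2.2)) ?_ fun _ => rfl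
  have : Continuous fun i : Idx => (-i.1, i.2) := continuous_of_discreteTopology
  exact (this.comp (by fun_prop)).prodMk (by fun_prop)

/-! ### Functions that separate points -/

section lift

variable {Z : Type*} (f : BlowUp → Z) (g : Collars → Z)
  (h0 : ∀ i σ p, f (BlowUp.bdry i σ p) = g (i, 0, σ, p))
  (h1 : ∀ i (σ σ' : S3) p, (∃ c : ℂ, (σ' : C2) = c • (σ : C2)) → g (i, 1, σ, p) = g (i, 1, σ', p))

/-- The function given by functions on `Y` and on the collars. -/
def lift : Collapsed → Z :=
  Quot.lift (Quot.lift (Sum.elim f g) (by rintro _ _ ⟨i, σ, p⟩; exact h0 i σ p))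
    (by rintro _ _ ⟨i, σ, σ', p, h⟩; exact h1 i σ σ' p h)

variable {f g} in
lemma continuous_lift [TopologicalSpace Z] (hf : Continuous f) (hg : Continuous g) :
    Continuous (lift f g h0 h1) := by
  rw [isQuotientMap_proj.continuous_iff]
  exact hf.sumElim hg

end lift

/-- The projection to the 7-torus. -/
def blowDown : Collapsed → Torus7 :=
  lift BlowUp.blowDown (fun c => tau c.1 0 c.2.2.2) (fun _ _ _ => rfl) fun _ _ _ _ _ => rfl

lemma continuous_blowDown : Continuous blowDown :=
  continuous_lift _ _ BlowUp.continuous_blowDown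
    (BlowUp.continuous_tau_comp continuous_fst continuous_const (by fun_prop))

/-- The collar coordinate. -/
def radius : Collapsed → unitInterval :=
  lift (fun _ => 0) (fun c => c.2.1) (fun _ _ _ => rfl) fun _ _ _ _ _ => rfl

lemma continuous_radius : Continuous radius :=
  continuous_lift _ _ continuous_const (by fun_prop)

/-- The extension of `BlowUp.direction` that vanishes where the collars are collapsed. -/
def direction (i : Idx) : Collapsed → (Fin 4 → ℂ) :=
  lift (BlowUp.direction i)
    (fun c => (1 - (c.2.1 : ℝ)) • BlowUp.direction i (BlowUp.bdry c.1 c.2.2.1 c.2.2.2))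
    (fun _ _ _ => by simp) fun _ _ _ _ _ => by simp

lemma continuous_direction (i : Idx) : Continuous (direction i) := by
  refine continuous_lift _ _ (BlowUp.continuous_direction i) ?_
  have h : Continuous fun c : Collars => BlowUp.bdry c.1 c.2.2.1 c.2.2.2 := by
    simp only [BlowUp.bdry_eq_polar]
    exact BlowUp.continuous_polar.comp (by fun_prop)
  have h' : Continuous fun c : Collars => 1 - (c.2.1 : ℝ) := by fun_prop
  exact h'.smul ((BlowUp.continuous_direction i).comp h)

end Collapsed

/-! ### The Hopf map and the Hausdorff property of the collapsed space. -/

/-- The Hopf map `S³ → S² ⊂ ℂ × ℝ`. -/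
def hopfMap (σ : S3) : ℂ × ℝ :=
  ((starRingEnd ℂ) ((σ : C2) 0) * (σ : C2) 1, ‖(σ : C2) 0‖ ^ 2)

lemma continuous_hopfMap : Continuous hopfMap := by
  have h (j : Fin 2) : Continuous fun σ : S3 => (σ : C2) j := by fun_prop
  exact ((Complex.continuous_conj.comp (h 0)).mul (h 1)).prodMk ((h 0).norm.pow 2)

lemma norm_sq_add_norm_sq (σ : S3) : ‖(σ : C2) 0‖ ^ 2 + ‖(σ : C2) 1‖ ^ 2 = 1 := by
  have h := EuclideanSpace.norm_sq_eq (σ : C2)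
  rw [mem_sphere_zero_iff_norm.mp σ.2, Fin.sum_univ_two] at h
  linarith

/-- Conversely to the invariance under unit scalars, the scalar is recovered as the quotient of the
first coordinates, or of the second ones if the first vanish. -/
lemma hopfMap_eq_iff {σ σ' : S3} :
    hopfMap σ = hopfMap σ' ↔ ∃ c : ℂ, (σ' : C2) = c • (σ : C2) := by
  have key (z : ℂ) : (starRingEnd ℂ) z * z = ((‖z‖ ^ 2 : ℝ) : ℂ) := by
    rw [mul_comm, Complex.mul_conj, Complex.normSq_eq_norm_sq]
  constructor
  · intro h
    have h1 : (starRingEnd ℂ) ((σ : C2) 0) * (σ : C2) 1 =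
        (starRingEnd ℂ) ((σ' : C2) 0) * (σ' : C2) 1 := congrArg Prod.fst h
    have h2 : ‖(σ : C2) 0‖ ^ 2 = ‖(σ' : C2) 0‖ ^ 2 := congrArg Prod.snd h
    have h3 := norm_sq_add_norm_sq σ
    by_cases h0 : (σ : C2) 0 = 0
    · have h0' : (σ' : C2) 0 = 0 := by
        rw [h0, norm_zero] at h2
        simpa using h2.symm
      have hne : (σ : C2) 1 ≠ 0 := by
        intro h4
        rw [h0, h4] at h3
        simp at h3
      refine ⟨(σ' : C2) 1 / (σ : C2) 1, ?_⟩
      ext j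
      fin_cases j
      · simp [h0, h0']
      · simp [hne]
    · refine ⟨(σ' : C2) 0 / (σ : C2) 0, ?_⟩
      have hc : (starRingEnd ℂ) ((σ : C2) 0) ≠ 0 := by simpa using h0
      ext j
      fin_cases j
      · simp [h0]
      · simp only [Fin.mk_one, PiLp.smul_apply, smul_eq_mul]
        rw [div_mul_eq_mul_div, eq_div_iff h0]
        refine mul_left_cancel₀ hc ?_
        have h5 := key ((σ : C2) 0)
        rw [h2, ← key] at h5
        linear_combination (σ' : C2) 1 * h5 - (σ' : C2) 0 * h1
  · rintro ⟨c, hc⟩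
    have hn := congrArg norm hc
    rw [norm_smul, mem_sphere_zero_iff_norm.mp σ.2, mem_sphere_zero_iff_norm.mp σ'.2,
      mul_one] at hn
    have h1 := key c
    rw [← hn] at h1
    refine Prod.ext ?_ ?_
    · simp only [hopfMap, hc, PiLp.smul_apply, smul_eq_mul, map_mul]
      push_cast at h1
      linear_combination -((starRingEnd ℂ) ((σ : C2) 0) * (σ : C2) 1) * h1
    · simp [hopfMap, hc, ← hn]

namespace Collapsed

/-- The extension of the Hopf map on the collapsed ends of the collars that vanishes on `Y`. -/
def hopf : Collapsed → ℂ × ℝ :=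
  lift (fun _ => 0) (fun c => (c.2.1 : ℝ) • hopfMap c.2.2.1) (fun _ _ _ => by simp)
    fun _ _ _ _ h => by
      simp only
      rw [hopfMap_eq_iff.2 h]

lemma continuous_hopf : Continuous hopf := by
  refine continuous_lift _ _ continuous_const ?_
  have h : Continuous fun c : Collars => (c.2.1 : ℝ) := by fun_prop
  have h' : Continuous fun c : Collars => c.2.2.1 := by fun_prop
  exact h.smul (continuous_hopfMap.comp h')

lemma eq_of_blowDown_collar {i i' : Idx} {r r' : unitInterval} {σ σ' : S3} {p p' : Torus3}
    (h : blowDown (collar i r σ p) = blowDown (collar i' r' σ' p')) : i = i' ∧ p = p' := by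
  have := tau_injective (by norm_num) (by norm_num) h
  exact ⟨this.1, this.2.2⟩

lemma blowDown_collar_ne_off {i : Idx} {r : unitInterval} {σ : S3} {p : Torus3}
    {a : {a : Torus7 // a ∉ sing}} : blowDown (collar i r σ p) ≠ blowDown (off a) :=
  fun h => a.2 ⟨i, p, h.symm⟩

/-- The blow-down finds the torus point, hence the collar and its `T³`-coordinate, and `radius`
finds `r`. The oriented line is seen by `direction` for `r < 1`, where the factor `1 - r` is
nonzero; at `r = 1` only its complex line matters, and `hopf` sees that. -/
lemma eq_of_separating {x y : Collapsed} (h1 : blowDown x = blowDown y) (h2 : radius x = radius y)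
    (h3 : ∀ i, direction i x = direction i y) (h4 : hopf x = hopf y) : x = y := by
  obtain ⟨a, rfl⟩ | ⟨i, r, σ, p, rfl⟩ := exists_eq_off_or_collar x <;>
    obtain ⟨b, rfl⟩ | ⟨j, r', σ', p', rfl⟩ := exists_eq_off_or_collar y
  · exact congrArg off (Subtype.ext h1)
  · exact absurd h1.symm blowDown_collar_ne_off
  · exact absurd h1 blowDown_collar_ne_off
  · obtain ⟨rfl, rfl⟩ := eq_of_blowDown_collar h1
    obtain rfl : r = r' := h2
    by_cases hr : r = 1
    · subst hr
      refine Quot.sound (HopfRel.hopf _ _ _ _ (hopfMap_eq_iff.1 ?_))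
      have : ((1 : unitInterval) : ℝ) • hopfMap σ = ((1 : unitInterval) : ℝ) • hopfMap σ' := h4
      simpa using this
    · have hr' : (1 - (r : ℝ)) ≠ 0 := by
        intro h
        exact hr (Subtype.ext (sub_eq_zero.1 h).symm)
      have h5 : (1 - (r : ℝ)) • BlowUp.direction i (BlowUp.bdry i σ p) =
        (1 - (r : ℝ)) • BlowUp.direction i (BlowUp.bdry i σ' p) := h3 i
      have h6 := smul_right_injective _ hr' h5
      rw [BlowUp.direction_bdry_self, BlowUp.direction_bdry_self] at h6
      rw [BlowUp.unit_expDir_zero_injective h6]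

instance : T2Space Collapsed := by
  refine T2Space.of_injective_continuous
    (f := fun x => (blowDown x, radius x, (fun i => direction i x : Idx → Fin 4 → ℂ), hopf x))
    (fun x y h => ?_) ?_
  · simp only [Prod.mk.injEq] at h
    exact eq_of_separating h.1 h.2.1 (fun i => congrFun h.2.2.1 i) h.2.2.2
  · exact continuous_blowDown.prodMk (continuous_radius.prodMk
      ((continuous_pi fun i => continuous_direction i).prodMk continuous_hopf))

end Collapsed

instance : Nonempty S3 := ⟨⟨EuclideanSpace.single 0 1, by simp⟩⟩

/-! ### The group generated by `α` and `β` -/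

/-- The dihedral relation `βα = α²β`, which brings every word in the generators to the form `α^i
β^j`. -/
lemma beta_alpha (a : Torus7) : beta (alpha a) = alpha (alpha (beta a)) := by
  induction a using QuotientAddGroup.induction_on with
  | H v =>
    obtain ⟨z, x⟩ := v
    simp only [alpha, beta, QuotientAddGroup.map_mk, ← QuotientAddGroup.mk_add]
    simp only [xiHom, betaHom, AddMonoidHom.coe_mk, ZeroHom.coe_mk, Prod.mk_add_mk, add_zero]
    have hz : (fun j => -(starRingEnd ℂ) (xi * z j)) =
        fun j => xi * (xi * -(starRingEnd ℂ) (z j)) := by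
      funext j
      rw [map_mul, conj_xi]
      ring
    rw [hz]
    exact mk_eq_of_int ⟨1, by push_cast; ring⟩

namespace Collapsed

lemma alphaMap_alphaMap_alphaMap (x : Collapsed) : alphaMap (alphaMap (alphaMap x)) = x := by
  obtain ⟨a, rfl⟩ | ⟨⟨i, e⟩, r, σ, p, rfl⟩ := exists_eq_off_or_collar x
  · exact congrArg off (Subtype.ext (alpha_alpha_alpha a.1))
  · refine congrArg (fun j => collar (j, e) r σ p) (?_ : i + 1 + 1 + 1 = i)
    decide +revert

lemma betaMap_betaMap (x : Collapsed) : betaMap (betaMap x) = x := by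
  obtain ⟨a, rfl⟩ | ⟨⟨i, e⟩, r, σ, p, rfl⟩ := exists_eq_off_or_collar x
  · exact congrArg off (Subtype.ext (beta_beta a.1))
  · change collar (- -i, e) r (- -σ) p = _
    rw [neg_neg, neg_neg]

lemma betaMap_alphaMap (x : Collapsed) :
    betaMap (alphaMap x) = alphaMap (alphaMap (betaMap x)) := by
  obtain ⟨a, rfl⟩ | ⟨⟨i, e⟩, r, σ, p, rfl⟩ := exists_eq_off_or_collar x
  · exact congrArg off (Subtype.ext (beta_alpha a.1))
  · refine congrArg (fun j => collar (j, e) r (-σ) p) (?_ : -(i + 1) = -i + 1 + 1)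
    decide +revert

/-- The relation of lying in the same orbit of the group generated by `α` and `β`. -/
def SameOrbit (x y : Collapsed) : Prop := ∃ i j : ℕ, y = alphaMap^[i] (betaMap^[j] x)

lemma SameOrbit.refl (x : Collapsed) : SameOrbit x x := ⟨0, 0, rfl⟩

lemma SameOrbit.alphaMap {x y : Collapsed} (h : SameOrbit x y) : SameOrbit x (alphaMap y) := by
  obtain ⟨i, j, rfl⟩ := h
  exact ⟨i + 1, j, (Function.iterate_succ_apply' _ _ _).symm⟩

lemma SameOrbit.betaMap {x y : Collapsed} (h : SameOrbit x y) : SameOrbit x (betaMap y) := by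
  obtain ⟨i, j, rfl⟩ := h
  have hs : Function.Semiconj Collapsed.betaMap Collapsed.alphaMap Collapsed.alphaMap^[2] :=
    betaMap_alphaMap
  refine ⟨2 * i, j + 1, ?_⟩
  rw [(hs.iterate_right i).eq, ← Function.iterate_mul, Function.iterate_succ_apply']

lemma SameOrbit.iterate {x y : Collapsed} (h : SameOrbit x y) (i j : ℕ) :
    SameOrbit x (Collapsed.betaMap^[j] (Collapsed.alphaMap^[i] y)) := by
  have h1 : SameOrbit x (Collapsed.alphaMap^[i] y) := by
    induction i with
    | zero => exact h
    | succ i ih => rw [Function.iterate_succ_apply']; exact ih.alphaMap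
  induction j with
  | zero => exact h1
  | succ j ih => rw [Function.iterate_succ_apply']; exact ih.betaMap

lemma iterate_alphaMap_mod (i : ℕ) (x : Collapsed) : alphaMap^[i % 3] x = alphaMap^[i] x :=
  Function.IsPeriodicPt.iterate_mod_apply (n := 3) (alphaMap_alphaMap_alphaMap x) i

lemma iterate_betaMap_mod (j : ℕ) (x : Collapsed) : betaMap^[j % 2] x = betaMap^[j] x :=
  Function.IsPeriodicPt.iterate_mod_apply (n := 2) (betaMap_betaMap x) j

/-- The inverse of `α^i` is `α^(2i)`, and `β^j` is its own inverse. -/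
lemma SameOrbit.symm {x y : Collapsed} (h : SameOrbit x y) : SameOrbit y x := by
  obtain ⟨i, j, rfl⟩ := h
  have h1 := (SameOrbit.refl (Collapsed.alphaMap^[i] (Collapsed.betaMap^[j] x))).iterate (2 * i) j
  rwa [← Function.iterate_add_apply, show 2 * i + i = 3 * i by ring, ← iterate_alphaMap_mod (3 * i),
    Nat.mul_mod_right, Function.iterate_zero, id, ← Function.iterate_add_apply,
    ← iterate_betaMap_mod (j + j), ← two_mul, Nat.mul_mod_right] at h1

lemma SameOrbit.trans {x y z : Collapsed} (h : SameOrbit x y) (h' : SameOrbit y z) :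
    SameOrbit x z := by
  obtain ⟨i, j, rfl⟩ := h'
  have h1 := (h.iterate 0 j).iterate i 0
  exact h1

lemma sameOrbit_iff_mk_eq {x y : Collapsed} :
    SameOrbit x y ↔ (Quot.mk OrbitRel x : M) = Quot.mk OrbitRel y := by
  constructor
  · rintro ⟨i, j, rfl⟩
    have hβ : (Quot.mk OrbitRel x : M) = Quot.mk OrbitRel (betaMap^[j] x) := by
      induction j with
      | zero => rfl
      | succ j ih =>
        rw [Function.iterate_succ_apply']
        exact ih.trans (Quot.sound (OrbitRel.beta _))
    rw [hβ]
    generalize betaMap^[j] x = y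
    induction i with
    | zero => rfl
    | succ i ih =>
      rw [Function.iterate_succ_apply']
      exact ih.trans (Quot.sound (OrbitRel.alpha _))
  · intro h
    have h' := Quot.eqvGen_exact h
    clear h
    induction h' with
    | rel x y h =>
      cases h with
      | alpha => exact (SameOrbit.refl x).alphaMap
      | beta => exact (SameOrbit.refl x).betaMap
    | refl x => exact SameOrbit.refl x
    | symm x y h ih => exact ih.symm
    | trans x y z h h' ih ih' =>
      exact ih.trans ih'

lemma sameOrbit_iff_exists_fin {x y : Collapsed} :
    SameOrbit x y ↔ ∃ (i : Fin 3) (j : Fin 2), y = alphaMap^[i] (betaMap^[j] x) := by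
  constructor
  · rintro ⟨i, j, rfl⟩
    refine ⟨⟨i % 3, Nat.mod_lt _ (by norm_num)⟩, ⟨j % 2, Nat.mod_lt _ (by norm_num)⟩, ?_⟩
    rw [iterate_alphaMap_mod, iterate_betaMap_mod]
  · rintro ⟨i, j, rfl⟩
    exact ⟨i, j, rfl⟩

lemma continuous_iterate (i j : ℕ) : Continuous fun x => alphaMap^[i] (betaMap^[j] x) :=
  (continuous_alphaMap.iterate i).comp (continuous_betaMap.iterate j)

end Collapsed

/-! ### The quotient by the finite group -/

namespace M

open Collapsed

/-- The quotient map. -/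
def mk (x : Collapsed) : M := Quot.mk OrbitRel x

lemma mk_eq_mk_iff {x y : Collapsed} : mk x = mk y ↔ SameOrbit x y :=
  sameOrbit_iff_mk_eq.symm

lemma isQuotientMap_mk : IsQuotientMap mk := isQuotientMap_quot_mk

/-- The saturation of an open set is a finite union of its preimages under the continuous maps `α^i
β^j`. -/
lemma isOpenQuotientMap_mk : IsOpenQuotientMap mk := by
  refine ⟨isQuotientMap_mk.surjective, isQuotientMap_mk.continuous, fun U hU => ?_⟩
  rw [← isQuotientMap_mk.isOpen_preimage]
  have : mk ⁻¹' (mk '' U) =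
      ⋃ (i : Fin 3) (j : Fin 2), (fun x => alphaMap^[i] (betaMap^[j] x)) ⁻¹' U := by
    ext x
    simp only [mem_preimage, mem_image, mem_iUnion]
    constructor
    · rintro ⟨y, hy, h⟩
      obtain ⟨i, j, rfl⟩ := sameOrbit_iff_exists_fin.1 (mk_eq_mk_iff.1 h.symm)
      exact ⟨i, j, hy⟩
    · rintro ⟨i, j, h⟩
      exact ⟨_, h, (mk_eq_mk_iff.2 ⟨i, j, rfl⟩).symm⟩
  rw [this]
  exact isOpen_iUnion fun i => isOpen_iUnion fun j => hU.preimage (continuous_iterate i j)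

instance : CompactSpace M := isQuotientMap_mk.surjective.compactSpace isQuotientMap_mk.continuous

/-- The orbit relation is a finite union of graphs of continuous maps of a Hausdorff space, hence
closed; for an open quotient map this suffices. -/
instance : T2Space M := by
  rw [t2Space_iff_of_isOpenQuotientMap isOpenQuotientMap_mk]
  have : {q : Collapsed × Collapsed | mk q.1 = mk q.2} =
      ⋃ (i : Fin 3) (j : Fin 2), {q | q.2 = alphaMap^[i] (betaMap^[j] q.1)} := by
    ext q
    simp only [mk_eq_mk_iff, sameOrbit_iff_exists_fin, mem_ofPred_eq, mem_iUnion]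
  rw [this]
  exact isClosed_iUnion_of_finite fun i => isClosed_iUnion_of_finite fun j =>
    isClosed_eq continuous_snd ((continuous_iterate i j).comp continuous_fst)

lemma finite_preimage_singleton (y : M) : (mk ⁻¹' {y}).Finite := by
  obtain ⟨x, rfl⟩ := isQuotientMap_mk.surjective y
  refine (finite_range fun q : Fin 3 × Fin 2 => alphaMap^[q.1] (betaMap^[q.2] x)).subset ?_
  intro z hz
  obtain ⟨i, j, rfl⟩ := sameOrbit_iff_exists_fin.1 (mk_eq_mk_iff.1 (Eq.symm hz))
  exact ⟨(i, j), rfl⟩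

end M

lemma semiconj_mk (T : SpecialLinearGroup (Fin 3) ℤ)
    (γ : Path (toReal T) (1 : SpecialLinearGroup (Fin 3) ℝ)) :
    Function.Semiconj M.mk (Collapsed.map T γ) (fMap T γ) := fun _ => rfl

lemma continuous_fMap (T : SpecialLinearGroup (Fin 3) ℤ)
    (γ : Path (toReal T) (1 : SpecialLinearGroup (Fin 3) ℝ)) : Continuous (fMap T γ) := by
  rw [M.isQuotientMap_mk.continuous_iff, ← (semiconj_mk T γ).comp_eq]
  exact M.isQuotientMap_mk.continuous.comp (Collapsed.continuous_map T γ)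

/-! ### Invertibility -/

lemma extend_extend (G H : SpecialLinearGroup (Fin 3) ℝ) (w : C2) :
    extend G (extend H w) = extend (G * H) w :=
  C2_ext (by simp only [re3_extend, Matrix.mulVec_mulVec, Matrix.SpecialLinearGroup.coe_mul])
    (by simp only [extend_im])

lemma ray_ray {G H : SpecialLinearGroup (Fin 3) ℝ} (h : G * H = 1) (σ : S3) :
    ray G (ray H σ) = σ := by
  have hne : ‖extend H σ.1‖ ≠ 0 :=
    norm_ne_zero_iff.2 (extend_ne_zero H (ne_zero_of_mem_unit_sphere σ))
  apply Subtype.ext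
  change (‖extend G (_ • extend H σ.1)‖⁻¹ : ℝ) • extend G ((‖extend H σ.1‖⁻¹ : ℝ) • extend H σ.1) = _
  rw [extend_smul, extend_extend, h, extend_one, norm_smul, mem_sphere_zero_iff_norm.mp σ.2,
    norm_inv, norm_norm, smul_smul]
  field_simp
  rw [one_smul]

lemma lin3_lin3 {S T : SpecialLinearGroup (Fin 3) ℤ} (h : S * T = 1) (p : Torus3) :
    lin3 S (lin3 T p) = p := by
  induction p using QuotientAddGroup.induction_on with
  | H y =>
    rw [lin3, lin3, QuotientAddGroup.map_mk, QuotientAddGroup.map_mk]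
    congr 1
    have h1 : toReal S * toReal T = 1 := by
      rw [toReal, toReal, ← map_mul, h, map_one]
    change (toReal S).1 *ᵥ ((toReal T).1 *ᵥ y) = y
    rw [Matrix.mulVec_mulVec, ← Matrix.SpecialLinearGroup.coe_mul]
    change (toReal S * toReal T).1 *ᵥ y = y
    rw [h1]
    simp

lemma Collapsed.map_map {S T : SpecialLinearGroup (Fin 3) ℤ} (h : S * T = 1)
    {δ : Path (toReal S) (1 : SpecialLinearGroup (Fin 3) ℝ)}
    {γ : Path (toReal T) (1 : SpecialLinearGroup (Fin 3) ℝ)} (hδ : ∀ t, δ t * γ t = 1)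
    (x : Collapsed) : map S δ (map T γ x) = x := by
  obtain ⟨a, rfl⟩ | ⟨i, r, σ, p, rfl⟩ := exists_eq_off_or_collar x
  · obtain rfl := eq_inv_of_mul_eq_one_left h
    exact congrArg off (Subtype.ext (lin_inv_lin T a.1))
  · change collar i r (ray (δ r) (ray (γ r) σ)) (lin3 S (lin3 T p)) = _
    rw [ray_ray (hδ r), lin3_lin3 h]

lemma fMap_fMap {S T : SpecialLinearGroup (Fin 3) ℤ} (h : S * T = 1)
    {δ : Path (toReal S) (1 : SpecialLinearGroup (Fin 3) ℝ)}
    {γ : Path (toReal T) (1 : SpecialLinearGroup (Fin 3) ℝ)} (hδ : ∀ t, δ t * γ t = 1)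
    (x : M) : fMap S δ (fMap T γ x) = x := by
  obtain ⟨x, rfl⟩ := M.isQuotientMap_mk.surjective x
  exact congrArg M.mk (Collapsed.map_map h hδ x)

/-- The inverse is the map built from `T⁻¹` and the path `t ↦ γ(t)⁻¹`. -/
lemma isHomeomorph_fMap (T : SpecialLinearGroup (Fin 3) ℤ)
    (γ : Path (toReal T) (1 : SpecialLinearGroup (Fin 3) ℝ)) : IsHomeomorph (fMap T γ) := by
  let δ : Path (toReal T⁻¹) (1 : SpecialLinearGroup (Fin 3) ℝ) :=
    { toFun := fun t => (γ t)⁻¹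
      continuous_toFun := γ.continuous.inv
      source' := by rw [γ.source, toReal, toReal, map_inv]
      target' := by rw [γ.target, inv_one] }
  refine isHomeomorph_iff_continuous_bijective.2 ⟨continuous_fMap T γ,
    Function.LeftInverse.injective (g := fMap T⁻¹ δ) (fMap_fMap (inv_mul_cancel T) fun t => ?_),
    Function.RightInverse.surjective (g := fMap T⁻¹ δ) (fMap_fMap (mul_inv_cancel T) fun t => ?_)⟩
  · exact inv_mul_cancel (γ t)
  · exact mul_inv_cancel (γ t)

/-! ### Entropy along the fibres and the conclusion. -/

lemma TopEntropyLE.subset {X : Type*} [TopologicalSpace X] {S : X → X} {F F' : Set X} {H : ℝ}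
    (h : TopEntropyLE S F' H) (hF : F ⊆ F') : TopEntropyLE S F H := fun U hU H' hH' =>
  (h U hU H' hH').mono fun _ hn => hn.mono hF le_rfl fun _ _ _ _ => id

/-- A slice is not invariant: at time `k` it has moved to the slice over `Q^k b`. Within it the
motion is still `R^k`, so labels for `R` work at all times, provided closeness in `A` implies
closeness in `X` uniformly over `B`. -/
lemma TopEntropyLE.of_skew {A B X : Type*} [TopologicalSpace A] [TopologicalSpace B]
    [CompactSpace B] [TopologicalSpace X] [Nonempty A] {g : A × B → X} (hg : Continuous g)
    {R : A → A} {Q : B → B} {S : X → X} (hsemi : Function.Semiconj g (Prod.map R Q) S) {H : ℝ}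
    (hR : TopEntropyLE R univ H) (b : B) : TopEntropyLE S (range fun a => g (a, b)) H := by
  intro U hU H' hH'
  -- Compactness of `B` makes this uniform condition a neighbourhood of the diagonal.
  have hW : {q : A × A | ∀ b ∈ (univ : Set B), (g (q.1, b), g (q.2, b)) ∈ U} ∈
      𝓝ˢ (diagonal A) := by
    rw [mem_nhdsSet_iff_forall]
    rintro ⟨a, a'⟩ (rfl : a = a')
    refine isCompact_univ.eventually_forall_of_forall_eventually fun b _ => ?_
    have h1 : Continuous fun z : (A × A) × B => (g (z.1.1, z.2), g (z.1.2, z.2)) :=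
      (hg.comp (by fun_prop)).prodMk (hg.comp (by fun_prop))
    exact h1.continuousAt.eventually (mem_nhdsSet_iff_forall.1 hU (g (a, b), g (a, b)) rfl)
  filter_upwards [hR _ hW H' hH'] with n hn
  refine (hn.comap (Function.invFun fun a => g (a, b))).mono (subset_univ _) le_rfl
    fun x hx y hy hxy k hk => ?_
  have h1 := hxy k hk (Q^[k] b) (mem_univ _)
  have h2 (a : A) : g (R^[k] a, Q^[k] b) = S^[k] (g (a, b)) := by
    rw [← (hsemi.iterate_right k).eq, Prod.map_iterate]
    rfl
  have hx' := Function.invFun_eq hx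
  have hy' := Function.invFun_eq hy
  simp only [h2] at h1
  rwa [hx', hy'] at h1

section

variable (T : SpecialLinearGroup (Fin 3) ℤ)
  (γ : Path (toReal T) (1 : SpecialLinearGroup (Fin 3) ℝ))

namespace Collapsed

lemma semiconj_blowDown : Function.Semiconj blowDown (map T γ) (lin T) := by
  intro x
  obtain ⟨a, rfl⟩ | ⟨i, r, σ, p, rfl⟩ := exists_eq_off_or_collar x
  · rfl
  · change tau i 0 (lin3 T p) = lin T (tau i 0 p)
    rw [lin_tau, extend_zero]

lemma radius_map (x : Collapsed) : radius (map T γ x) = radius x := by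
  obtain ⟨a, rfl⟩ | ⟨i, r, σ, p, rfl⟩ := exists_eq_off_or_collar x <;> rfl

lemma surjective_blowDown : Function.Surjective blowDown := by
  intro a
  by_cases ha : a ∈ sing
  · obtain ⟨i, p, rfl⟩ := ha
    exact ⟨collar i 0 (Classical.arbitrary S3) p, rfl⟩
  · exact ⟨off ⟨a, ha⟩, rfl⟩

/-- At a fixed height `r` the sphere direction evolves by one fixed matrix `γ(r)`, while `T` moves
the torus coordinate independently. -/
lemma topEntropyLE_collar (i : Idx) (r : unitInterval) (p : Torus3) :
    TopEntropyLE (map T γ) (range fun σ => collar i r σ p) 0 :=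
  TopEntropyLE.of_skew (g := fun q : S3 × Torus3 => collar i r q.1 q.2)
    (continuous_collar.comp (f := fun q : S3 × Torus3 => (i, r, q.1, q.2)) (by fun_prop))
    (Q := lin3 T) (fun _ => rfl) (topEntropyLE_ray (γ r)) p

/-- Recording the collar height in the base is what keeps the matrix constant on each fibre; a fibre
of the blow-down alone would mix all the matrices `γ(r)`. -/
lemma topEntropyLE_fiber (y : Torus7 × unitInterval) :
    TopEntropyLE (map T γ) ((fun x => (blowDown x, radius x)) ⁻¹' {y}) 0 := by
  obtain ⟨a, r⟩ := y
  by_cases ha : a ∈ sing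
  · obtain ⟨i, p, rfl⟩ := ha
    refine (topEntropyLE_collar T γ i r p).subset fun x hx => ?_
    have h1 : blowDown x = tau i 0 p := congrArg Prod.fst hx
    have h2 : radius x = r := congrArg Prod.snd hx
    obtain ⟨a, rfl⟩ | ⟨j, s, σ, q, rfl⟩ := exists_eq_off_or_collar x
    · exact absurd ⟨i, p, h1⟩ a.2
    · obtain ⟨rfl, rfl⟩ := eq_of_blowDown_collar (r' := r) (σ' := σ) h1
      obtain rfl : s = r := h2
      exact ⟨σ, rfl⟩
  · refine TopEntropyLE.of_finite ((finite_singleton (off ⟨a, ha⟩)).subset fun x hx => ?_) le_rfl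
    have h1 : blowDown x = a := congrArg Prod.fst hx
    obtain ⟨b, rfl⟩ | ⟨j, s, σ, q, rfl⟩ := exists_eq_off_or_collar x
    · exact congrArg off (Subtype.ext h1)
    · exact absurd ⟨j, q, h1.symm⟩ ha

theorem topEntropyLE_map : TopEntropyLE (map T γ) univ (expansionRate T) :=
  TopEntropyLE.of_fibers (π := fun x => (blowDown x, radius x)) (continuous_map T γ)
    (continuous_blowDown.prodMk continuous_radius)
    (fun x => Prod.ext (semiconj_blowDown T γ x) (radius_map T γ x)) (topEntropyLE_lin T)
    (topEntropyLE_fiber T γ)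

end Collapsed

instance : Nonempty M := (Collapsed.surjective_blowDown 0).nonempty.map M.mk

/-- The upper bound passes to `M` as a factor of `M̃`. For the lower bound, a smaller entropy on `M`
would lift to `M̃` by Bowen's inequality, the orbits being finite, and then descend to the torus,
against the volume estimate. -/
theorem topologicalEntropy_fMap : topologicalEntropy (fMap T γ) = (expansionRate T : EReal) := by
  refine le_antisymm (topologicalEntropy_le_iff.2 ?_) (not_lt.1 fun h => ?_)
  · exact (Collapsed.topEntropyLE_map T γ).of_surjective M.isQuotientMap_mk.continuous
      M.isQuotientMap_mk.surjective (semiconj_mk T γ)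
  · obtain ⟨H, h1, h2⟩ := EReal.lt_iff_exists_real_btwn.1 h
    have h3 : TopEntropyLE (Collapsed.map T γ) univ H :=
      TopEntropyLE.of_fibers (Collapsed.continuous_map T γ) M.isQuotientMap_mk.continuous
        (semiconj_mk T γ) (topologicalEntropy_le_iff.1 h1.le) fun y =>
          TopEntropyLE.of_finite (M.finite_preimage_singleton y) le_rfl
    have h4 := expansionRate_le (h3.of_surjective Collapsed.continuous_blowDown
      Collapsed.surjective_blowDown (Collapsed.semiconj_blowDown T γ))
    exact absurd (EReal.coe_lt_coe_iff.1 h2) (not_lt.2 h4)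

end

end JoyceManifold

end

open Classical in
theorem theorem3p3 (T : Matrix.SpecialLinearGroup (Fin 3) ℤ)
    (γ : Path (JoyceManifold.toReal T) (1 : Matrix.SpecialLinearGroup (Fin 3) ℝ)) :
    ∃ (_ : CompactSpace JoyceManifold.M) (_ : T2Space JoyceManifold.M),
      IsHomeomorph (JoyceManifold.fMap T γ) ∧
      JoyceManifold.topologicalEntropy (JoyceManifold.fMap T γ) =
        ((2 * (((JoyceManifold.eigenvalues T).filter fun l => 1 < ‖l‖).map
          fun l => Real.log ‖l‖).sum : ℝ) : EReal) :=
  ⟨inferInstance, inferInstance, JoyceManifold.isHomeomorph_fMap T γ,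
    JoyceManifold.topologicalEntropy_fMap T γ⟩
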